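/- **Setting.** Fix $n\ge 0$ and variables $z_1,\dots,z_n,y,\lambda$. Let $\mathcal L=\mathcal L_{\lambda,(z,y)}=\mathcal L_{\lambda,y}\otimes_{\mathbb C[y]}\mathbb C(z,y)$, where $\mathcal L_{\lambda,y}$ is the algebra of fractions $f/g$ with $f\in\mathbb C[\lambda,y]$ and $g$ a finite product of factors $\lambda+ly$, $l\in\mathbb Z$. For $0\le k\le n$ put $\Gamma=(\gamma_{1,1},\dots,\gamma_{1,k};\gamma_{2,1},\dots,\gamma_{2,n-k})$. Let $T=(\mathbb C^\times)^n\times\mathbb C^\times$ act on $T^*\mathrm{Gr}_k=T^*\mathrm{Gr}_k(\mathbb C^n)$, the last factor scaling the fibers, and use the standard presentation $$H^*_T(T^*\mathrm{Gr}_k)=\mathbb C[\Gamma,z,y]^{S_k\times S_{n-k}}\Big/\Big\langle\text{coefficients of }\textstyle\prod_{i}(u-\gamma_{1,i})\prod_{j}(u-\gamma_{2,j})-\prod_{a}(u-z_a)\Big\rangle .$$ Write $\mathcal X_n=\coprod_{k=0}^nT^*\mathrm{Gr}_k$, and $\otimes\mathcal L$ for $\otimes_{\mathbb C[z,y]}\mathcal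 L$. For $J\subset[n]$, $|J|=k$, restriction to the fixed point $x_J$ is the substitution $\{\gamma_{1,*}\}\mapsto z_J=\{z_a\}_{a\in J}$, $\{\gamma_{2,*}\}\mapsto\{z_a\}_{a\notin J}$; these restrictions give an isomorphism $H_T^*(\mathcal X_n)\otimes\mathcal L\cong\bigoplus_{J\subset[n]}\mathcal L$. *Stable envelope.* For $I=\{i_1<\dots<i_k\}\subset[n]$ let $w(i,I)=\#\{j>i,\,j\in I\}-\#\{j>i,\,j\notin I\}$, $$W_I(\lambda,t,z,y)=y^k\sum_{\sigma\in S_k}\Big(\prod_{r=1}^k\prod_{a=1}^n l_I(r,a)\prod_{a<b}\frac{t_a-t_b+y}{t_a-t_b}\Big)\Big|_{t_r\mapsto t_{\sigma(r)}},$$ where $l_I(r,a)$ is $t_r-z_a+y$ if $a<i_r$, $\lambda+t_r-z_a-w(i_r,I)y$ if $a=i_r$, and $t_r-z_a$ if $a>i_r$. Put $$\tilde W^+_I=\frac{W_I}{\prod_{i\in I}(\lambda-w(i,I)y)(\lambda-(w(i,I)+1)y)\ \prod_{a,b=1}^k(t_a-t_b+y)} .$$ Let $v_1,v_2$ be the standard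 basis of $\mathbb C^2$ and $v_I=v_{i_1}\otimes\cdots\otimes v_{i_n}$ with $i_j=1$ if $j\in I$ and $i_j=2$ otherwise. $\mathrm{Stab}_{\mathrm{id}}:(\mathbb C^2)^{\otimes n}\otimes\mathcal L\to H^*_T(\mathcal X_n)\otimes\mathcal L$ is the $\mathcal L$-linear map sending $v_I$ to the class whose restriction to $x_J$ is $\tilde W^+_I(\lambda,z_J,z,y)$ if $|J|=|I|$ and $0$ otherwise. *Operators.* Let $R(\lambda,z,y)$ be the operator on $\mathbb C^2\otimes\mathbb C^2$ fixing $v_1\otimes v_1$ and $v_2\otimes v_2$, with $$v_1\otimes v_2\mapsto\tfrac{(\lambda+y)z}{\lambda(z-y)}v_1\otimes v_2-\tfrac{(\lambda-z)y}{\lambda(z-y)}v_2\otimes v_1,\qquad v_2\otimes v_1\mapsto-\tfrac{(\lambda+z)y}{\lambda(z-y)}v_1\otimes v_2+\tfrac{(\lambda-y)z}{\lambda(z-y)}v_2\otimes v_1 .$$ Let $h^{(j)}$ act on the $j$-th factor by $hv_1=v_1$, $hv_2=-v_2$, and on $\mathbb C^2\otimes(\mathbb C^2)^{\otimes n}$ (auxiliary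 factor number $0$) put $$L(\lambda,w,y)=R^{(0,1)}\Big(\lambda-y\sum_{j=2}^nh^{(j)},w-z_1,y\Big)\cdots R^{(0,n-1)}\big(\lambda-yh^{(n)},w-z_{n-1},y\big)\,R^{(0,n)}(\lambda,w-z_n,y),$$ with entries $L_{ij}$ given by $L(v_j\otimes\zeta)=\sum_iv_i\otimes L_{ij}\zeta$ and expanded in powers of $w^{-1}$. With $(\delta\zeta)(\lambda)=\zeta(\lambda+y)$ let $\tilde L_{i1}=L_{i1}\delta^{-1}$, $\tilde L_{i2}=L_{i2}\delta$, and $$\tilde F(w)=\tilde L_{12}(w)\tilde L_{22}(w)^{-1},\qquad\tilde E(w)=\tilde L_{22}(w)^{-1}\tilde L_{21}(w),$$ power series in $w^{-1}$ whose coefficients are operators on $(\mathbb C^2)^{\otimes n}\otimes\mathcal L$. **Proposition.** $\mathrm{Stab}_{\mathrm{id}}$ is an isomorphism and $\tilde L_{22}(w)$ is invertible. Conjugated by $\mathrm{Stab}_{\mathrm{id}}$, the series $\tilde F(w)$ and $\tilde E(w)$ act as follows on classes $[f]$, $f\in\mathbb C[\Gamma,z,y]^{S_k\times S_{n-k}}\otimes\mathcal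 L$, where rational functions of $w$ are expanded in powers of $w^{-1}$. 1. For $1\le k\le n$, $\tilde F(w):H^*_T(T^*\mathrm{Gr}_k)\otimes\mathcal L\to H^*_T(T^*\mathrm{Gr}_{k-1})\otimes\mathcal L$ sends $[f(\lambda,\Gamma,z,y)]$ to $$\left[(-1)^{k-1}c_F\sum_{i=1}^{n-k+1}\frac{f(\lambda,\Gamma^{'i},z,y)}{w-\gamma_{2,i}}\,(\lambda+w-\gamma_{2,i}+y(n-2k+1))\,\frac{\prod_{j=1}^{k-1}(\gamma_{2,i}-\gamma_{1,j}-y)}{\prod_{j\ne i}(\gamma_{2,i}-\gamma_{2,j})}\right],\qquad c_F=-y,$$ where $\Gamma^{'i}=(\gamma_{1,1},\dots,\gamma_{1,k-1},\gamma_{2,i};\gamma_{2,1},\dots,\check\gamma_{2,i},\dots,\gamma_{2,n-k+1})$ and $\check{\ }$ means omission. 2. For $0\le k\le n-1$, $\tilde E(w):H^*_T(T^*\mathrm{Gr}_k)\otimes\mathcal L\to H^*_T(T^*\mathrm{Gr}_{k+1})\otimes\mathcal L$ sends $[f(\lambda,\Gamma,z,y)]$ to $$\left[(-1)^{n-k-1}c_E\sum_{i=1}^{k+1}\frac{f(\lambda-2y,\Gamma^{i'},z,y)}{w-\gamma_{1,i}}\,(\lambda-w+\gamma_{1,i}-y)\,\frac{\prod_{j=1}^{n-k-1}(\gamma_{2,j}-\gamma_{1,i}-y)}{\prod_{j\ne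 i}(\gamma_{1,j}-\gamma_{1,i})}\right],\qquad c_E=\frac{-y}{(\lambda-y)(\lambda-2y)},$$ where $\Gamma^{i'}=(\gamma_{1,1},\dots,\check\gamma_{1,i},\dots,\gamma_{1,k+1};\gamma_{1,i},\gamma_{2,1},\dots,\gamma_{2,n-k-1})$. In both formulas every coefficient of the expansion of the bracket in powers of $w^{-1}$ is an $S\times S$-symmetric polynomial in the Chern roots of the target with coefficients in $\mathcal L$, so that its class is defined. Moreover $\tilde F(w)$ is zero on the summand $k=0$ and $\tilde E(w)$ is zero on the summand $k=n$. -/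

import Mathlib

open scoped TensorProduct

noncomputable section

/-! ### Coefficient rings -/

/-- `ℂ[z₁,…,zₙ,y] = H*_T(pt)`; the variable `some i` is `z_i` and `none` is `y`. -/
def BaseRing (n : ℕ) : Type := MvPolynomial (Option (Fin n)) ℂ

instance (n : ℕ) : CommRing (BaseRing n) :=
  inferInstanceAs (CommRing (MvPolynomial (Option (Fin n)) ℂ))

instance (n : ℕ) : Algebra ℂ (BaseRing n) :=
  inferInstanceAs (Algebra ℂ (MvPolynomial (Option (Fin n)) ℂ))

instance (n : ℕ) : IsDomain (BaseRing n) :=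
  inferInstanceAs (IsDomain (MvPolynomial (Option (Fin n)) ℂ))

def zBase {n : ℕ} (i : Fin n) : BaseRing n :=
  (MvPolynomial.X (some i) : MvPolynomial (Option (Fin n)) ℂ)

def yBase (n : ℕ) : BaseRing n := (MvPolynomial.X none : MvPolynomial (Option (Fin n)) ℂ)

/-- The multiplicative set of `ℂ[z,y][λ]` generated by the nonzero polynomials in `z, y` and by the
polynomials `λ + l y`, `l ∈ ℤ`. -/
def denominators (n : ℕ) : Submonoid (Polynomial (BaseRing n)) :=
  Submonoid.closure
    ({f | ∃ r : BaseRing n, r ≠ 0 ∧ f = Polynomial.C r} ∪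
      {f | ∃ l : ℤ, f = Polynomial.X + Polynomial.C ((l : BaseRing n) * yBase n)})

/-- The ring `𝓛_{λ,(z,y)} = 𝓛_{λ,y} ⊗_{ℂ[y]} ℂ(z,y)`. Since `𝓛_{λ,y}` is the localization of
`ℂ[λ,y]` at the products of the `λ + l y` and `ℂ(z,y)` is the localization of `ℂ[z,y]` at the
nonzero polynomials, their tensor product over `ℂ[y]` is the localization of `ℂ[z,y][λ]` at the
multiplicative set generated by both families of denominators. -/
def CoeffRing (n : ℕ) : Type := Localization (denominators n)

instance (n : ℕ) : CommRing (CoeffRing n) :=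
  inferInstanceAs (CommRing (Localization (denominators n)))

instance (n : ℕ) : Algebra (Polynomial (BaseRing n)) (CoeffRing n) :=
  inferInstanceAs (Algebra (Polynomial (BaseRing n)) (Localization (denominators n)))

instance (n : ℕ) : IsLocalization (denominators n) (CoeffRing n) :=
  inferInstanceAs (IsLocalization (denominators n) (Localization (denominators n)))

instance (n : ℕ) : Algebra (BaseRing n) (CoeffRing n) :=
  inferInstanceAs (Algebra (BaseRing n) (Localization (denominators n)))

instance (n : ℕ) : IsScalarTower (BaseRing n) (Polynomial (BaseRing n)) (CoeffRing n) :=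
  inferInstanceAs
    (IsScalarTower (BaseRing n) (Polynomial (BaseRing n)) (Localization (denominators n)))

theorem denominators_le (n : ℕ) :
    denominators n ≤ nonZeroDivisors (Polynomial (BaseRing n)) := by
  refine Submonoid.closure_le.2 ?_
  rintro f (⟨r, hr, rfl⟩ | ⟨l, rfl⟩)
  · exact mem_nonZeroDivisors_of_ne_zero (Polynomial.C_ne_zero.2 hr)
  · exact mem_nonZeroDivisors_of_ne_zero (Polynomial.X_add_C_ne_zero _)

instance (n : ℕ) : IsDomain (CoeffRing n) :=
  IsLocalization.isDomain_localization (denominators_le n)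

/-- The elements `λ`, `y`, `z_i` of `𝓛_{λ,(z,y)}`. -/
def lam (n : ℕ) : CoeffRing n := algebraMap (Polynomial (BaseRing n)) (CoeffRing n) Polynomial.X

def yy (n : ℕ) : CoeffRing n := algebraMap (BaseRing n) (CoeffRing n) (yBase n)

def zz {n : ℕ} (i : Fin n) : CoeffRing n := algebraMap (BaseRing n) (CoeffRing n) (zBase i)

theorem isUnit_lam_add (n : ℕ) (l : ℤ) : IsUnit (lam n + (l : CoeffRing n) * yy n) := by
  have h := IsLocalization.map_units (CoeffRing n)
    (⟨Polynomial.X + Polynomial.C ((l : BaseRing n) * yBase n),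
      Submonoid.subset_closure (Or.inr ⟨l, rfl⟩)⟩ : denominators n)
  have e : algebraMap (Polynomial (BaseRing n)) (CoeffRing n)
      (Polynomial.X + Polynomial.C ((l : BaseRing n) * yBase n))
      = lam n + (l : CoeffRing n) * yy n := by
    rw [map_add, map_mul, map_mul, yy,
      IsScalarTower.algebraMap_apply (BaseRing n) (Polynomial (BaseRing n)) (CoeffRing n)]
    simp [lam]
  rw [← e]
  exact h

theorem isUnit_base (n : ℕ) (r : BaseRing n) (hr : r ≠ 0) :
    IsUnit (algebraMap (BaseRing n) (CoeffRing n) r) := by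
  have h := IsLocalization.map_units (CoeffRing n)
    (⟨Polynomial.C r, Submonoid.subset_closure (Or.inl ⟨r, hr, rfl⟩)⟩ : denominators n)
  rw [IsScalarTower.algebraMap_apply (BaseRing n) (Polynomial (BaseRing n)) (CoeffRing n)]
  exact h

theorem isUnit_shift (n : ℕ) (m : ℤ) (f : denominators n) :
    IsUnit (Polynomial.aeval (lam n + (m : CoeffRing n) * yy n)
      (f : Polynomial (BaseRing n))) := by
  obtain ⟨f, hf⟩ := f
  induction hf using Submonoid.closure_induction with
  | mem f hf =>
    rcases hf with ⟨r, hr, rfl⟩ | ⟨l, rfl⟩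
    · simpa using isUnit_base n r hr
    · have := isUnit_lam_add n (m + l)
      have e : lam n + ((m + l : ℤ) : CoeffRing n) * yy n =
          lam n + (m : CoeffRing n) * yy n + (l : CoeffRing n) * yy n := by
        push_cast; ring
      rw [e] at this
      simpa [yy] using this
  | one => simp
  | mul f g _ _ hf hg =>
    have := hf.mul hg
    simpa using this

/-- The substitution `λ ↦ λ + m y` on `𝓛_{λ,(z,y)}`, fixing `z` and `y`. -/
def shift (n : ℕ) (m : ℤ) : CoeffRing n →ₐ[BaseRing n] CoeffRing n :=
  IsLocalization.liftAlgHom (M := denominators n)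
    (f := Polynomial.aeval (lam n + (m : CoeffRing n) * yy n)) (isUnit_shift n m)

/-! ### Equivariant cohomology of the cotangent bundles -/

/-- `ℂ[Γ,z,y]`, `Γ = (γ_{1,1},…,γ_{1,p}; γ_{2,1},…,γ_{2,q})`: the variable `Sum.inl i` is `γ_{1,i}`
and `Sum.inr j` is `γ_{2,j}`. -/
abbrev RootRing (n p q : ℕ) : Type := MvPolynomial (Fin p ⊕ Fin q) (BaseRing n)

/-- `ℂ[Γ,z,y]^{S_p × S_q}`. -/
def invRing (n p q : ℕ) : Subalgebra (BaseRing n) (RootRing n p q) where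
  carrier := {f | ∀ (σ : Equiv.Perm (Fin p)) (τ : Equiv.Perm (Fin q)),
    MvPolynomial.rename (Equiv.sumCongr σ τ) f = f}
  mul_mem' := fun ha hb σ τ => by rw [map_mul, ha σ τ, hb σ τ]
  add_mem' := fun ha hb σ τ => by rw [map_add, ha σ τ, hb σ τ]
  algebraMap_mem' := fun r σ τ => AlgHom.commutes _ r

/-- The polynomial `∏ᵢ (u - γ_{1,i}) ∏ⱼ (u - γ_{2,j}) - ∏ₐ (u - z_a)` in `u`. -/
def relPoly (n p q : ℕ) : Polynomial (RootRing n p q) :=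
  (∏ i : Fin p, (Polynomial.X - Polynomial.C (MvPolynomial.X (Sum.inl i)))) *
    (∏ j : Fin q, (Polynomial.X - Polynomial.C (MvPolynomial.X (Sum.inr j)))) -
    ∏ a : Fin n, (Polynomial.X - Polynomial.C (MvPolynomial.C (zBase a)))

/-- The ideal of `ℂ[Γ,z,y]^{S_p × S_q}` generated by the coefficients of `relPoly`. -/
def relIdeal (n p q : ℕ) : Ideal (invRing n p q) :=
  Ideal.span {x | ∃ m : ℕ, (x : RootRing n p q) = (relPoly n p q).coeff m}

/-- `H*_T(T*Gr_p(ℂⁿ))`, for `p + q = n`. -/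
def Coh (n p q : ℕ) : Type := invRing n p q ⧸ relIdeal n p q

instance (n p q : ℕ) : CommRing (Coh n p q) :=
  inferInstanceAs (CommRing (invRing n p q ⧸ relIdeal n p q))

instance (n p q : ℕ) : Algebra (BaseRing n) (Coh n p q) :=
  inferInstanceAs (Algebra (BaseRing n) (invRing n p q ⧸ relIdeal n p q))

/-- The quotient map `ℂ[Γ,z,y]^{S_p × S_q} → H*_T(T*Gr_p(ℂⁿ))`. -/
def cohMk (n p q : ℕ) : invRing n p q →ₐ[BaseRing n] Coh n p q :=
  Ideal.Quotient.mkₐ (BaseRing n) (relIdeal n p q)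

/-- `ℂ[Γ,z,y]^{S_p × S_q} ⊗ 𝓛_{λ,(z,y)}`: the symmetric functions `f(λ,Γ,z,y)`. -/
abbrev InvL (n p q : ℕ) : Type := CoeffRing n ⊗[BaseRing n] invRing n p q

/-- `H*_T(T*Gr_p(ℂⁿ)) ⊗ 𝓛_{λ,(z,y)}`, for `p + q = n`. -/
abbrev CohL (n p q : ℕ) : Type := CoeffRing n ⊗[BaseRing n] Coh n p q

/-- The class `[f(λ,Γ,z,y)]`. -/
def cohClass (n p q : ℕ) : InvL n p q →ₗ[CoeffRing n] CohL n p q :=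
  (cohMk n p q).toLinearMap.baseChange (CoeffRing n)

/-- `f(λ,Γ,z,y)` as a polynomial in `Γ` with coefficients in `𝓛_{λ,(z,y)}`. -/
def toPoly (n p q : ℕ) :
    InvL n p q →ₐ[CoeffRing n] MvPolynomial (Fin p ⊕ Fin q) (CoeffRing n) :=
  Algebra.TensorProduct.lift (Algebra.ofId _ _)
    ((MvPolynomial.aeval MvPolynomial.X : RootRing n p q →ₐ[BaseRing n]
      MvPolynomial (Fin p ⊕ Fin q) (CoeffRing n)).comp (invRing n p q).val)
    (fun _ _ => Commute.all _ _)

/-- The substitution `f(λ,Γ,z,y) ↦ f(λ + m y,Γ,z,y)`. -/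
def shiftInv (n p q : ℕ) (m : ℤ) : InvL n p q →ₗ[BaseRing n] InvL n p q :=
  (shift n m).toLinearMap.rTensor (invRing n p q)

/-- `H*_T(𝒳_n) ⊗ 𝓛_{λ,(z,y)} = ⊕_{p+q=n} H*_T(T*Gr_p(ℂⁿ)) ⊗ 𝓛_{λ,(z,y)}`. -/
abbrev TotalCoh (n : ℕ) : Type := (c : {c : ℕ × ℕ // c.1 + c.2 = n}) → CohL n c.1.1 c.1.2

/-- The inclusion of the summand of `T*Gr_p(ℂⁿ)`. -/
def inclCoh (n p q : ℕ) (h : p + q = n) : CohL n p q →ₗ[CoeffRing n] TotalCoh n :=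
  LinearMap.single (CoeffRing n) (fun c : {c : ℕ × ℕ // c.1 + c.2 = n} => CohL n c.1.1 c.1.2)
    ⟨(p, q), h⟩

/-! ### Localization to the fixed points -/

/-- The substitution `{γ_{1,*}} ↦ {z_a | a ∈ J}`, `{γ_{2,*}} ↦ {z_a | a ∉ J}`. -/
def rootsAt {n : ℕ} (J : Finset (Fin n)) : Fin J.card ⊕ Fin Jᶜ.card → BaseRing n :=
  Sum.elim (fun i => zBase (J.orderEmbOfFin rfl i)) (fun j => zBase (Jᶜ.orderEmbOfFin rfl j))

theorem rootsAt_rel {n : ℕ} (J : Finset (Fin n)) (m : ℕ) :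
    MvPolynomial.aeval (rootsAt J) ((relPoly n J.card Jᶜ.card).coeff m) = 0 := by
  have key : (relPoly n J.card Jᶜ.card).map
      (MvPolynomial.aeval (rootsAt J) : RootRing n J.card Jᶜ.card →ₐ[BaseRing n] BaseRing n).toRingHom
      = 0 := by
    have h1 : ∀ K : Finset (Fin n), (∏ i : Fin K.card,
        ((Polynomial.X : Polynomial (BaseRing n)) -
          Polynomial.C (zBase (K.orderEmbOfFin rfl i)))) =
        ∏ a ∈ K, (Polynomial.X - Polynomial.C (zBase a)) := by
      intro K
      conv_rhs => rw [← Finset.image_orderEmbOfFin_univ K rfl]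
      rw [Finset.prod_image (fun a _ b _ h => (K.orderEmbOfFin rfl).injective h)]
    simp only [relPoly, Polynomial.map_sub, Polynomial.map_mul, Polynomial.map_prod,
      Polynomial.map_X, Polynomial.map_C]
    simp only [AlgHom.toRingHom_eq_coe, RingHom.coe_coe, MvPolynomial.aeval_X, MvPolynomial.aeval_C,
      rootsAt, Sum.elim_inl, Sum.elim_inr, Algebra.algebraMap_self, RingHom.id_apply]
    rw [h1, h1, Finset.prod_mul_prod_compl, sub_self]
  have := congrArg (fun f => Polynomial.coeff f m) key
  simpa [Polynomial.coeff_map] using this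

/-- The restriction `H*_T(T*Gr_p(ℂⁿ)) → H*_T(x_J) = ℂ[z,y]`, where `p = |J|`. -/
def cohAt {n : ℕ} (J : Finset (Fin n)) : Coh n J.card Jᶜ.card →ₐ[BaseRing n] BaseRing n :=
  Ideal.Quotient.liftₐ (relIdeal n J.card Jᶜ.card)
    ((MvPolynomial.aeval (rootsAt J)).comp (invRing n J.card Jᶜ.card).val)
    (fun a ha => by
      have hle : relIdeal n J.card Jᶜ.card ≤ RingHom.ker
          ((MvPolynomial.aeval (rootsAt J)).comp (invRing n J.card Jᶜ.card).val) := by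
        refine Ideal.span_le.2 ?_
        rintro x ⟨m, hm⟩
        change MvPolynomial.aeval (rootsAt J) (x : RootRing n J.card Jᶜ.card) = 0
        rw [hm]
        exact rootsAt_rel J m
      exact hle ha)

/-- `(ℂ²)^{⊗n} ⊗ 𝓛_{λ,(z,y)} = H*_T((𝒳_n)^T) ⊗ 𝓛_{λ,(z,y)}` in coordinates: the function `ζ`
stands for `∑_I ζ(I) v_I`, where `v_I = v_{i_1} ⊗ ⋯ ⊗ v_{i_n}` with `i_j = 1` if `j ∈ I` and
`i_j = 2` otherwise; equivalently `v_I = 1_I ∈ H*_T(x_I)`. -/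
abbrev TensorSpace (n : ℕ) : Type := Finset (Fin n) → CoeffRing n

/-- The equivariant localization map, whose components are the restrictions to the `x_J`. -/
def Loc (n : ℕ) : TotalCoh n →ₗ[CoeffRing n] TensorSpace n :=
  LinearMap.pi fun J =>
    ((Algebra.TensorProduct.rid (BaseRing n) (CoeffRing n) (CoeffRing n)).toLinearMap ∘ₗ
      (cohAt J).toLinearMap.baseChange (CoeffRing n)) ∘ₗ
    LinearMap.proj (R := CoeffRing n)
      (φ := fun c : {c : ℕ × ℕ // c.1 + c.2 = n} => CohL n c.1.1 c.1.2)
      ⟨(J.card, Jᶜ.card), by simp [Finset.card_add_card_compl]⟩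

/-! ### Weight functions and the stable envelope -/

/-- `w(i,I) = -#{j > i, j ∉ I} + #{j > i, j ∈ I}`. -/
def wNum {n : ℕ} (i : Fin n) (I : Finset (Fin n)) : ℤ :=
  -((Finset.univ.filter fun j => i < j ∧ j ∉ I).card : ℤ) +
    ((Finset.univ.filter fun j => i < j ∧ j ∈ I).card : ℤ)

/-- `C^{(r)}_{id,I} = ∏_{i ∈ I} (λ - (w(i,I) + r) y)`. -/
def cFactor {n : ℕ} (r : ℤ) (I : Finset (Fin n)) : CoeffRing n :=
  ∏ i ∈ I, (lam n - ((wNum i I + r : ℤ) : CoeffRing n) * yy n)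

/-- The factor `l_I(r,a)` of the weight function, where `ir` is the `r`-th element of `I` and
`t` is the value of `t_r`. -/
def lFactor {n : ℕ} (I : Finset (Fin n)) (ir : Fin n) (t : CoeffRing n) (a : Fin n) :
    CoeffRing n :=
  if a < ir then t - zz a + yy n
  else if a = ir then lam n + t - zz a - (wNum ir I : CoeffRing n) * yy n
  else t - zz a

/-- The weight function `W_I(λ,t,z,y)` at a point `t` with distinct coordinates such that the
`t_a - t_b` are invertible. -/
def weightFn {n : ℕ} (I : Finset (Fin n)) (t : Fin I.card → CoeffRing n) : CoeffRing n :=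
  yy n ^ I.card * ∑ σ : Equiv.Perm (Fin I.card),
    (∏ r : Fin I.card, ∏ a : Fin n, lFactor I (I.orderEmbOfFin rfl r) (t (σ r)) a) *
    ∏ a : Fin I.card, ∏ b ∈ Finset.Ioi a,
      (t (σ a) - t (σ b) + yy n) * Ring.inverse (t (σ a) - t (σ b))

/-- `e_k(t,y) = ∏_{a,b} (t_a - t_b + y)`. -/
def eFactor {n k : ℕ} (t : Fin k → CoeffRing n) : CoeffRing n :=
  ∏ a : Fin k, ∏ b : Fin k, (t a - t b + yy n)

/-- `W̃⁺_I(λ,t,z,y) = W_I / (C^{(0)}_I C^{(1)}_I e_k)`. -/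
def weightPlus {n : ℕ} (I : Finset (Fin n)) (t : Fin I.card → CoeffRing n) : CoeffRing n :=
  weightFn I t * Ring.inverse (cFactor 0 I * cFactor 1 I * eFactor t)

/-- The restrictions of `κ_{id,I}`: `W̃⁺_I(λ,z_J,z,y)` at `x_J` with `|J| = |I|`, and `0` at the
fixed points on the other components of `𝒳_n`. -/
def kappaRestriction {n : ℕ} (I : Finset (Fin n)) : TensorSpace n := fun J =>
  if h : J.card = I.card then weightPlus I (fun r => zz (J.orderEmbOfFin h r)) else 0

/-- The class `κ_{id,I}`, i.e. the preimage of `kappaRestriction I` under the localization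
isomorphism. -/
def kappa {n : ℕ} (I : Finset (Fin n)) : TotalCoh n :=
  Function.invFun (Loc n) (kappaRestriction I)

/-- The stable envelope map `Stab_id`, `v_I ↦ κ_{id,I}`. -/
def stab (n : ℕ) : TensorSpace n →ₗ[CoeffRing n] TotalCoh n :=
  Fintype.linearCombination (CoeffRing n) kappa

/-! ### The dynamical L-operator -/

/-- The rational dynamical R-matrix; the index `0` is `v_1` and the index `1` is `v_2`. -/
def rMatrix {A : Type} [CommRing A] (l z y : A) : Matrix (Fin 2 × Fin 2) (Fin 2 × Fin 2) A :=
  fun r c => match r, c with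
  | (0, 0), (0, 0) => 1
  | (0, 1), (0, 1) => (l + y) * z * Ring.inverse (l * (z - y))
  | (0, 1), (1, 0) => -((l + z) * y) * Ring.inverse (l * (z - y))
  | (1, 0), (0, 1) => -((l - z) * y) * Ring.inverse (l * (z - y))
  | (1, 0), (1, 0) => (l - y) * z * Ring.inverse (l * (z - y))
  | (1, 1), (1, 1) => 1
  | _, _ => 0

/-- The spectral parameter `w`: Laurent series are in the variable `w⁻¹`. -/
def wVar (A : Type) [CommRing A] : LaurentSeries A := HahnSeries.single (-1 : ℤ) 1

/-- The index of the `j`-th tensor factor of `v_I`. -/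
def spin {n : ℕ} (I : Finset (Fin n)) (j : Fin n) : Fin 2 := if j ∈ I then 0 else 1

/-- The eigenvalue of `h^{(j+1)} + ⋯ + h^{(n)}` on `v_I`. -/
def hAfter {n : ℕ} (I : Finset (Fin n)) (j : Fin n) : ℤ :=
  ∑ m ∈ Finset.Ioi j, if m ∈ I then 1 else -1

/-- The matrix of `R^{(0,j)}(λ - y ∑_{m > j} h^{(m)}, w - z_j, y)` on `ℂ² ⊗ (ℂ²)^{⊗n}`, the first
factor being the auxiliary space number `0`. -/
def rFactor (n : ℕ) (j : Fin n) :
    Matrix (Fin 2 × Finset (Fin n)) (Fin 2 × Finset (Fin n)) (LaurentSeries (CoeffRing n)) :=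
  fun r c =>
    if r.2.erase j = c.2.erase j then
      rMatrix (HahnSeries.C (lam n - (hAfter c.2 j : CoeffRing n) * yy n))
        (wVar (CoeffRing n) - HahnSeries.C (zz j)) (HahnSeries.C (yy n))
        (r.1, spin r.2 j) (c.1, spin c.2 j)
    else 0

/-- The L-operator of `V(z_1) ⊗ ⋯ ⊗ V(z_n)`, the product of the `rFactor`s in the order
`j = 1, …, n`. -/
def lOperator (n : ℕ) :
    Matrix (Fin 2 × Finset (Fin n)) (Fin 2 × Finset (Fin n)) (LaurentSeries (CoeffRing n)) :=
  (List.ofFn (rFactor n)).prod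

/-- The operator `ζ(λ,z,y) ↦ ζ(λ + m y,z,y)`, that is `δ^m`. -/
def shiftTensor (n : ℕ) (m : ℤ) : TensorSpace n →ₗ[BaseRing n] TensorSpace n :=
  (shift n m).toLinearMap.compLeft (Finset (Fin n))

/-- `L_{ij,s}(λ,y)`, the coefficient of `w^{-s}` in the block `(i,j)` of the L-operator. -/
def lCoeff (n : ℕ) (i j : Fin 2) (s : ℕ) : TensorSpace n →ₗ[BaseRing n] TensorSpace n :=
  (Matrix.toLin' (Matrix.of fun I J : Finset (Fin n) =>
    (lOperator n (i, I) (j, J)).coeff (s : ℤ))).restrictScalars (BaseRing n)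

/-- The series `L̃_{ij}(w,y) = ∑_s L_{ij,s}(λ,y) δ^{∓1} w^{-s}`, with `δ⁻¹` if `j = 1` and `δ` if
`j = 2`, as a power series in `w⁻¹` with operator coefficients. -/
def lTilde (n : ℕ) (i j : Fin 2) : PowerSeries (Module.End (BaseRing n) (TensorSpace n)) :=
  PowerSeries.mk fun s => lCoeff n i j s * shiftTensor n (if j = 0 then -1 else 1)

/-- `F̃(w) = L̃_{12}(w) L̃_{22}(w)⁻¹`. -/
def fTilde (n : ℕ) : PowerSeries (Module.End (BaseRing n) (TensorSpace n)) :=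
  lTilde n 0 1 * Ring.inverse (lTilde n 1 1)

/-- `Ẽ(w) = L̃_{22}(w)⁻¹ L̃_{21}(w)`. -/
def eTilde (n : ℕ) : PowerSeries (Module.End (BaseRing n) (TensorSpace n)) :=
  Ring.inverse (lTilde n 1 1) * lTilde n 1 0

/-! ### The explicit formulas -/

/-- Rational functions in `Γ` with coefficients in the fraction field of `𝓛_{λ,(z,y)}`. -/
def RootField (n p q : ℕ) : Type :=
  FractionRing (MvPolynomial (Fin p ⊕ Fin q) (CoeffRing n))

instance (n p q : ℕ) : Field (RootField n p q) :=
  inferInstanceAs (Field (FractionRing (MvPolynomial (Fin p ⊕ Fin q) (CoeffRing n))))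

instance (n p q : ℕ) :
    Algebra (MvPolynomial (Fin p ⊕ Fin q) (CoeffRing n)) (RootField n p q) :=
  inferInstanceAs (Algebra (MvPolynomial (Fin p ⊕ Fin q) (CoeffRing n))
    (FractionRing (MvPolynomial (Fin p ⊕ Fin q) (CoeffRing n))))

instance (n p q : ℕ) :
    IsFractionRing (MvPolynomial (Fin p ⊕ Fin q) (CoeffRing n)) (RootField n p q) :=
  inferInstanceAs (IsFractionRing (MvPolynomial (Fin p ⊕ Fin q) (CoeffRing n))
    (FractionRing (MvPolynomial (Fin p ⊕ Fin q) (CoeffRing n))))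

/-- Constants and Chern roots in the field of Laurent series in `w⁻¹` over `RootField`. -/
def ofPoly {n p q : ℕ} (f : MvPolynomial (Fin p ⊕ Fin q) (CoeffRing n)) :
    LaurentSeries (RootField n p q) :=
  HahnSeries.C (algebraMap (MvPolynomial (Fin p ⊕ Fin q) (CoeffRing n)) (RootField n p q) f)

def constL (n p q : ℕ) (a : CoeffRing n) : LaurentSeries (RootField n p q) :=
  ofPoly (MvPolynomial.C a)

def root1 (n p q : ℕ) (i : Fin p) : LaurentSeries (RootField n p q) :=
  ofPoly (MvPolynomial.X (Sum.inl i))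

def root2 (n p q : ℕ) (j : Fin q) : LaurentSeries (RootField n p q) :=
  ofPoly (MvPolynomial.X (Sum.inr j))

/-- `Γ'ⁱ = (γ_{1,1},…,γ_{1,k-1},γ_{2,i}; γ_{2,1},…,γ̌_{2,i},…,γ_{2,n-k+1})`, with `k = p + 1` and
`n - k = q`. -/
def rootsF {p q : ℕ} (i : Fin (q + 1)) : Fin (p + 1) ⊕ Fin q → Fin p ⊕ Fin (q + 1) :=
  Sum.elim (Fin.snoc (α := fun _ => Fin p ⊕ Fin (q + 1)) Sum.inl (Sum.inr i))
    (fun j => Sum.inr (i.succAbove j))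

/-- `Γⁱ' = (γ_{1,1},…,γ̌_{1,i},…,γ_{1,k+1}; γ_{1,i},γ_{2,1},…,γ_{2,n-k-1})`, with `k = p` and
`n - k = q + 1`. -/
def rootsE {p q : ℕ} (i : Fin (p + 1)) : Fin p ⊕ Fin (q + 1) → Fin (p + 1) ⊕ Fin q :=
  Sum.elim (fun j => Sum.inl (i.succAbove j))
    (Fin.cons (α := fun _ => Fin (p + 1) ⊕ Fin q) (Sum.inl i) Sum.inr)

/-- The formula for `F̃(w)` applied to `f(λ,Γ,z,y)`, where `k = p + 1`, `n - k = q`: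
`(-1)^{k-1} c_F ∑ᵢ f(λ,Γ'ⁱ,z,y) / (w - γ_{2,i}) · (λ + w - γ_{2,i} + y (n - 2k + 1)) ·
∏_j (γ_{2,i} - γ_{1,j} - y) / ∏_{j ≠ i} (γ_{2,i} - γ_{2,j})` with `c_F = -y`. -/
def formulaF (n p q : ℕ) (f : InvL n (p + 1) q) : LaurentSeries (RootField n p (q + 1)) :=
  (-1) ^ p * -(constL n p (q + 1) (yy n)) * ∑ i : Fin (q + 1),
    ofPoly (MvPolynomial.rename (rootsF i) (toPoly n (p + 1) q f)) /
        (wVar (RootField n p (q + 1)) - root2 n p (q + 1) i) *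
      (constL n p (q + 1) (lam n) + wVar (RootField n p (q + 1)) - root2 n p (q + 1) i +
        constL n p (q + 1) (yy n) *
          (((n : ℤ) - 2 * ((p : ℤ) + 1) + 1 : ℤ) : LaurentSeries (RootField n p (q + 1)))) *
      ((∏ j : Fin p, (root2 n p (q + 1) i - root1 n p (q + 1) j - constL n p (q + 1) (yy n))) /
        ∏ j ∈ Finset.univ.erase i, (root2 n p (q + 1) i - root2 n p (q + 1) j))

/-- The formula for `Ẽ(w)` applied to `f(λ,Γ,z,y)`, where `k = p`, `n - k - 1 = q`:
`(-1)^{n-k-1} c_E ∑ᵢ f(λ - 2y,Γⁱ',z,y) / (w - γ_{1,i}) · (λ - w + γ_{1,i} - y) ·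
∏_j (γ_{2,j} - γ_{1,i} - y) / ∏_{j ≠ i} (γ_{1,j} - γ_{1,i})` with
`c_E = -y / ((λ - y)(λ - 2y))`. -/
def formulaE (n p q : ℕ) (f : InvL n p (q + 1)) : LaurentSeries (RootField n (p + 1) q) :=
  (-1) ^ q *
    (-(constL n (p + 1) q (yy n)) /
      ((constL n (p + 1) q (lam n) - constL n (p + 1) q (yy n)) *
        (constL n (p + 1) q (lam n) - 2 * constL n (p + 1) q (yy n)))) *
    ∑ i : Fin (p + 1),
      ofPoly (MvPolynomial.rename (rootsE i) (toPoly n p (q + 1) (shiftInv n p (q + 1) (-2) f))) /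
          (wVar (RootField n (p + 1) q) - root1 n (p + 1) q i) *
        (constL n (p + 1) q (lam n) - wVar (RootField n (p + 1) q) + root1 n (p + 1) q i -
          constL n (p + 1) q (yy n)) *
        ((∏ j : Fin q,
            (root2 n (p + 1) q j - root1 n (p + 1) q i - constL n (p + 1) q (yy n))) /
          ∏ j ∈ Finset.univ.erase i, (root1 n (p + 1) q j - root1 n (p + 1) q i))

/-- The Laurent series `∑_s g_s(λ,Γ,z,y) w^{-s}`. -/
def seriesOf {n p q : ℕ} (g : ℕ → InvL n p q) : LaurentSeries (RootField n p q) :=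
  HahnSeries.ofPowerSeries ℤ (RootField n p q) (PowerSeries.mk fun s =>
    algebraMap (MvPolynomial (Fin p ⊕ Fin q) (CoeffRing n)) (RootField n p q) (toPoly n p q (g s)))

end

/-! Everything is checked at the torus fixed points. Restriction to the `x_J` is bijective over 𝓛
(`Loc_bijective`), so the theorem becomes a statement about the matrix `K` of restrictions of the
stable envelope classes: conjugation by `K` must turn L̃_22 into a diagonal difference operator, F̃
into the matrix expressing the value at `x_J` through the values at the `x_{J ∪ i}`, and Ẽ into the
matrix using the `x_{J ∖ m}`, with the coefficients read off from the explicit formulas.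

For fixed `J` the row `I ↦ K_{J,I}` is, up to the factor `compNorm` which does not involve `I`, the
vector `rowVec`, defined by recursion on the largest site. The weight function satisfies the same
recursion: split its sum over permutations according to the `z_m` substituted for the last variable
(`weightSum_eq_rowVec`). A new largest site multiplies the monodromy matrix on the right by an
R-matrix, which does not mix the two rows of the auxiliary matrix. So the action of L_21 and L_22 on
row vectors is found by one joint induction, each step being an identity of rational functions
(`rowRelations`).

L_12 lies in the other auxiliary row and is reached by duality. The vectors `colVec` are built by
recursion on the smallest site; this multiplies on the left and keeps the column L_12, L_22 together
(`colRelations`). Up to a shift of λ, both families consist of eigenvectors of L_22 with eigenvalue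
∏_{j ∈ J} (w - z_j)/(w - z_j - y), which at `w = z_j` vanishes exactly when `j ∈ J`. Hence vectors
for different sets are orthogonal (`pairing_of_ne`). Both families are triangular, in opposite
directions, which gives the diagonal pairings (`pairing_self`). They are therefore dual bases up to
normalization, and L_12 acts on rows by the transpose of its action on columns
(`rowAll_relation_up`).

These identities hold over fields. They are brought to 𝓛 by embedding it into Laurent series over
its fraction field and comparing coefficients of w^{-s}. Writing operators as `P δ^m`, one gets K
L̃_22 = Dδ K, K L̃_12 = F Dδ K and K L̃_21 = Dδ E δ^{-2} K, so F̃ and Ẽ become F and E δ^{-2}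
(`kappaOp_mul_fTilde`, `kappaOp_mul_eTilde`). `K` is invertible because it is triangular with units
on the diagonal (`isUnit_det_kappaMatrix`).

Two algebraic facts remain. A class vanishing at all fixed points is zero: over 𝓛 the differences
z_a - z_b are units, so Lagrange interpolation splits the ring of Chern roots into pieces where the
roots are a permutation of the z_a (`aeval_eq_zero_of_prod_eq`), and averaging over S_p × S_q
returns to the invariant ring. And the brackets have polynomial coefficients because they are
divided differences of families permuted by the symmetric group (`exists_algebraMap_eq_divDiff`). -/

/-! ### Transfer matrices of the dynamical L-operator over a field -/

/-- The eigenvalue of `∑ h^{(m)}` over the sites `m ∈ A` on `v_I`. -/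
def hSum {n : ℕ} (A I : Finset (Fin n)) : ℤ := ∑ m ∈ A, if m ∈ I then 1 else -1

theorem hSum_congr {n : ℕ} {A I I' : Finset (Fin n)} (h : ∀ m ∈ A, m ∈ I ↔ m ∈ I') :
    hSum A I = hSum A I' :=
  Finset.sum_congr rfl fun m hm => by simp only [h m hm]

theorem hSum_eq_card {n : ℕ} {A I : Finset (Fin n)} (h : I ⊆ A) :
    hSum A I = 2 * (I.card : ℤ) - A.card := by
  have h1 : hSum A I = ∑ m ∈ A, (2 * (if m ∈ I then 1 else 0) - 1 : ℤ) :=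
    Finset.sum_congr rfl fun m _ => by split_ifs <;> norm_num
  rw [h1, Finset.sum_sub_distrib, ← Finset.mul_sum]
  simp [Finset.inter_eq_right.2 h]

/-- The block of `R^{(0,j)}` between the states of site `j` in `v_I` (output) and `v_J` (input). -/
noncomputable def siteBlock {n : ℕ} {A : Type} [CommRing A] (z : Fin n → A) (y w l : A)
    (I J : Finset (Fin n)) (j : Fin n) : Matrix (Fin 2) (Fin 2) A :=
  Matrix.of fun α β => rMatrix l (w - z j) y (α, spin I j) (β, spin J j)

/-- The matrix in the auxiliary space of the entry `(I,J)` of the L-operator of the sites in `A`. -/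
noncomputable def transfer {n : ℕ} {R : Type} [CommRing R] (z : Fin n → R) (y w : R)
    (A : Finset (Fin n)) (l : R) (I J : Finset (Fin n)) : Matrix (Fin 2) (Fin 2) R :=
  ((A.sort (· ≤ ·)).map fun j =>
    siteBlock z y w (l - (hSum (A.filter (j < ·)) I : R) * y) I J j).prod

section Transfer

variable {n : ℕ} {F : Type} [Field F]

theorem transfer_congr (z : Fin n → F) (y w : F) (A : Finset (Fin n)) (l : F)
    {I J I' J' : Finset (Fin n)} (hI : ∀ m ∈ A, m ∈ I ↔ m ∈ I') (hJ : ∀ m ∈ A, m ∈ J ↔ m ∈ J') :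
    transfer z y w A l I J = transfer z y w A l I' J' := by
  unfold transfer
  congr 1
  refine List.map_congr_left fun j hj => ?_
  rw [Finset.mem_sort] at hj
  rw [hSum_congr fun m hm => hI m (Finset.mem_filter.1 hm).1]
  ext α β
  simp only [siteBlock, spin, hI j hj, hJ j hj]

theorem sort_insert_max {A : Finset (Fin n)} {a : Fin n} (h : ∀ b ∈ A, b < a) :
    (insert a A).sort (· ≤ ·) = A.sort (· ≤ ·) ++ [a] := by
  have ha : a ∉ A := fun h' => lt_irrefl _ (h a h')
  refine List.Perm.eq_of_pairwise (le := (· ≤ ·)) ?_ ?_ ?_ ?_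
  · intro x y _ _ h1 h2; exact le_antisymm h1 h2
  · exact Finset.pairwise_sort _ _
  · rw [List.pairwise_append]
    refine ⟨Finset.pairwise_sort _ _, by simp, ?_⟩
    intro x hx y hy
    rw [Finset.mem_sort] at hx
    rw [List.mem_singleton.1 hy]
    exact (h x hx).le
  · refine (List.perm_ext_iff_of_nodup (Finset.sort_nodup _ _) ?_).2 fun x => ?_
    · rw [List.nodup_append]
      refine ⟨Finset.sort_nodup _ _, by simp, ?_⟩
      intro x hx y hy hxy
      rw [Finset.mem_sort] at hx
      rw [List.mem_singleton.1 hy] at hxy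
      exact ha (hxy ▸ hx)
    · simp [or_comm]

/-- A largest site stands last in the product, so it gives a right factor with parameter `l` itself,
and its weight ±1 shifts the parameter of every other factor. Right multiplication preserves the row
index of the auxiliary matrix. -/
theorem transfer_insert_max (z : Fin n → F) (y w : F) {A : Finset (Fin n)} {a : Fin n}
    (h : ∀ b ∈ A, b < a) (l : F) (I J : Finset (Fin n)) :
    transfer z y w (insert a A) l I J =
      transfer z y w A (l - (if a ∈ I then 1 else -1) * y) I J * siteBlock z y w l I J a := by
  have ha : a ∉ A := fun h' => lt_irrefl _ (h a h')
  unfold transfer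
  rw [sort_insert_max h, List.map_append, List.prod_append]
  congr 1
  · congr 1
    refine List.map_congr_left fun j hj => ?_
    rw [Finset.mem_sort] at hj
    rw [Finset.filter_insert, if_pos (h j hj)]
    unfold hSum
    rw [Finset.sum_insert (by simp [ha])]
    congr 1
    split_ifs <;> push_cast <;> ring
  · have : (insert a A).filter (a < ·) = ∅ := by
      rw [Finset.filter_eq_empty_iff]
      intro x hx
      rcases Finset.mem_insert.1 hx with rfl | hx
      · exact lt_irrefl _
      · exact (h x hx).not_gt
    rw [List.map_singleton, List.prod_singleton, this]
    simp [hSum]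

/-- A smallest site stands first. It gives a left factor, which preserves the column index, and
leaves the other parameters alone; its own parameter depends on the weight of the output `I`. -/
theorem transfer_insert_min (z : Fin n → F) (y w : F) {A : Finset (Fin n)} {a : Fin n}
    (h : ∀ b ∈ A, a < b) (l : F) (I J : Finset (Fin n)) :
    transfer z y w (insert a A) l I J =
      siteBlock z y w (l - (hSum A I : F) * y) I J a * transfer z y w A l I J := by
  have ha : a ∉ A := fun h' => lt_irrefl _ (h a h')
  unfold transfer
  rw [Finset.sort_insert (· ≤ ·) (fun b hb => (h b hb).le) ha, List.map_cons, List.prod_cons]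
  congr 1
  · congr 3
    rw [Finset.filter_insert, if_neg (lt_irrefl a), Finset.filter_true_of_mem h]
  · congr 1
    refine List.map_congr_left fun j hj => ?_
    rw [Finset.mem_sort] at hj
    rw [Finset.filter_insert, if_neg (h j hj).not_gt]

/-! The entries of the transfer matrix after adding a maximal site. -/

section MaxSite

variable (z : Fin n → F) (y w : F) {A : Finset (Fin n)} {a : Fin n} (h : ∀ b ∈ A, b < a)
  {I J : Finset (Fin n)}

include h

theorem transfer_max_aux (l' : F) (I J I' J' : Finset (Fin n)) (hI : ∀ m ≠ a, m ∈ I ↔ m ∈ I')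
    (hJ : ∀ m ≠ a, m ∈ J ↔ m ∈ J') :
    transfer z y w A l' I J = transfer z y w A l' I' J' :=
  transfer_congr z y w A l' (fun m hm => hI m (h m hm).ne) (fun m hm => hJ m (h m hm).ne)

/-- In these names `in` and `out` record whether `a` belongs to the output set and to the input set,
in this order. The R-matrix conserves weight: equal states at `a` leave a diagonal block, different
states a single entry. -/
theorem transfer_max_out_out (hI : a ∉ I) (hJ : a ∉ J) (l : F) (α : Fin 2) :
    transfer z y w (insert a A) l I J α 0 =
        transfer z y w A (l + y) I J α 0 *
          ((l + y) * (w - z a) * (l * (w - z a - y))⁻¹) ∧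
      transfer z y w (insert a A) l I J α 1 = transfer z y w A (l + y) I J α 1 := by
  simp only [transfer_insert_max z y w h, Matrix.mul_apply, Fin.sum_univ_two, siteBlock,
    Matrix.of_apply, spin, hI, hJ, if_false, rMatrix, Ring.inverse_eq_inv']
  constructor <;> simp

theorem transfer_max_in_in (l : F) (α : Fin 2) :
    transfer z y w (insert a A) l (insert a I) (insert a J) α 0 =
        transfer z y w A (l - y) I J α 0 ∧
      transfer z y w (insert a A) l (insert a I) (insert a J) α 1 =
        transfer z y w A (l - y) I J α 1 *
          ((l - y) * (w - z a) * (l * (w - z a - y))⁻¹) := by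
  have e : ∀ l', transfer z y w A l' (insert a I) (insert a J) = transfer z y w A l' I J :=
    fun l' => transfer_max_aux z y w h l' _ _ _ _ (by simp +contextual) (by simp +contextual)
  simp only [transfer_insert_max z y w h, Matrix.mul_apply, Fin.sum_univ_two, siteBlock,
    Matrix.of_apply, spin, rMatrix, Ring.inverse_eq_inv', e,
    Finset.mem_insert_self, if_true]
  constructor <;> simp

theorem transfer_max_out_in (hI : a ∉ I) (l : F) (α : Fin 2) :
    transfer z y w (insert a A) l I (insert a J) α 0 = 0 ∧
      transfer z y w (insert a A) l I (insert a J) α 1 =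
        transfer z y w A (l + y) I J α 0 *
          (-((l + (w - z a)) * y) * (l * (w - z a - y))⁻¹) := by
  have e : ∀ l', transfer z y w A l' I (insert a J) = transfer z y w A l' I J :=
    fun l' => transfer_max_aux z y w h l' _ _ _ _ (by simp) (by simp +contextual)
  simp only [transfer_insert_max z y w h, Matrix.mul_apply, Fin.sum_univ_two, siteBlock,
    Matrix.of_apply, spin, rMatrix, Ring.inverse_eq_inv', e, hI,
    Finset.mem_insert_self, if_true, if_false]
  constructor <;> simp

theorem transfer_max_in_out (hJ : a ∉ J) (l : F) (α : Fin 2) :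
    transfer z y w (insert a A) l (insert a I) J α 0 =
        transfer z y w A (l - y) I J α 1 *
          (-((l - (w - z a)) * y) * (l * (w - z a - y))⁻¹) ∧
      transfer z y w (insert a A) l (insert a I) J α 1 = 0 := by
  have e : ∀ l', transfer z y w A l' (insert a I) J = transfer z y w A l' I J :=
    fun l' => transfer_max_aux z y w h l' _ _ _ _ (by simp +contextual) (by simp)
  simp only [transfer_insert_max z y w h, Matrix.mul_apply, Fin.sum_univ_two, siteBlock,
    Matrix.of_apply, spin, rMatrix, Ring.inverse_eq_inv', e, hJ,
    Finset.mem_insert_self, if_true, if_false]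
  constructor <;> simp

end MaxSite

/-! The entries of the transfer matrix after adding a minimal site. -/

section MinSite

variable (z : Fin n → F) (y w : F) {A : Finset (Fin n)} {a : Fin n} (h : ∀ b ∈ A, a < b)
  {I J : Finset (Fin n)}

include h

theorem transfer_min_aux (l' : F) (I J I' J' : Finset (Fin n)) (hI : ∀ m ≠ a, m ∈ I ↔ m ∈ I')
    (hJ : ∀ m ≠ a, m ∈ J ↔ m ∈ J') :
    transfer z y w A l' I J = transfer z y w A l' I' J' :=
  transfer_congr z y w A l' (fun m hm => hI m (h m hm).ne') (fun m hm => hJ m (h m hm).ne')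

theorem hSum_insert_min (I : Finset (Fin n)) : hSum A (insert a I) = hSum A I :=
  hSum_congr fun m hm => by simp [(h m hm).ne']

theorem transfer_min_out_out (hI : a ∉ I) (hJ : a ∉ J) (l : F)
    (μ : F) (hμ : μ = l - (hSum A I : F) * y) (β : Fin 2) :
    transfer z y w (insert a A) l I J 0 β =
        (μ + y) * (w - z a) * (μ * (w - z a - y))⁻¹ * transfer z y w A l I J 0 β ∧
      transfer z y w (insert a A) l I J 1 β = transfer z y w A l I J 1 β := by
  simp only [transfer_insert_min z y w h, ← hμ, Matrix.mul_apply, Fin.sum_univ_two, siteBlock,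
    Matrix.of_apply, spin, hI, hJ, if_false, rMatrix, Ring.inverse_eq_inv']
  constructor <;> simp

theorem transfer_min_in_in (l : F)
    (μ : F) (hμ : μ = l - (hSum A I : F) * y) (β : Fin 2) :
    transfer z y w (insert a A) l (insert a I) (insert a J) 0 β =
        transfer z y w A l I J 0 β ∧
      transfer z y w (insert a A) l (insert a I) (insert a J) 1 β =
        (μ - y) * (w - z a) * (μ * (w - z a - y))⁻¹ * transfer z y w A l I J 1 β := by
  have e : ∀ l', transfer z y w A l' (insert a I) (insert a J) = transfer z y w A l' I J :=
    fun l' => transfer_min_aux z y w h l' _ _ _ _ (by simp +contextual) (by simp +contextual)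
  simp only [transfer_insert_min z y w h, hSum_insert_min h, ← hμ, Matrix.mul_apply,
    Fin.sum_univ_two, siteBlock, Matrix.of_apply, spin, rMatrix, Ring.inverse_eq_inv', e,
    Finset.mem_insert_self, if_true]
  constructor <;> simp

theorem transfer_min_out_in (hI : a ∉ I) (l : F)
    (μ : F) (hμ : μ = l - (hSum A I : F) * y) (β : Fin 2) :
    transfer z y w (insert a A) l I (insert a J) 0 β =
        -((μ + (w - z a)) * y) * (μ * (w - z a - y))⁻¹ * transfer z y w A l I J 1 β ∧
      transfer z y w (insert a A) l I (insert a J) 1 β = 0 := by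
  have e : ∀ l', transfer z y w A l' I (insert a J) = transfer z y w A l' I J :=
    fun l' => transfer_min_aux z y w h l' _ _ _ _ (by simp) (by simp +contextual)
  simp only [transfer_insert_min z y w h, ← hμ, Matrix.mul_apply, Fin.sum_univ_two, siteBlock,
    Matrix.of_apply, spin, rMatrix, Ring.inverse_eq_inv', e, hI,
    Finset.mem_insert_self, if_true, if_false]
  constructor <;> simp

theorem transfer_min_in_out (hJ : a ∉ J) (l : F)
    (μ : F) (hμ : μ = l - (hSum A I : F) * y) (β : Fin 2) :
    transfer z y w (insert a A) l (insert a I) J 0 β = 0 ∧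
      transfer z y w (insert a A) l (insert a I) J 1 β =
        -((μ - (w - z a)) * y) * (μ * (w - z a - y))⁻¹ * transfer z y w A l I J 0 β := by
  have e : ∀ l', transfer z y w A l' (insert a I) J = transfer z y w A l' I J :=
    fun l' => transfer_min_aux z y w h l' _ _ _ _ (by simp +contextual) (by simp)
  simp only [transfer_insert_min z y w h, hSum_insert_min h, ← hμ, Matrix.mul_apply,
    Fin.sum_univ_two, siteBlock, Matrix.of_apply, spin, rMatrix, Ring.inverse_eq_inv', e, hJ,
    Finset.mem_insert_self, if_true, if_false]
  constructor <;> simp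

end MinSite

end Transfer

/-! ### Row vectors: the restrictions of the stable envelopes -/

section RowVec

variable {n : ℕ} {F : Type} [Field F]

/-- No `l + m y`, `m ∈ ℤ`, vanishes. -/
def IsGeneric (y l : F) : Prop := ∀ m : ℤ, l + m * y ≠ 0

theorem IsGeneric.shift {y l : F} (h : IsGeneric y l) (m : ℤ) : IsGeneric y (l + m * y) := by
  intro k
  have := h (m + k)
  push_cast at this
  rwa [add_mul, ← add_assoc] at this

theorem IsGeneric.add {y l : F} (h : IsGeneric y l) : IsGeneric y (l + y) := by
  simpa using h.shift 1

theorem IsGeneric.sub {y l : F} (h : IsGeneric y l) : IsGeneric y (l - y) := by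
  simpa [sub_eq_add_neg] using h.shift (-1)

theorem IsGeneric.ne_zero {y l : F} (h : IsGeneric y l) : l ≠ 0 := by
  simpa using h 0

/-- `∏_{j ∈ J} (w - z_j) / (w - z_j - y)`. -/
noncomputable def dEig (z : Fin n → F) (y w : F) (J : Finset (Fin n)) : F :=
  ∏ j ∈ J, (w - z j) / (w - z j - y)

/-- `∏_{j ∈ J} (z_j - a + y) / (z_j - a)`. -/
noncomputable def qProd (z : Fin n → F) (y a : F) (J : Finset (Fin n)) : F :=
  ∏ j ∈ J, (z j - a + y) / (z j - a)

/-- The matrix coefficient of `L_{21}` between row vectors. -/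
noncomputable def eEntry (z : Fin n → F) (y w l : F) (J : Finset (Fin n)) (m : Fin n) : F :=
  -(y * (l - w + z m)) / (l * (l - y) * (w - z m - y)) * qProd z y (z m) (J.erase m) *
    dEig z y w (J.erase m)

/-- The coefficient of the recursion of row vectors. -/
noncomputable def rowEntry (z : Fin n → F) (y l : F) (a : Fin n) (J : Finset (Fin n)) (m : Fin n) :
    F :=
  (l + z m - z a) * y / (l * (l - y) * (z m - z a + y)) * (qProd z y (z a) (J.erase m))⁻¹ *
    qProd z y (z m) (J.erase m)

/-- The normalized restrictions of the stable envelope classes to the fixed point `x_J`, for the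
sites in a list in decreasing order. -/
noncomputable def rowVec (z : Fin n → F) (y : F) :
    List (Fin n) → F → Finset (Fin n) → Finset (Fin n) → F
  | [], _, _, _ => 1
  | a :: L, l, J, I =>
    if a ∈ J then
      if a ∈ I then (l - y)⁻¹ * rowVec z y L (l - y) (J.erase a) (I.erase a) else 0
    else
      if a ∈ I then
        ∑ m ∈ J, rowEntry z y l a J m * rowVec z y L (l - y) (J.erase m) (I.erase a)
      else (qProd z y (z a) J)⁻¹ * rowVec z y L (l + y) J I

variable {z : Fin n → F} {y w : F}

/-- Removing two elements of `J` in either order leaves the same vector, so in such double sums only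
the coefficients symmetrized in the two elements have to agree. -/
theorem sum_offDiag_eq_of_symm (J : Finset (Fin n)) (f g : Fin n → Fin n → F)
    (h : ∀ a ∈ J, ∀ b ∈ J, a ≠ b → f a b + f b a = g a b + g b a) :
    ∑ a ∈ J, ∑ b ∈ J.erase a, f a b = ∑ a ∈ J, ∑ b ∈ J.erase a, g a b := by
  rw [← sub_eq_zero, ← Finset.sum_sub_distrib]
  simp_rw [← Finset.sum_sub_distrib]
  rw [Finset.sum_sigma']
  refine Finset.sum_involution (fun x _ => ⟨x.2, x.1⟩) ?_ ?_ ?_ ?_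
  · rintro ⟨a, b⟩ hx
    simp only [Finset.mem_sigma, Finset.mem_erase] at hx
    linear_combination h a hx.1 b hx.2.2 (Ne.symm hx.2.1)
  · rintro ⟨a, b⟩ hx _ he
    simp only [Finset.mem_sigma, Finset.mem_erase] at hx
    simp only [Sigma.mk.injEq] at he
    exact hx.2.1 he.1
  · rintro ⟨a, b⟩ hx
    simp only [Finset.mem_sigma, Finset.mem_erase] at hx ⊢
    exact ⟨hx.2.2, Ne.symm hx.2.1, hx.1⟩
  · rintro ⟨a, b⟩ _
    rfl

/-- The parameters `z`, `y` are generic. -/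
structure GenericSites (z : Fin n → F) (y : F) : Prop where
  inj : Function.Injective z
  add_ne : ∀ a b, z a - z b + y ≠ 0

theorem GenericSites.sub_ne (h : GenericSites z y) {a b : Fin n} (hab : a ≠ b) :
    z a - z b ≠ 0 :=
  sub_ne_zero.2 fun e => hab (h.inj e)

theorem GenericSites.qProd_ne_zero (h : GenericSites z y) {J : Finset (Fin n)} {a : Fin n}
    (ha : a ∉ J) : qProd z y (z a) J ≠ 0 :=
  Finset.prod_ne_zero_iff.2 fun j hj =>
    div_ne_zero (h.add_ne j a) (h.sub_ne fun e => ha (e ▸ hj))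

theorem qProd_erase (z : Fin n → F) (y a : F) {J : Finset (Fin n)} {m : Fin n} (hm : m ∈ J) :
    qProd z y a J = (z m - a + y) / (z m - a) * qProd z y a (J.erase m) :=
  (Finset.mul_prod_erase J _ hm).symm

theorem dEig_erase (z : Fin n → F) (y w : F) {J : Finset (Fin n)} {m : Fin n} (hm : m ∈ J) :
    dEig z y w J = (w - z m) / (w - z m - y) * dEig z y w (J.erase m) :=
  (Finset.mul_prod_erase J _ hm).symm

theorem sum_powerset_insert' {A : Finset (Fin n)} {a : Fin n} (ha : a ∉ A)
    (f : Finset (Fin n) → F) :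
    ∑ I ∈ (insert a A).powerset, f I = ∑ I ∈ A.powerset, (f I + f (insert a I)) := by
  rw [Finset.sum_powerset_insert ha, Finset.sum_add_distrib]

theorem rowVec_cons_in_in {a : Fin n} {L : List (Fin n)} {l : F} {J I : Finset (Fin n)}
    (hJ : a ∉ J) (hI : a ∉ I) :
    rowVec z y (a :: L) l (insert a J) (insert a I) = (l - y)⁻¹ * rowVec z y L (l - y) J I := by
  simp [rowVec, hJ, hI]

theorem rowVec_cons_in_out {a : Fin n} {L : List (Fin n)} {l : F} {J I : Finset (Fin n)}
    (hI : a ∉ I) : rowVec z y (a :: L) l (insert a J) I = 0 := by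
  simp [rowVec, hI]

theorem rowVec_cons_out_in {a : Fin n} {L : List (Fin n)} {l : F} {J I : Finset (Fin n)}
    (hJ : a ∉ J) (hI : a ∉ I) :
    rowVec z y (a :: L) l J (insert a I) =
      ∑ m ∈ J, rowEntry z y l a J m * rowVec z y L (l - y) (J.erase m) I := by
  simp [rowVec, hJ, hI]

theorem rowVec_cons_out_out {a : Fin n} {L : List (Fin n)} {l : F} {J I : Finset (Fin n)}
    (hJ : a ∉ J) (hI : a ∉ I) :
    rowVec z y (a :: L) l J I = (qProd z y (z a) J)⁻¹ * rowVec z y L (l + y) J I := by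
  simp [rowVec, hJ, hI]

variable (z y w) in
/-- The action of `L_{22}` and `L_{21}` on row vectors. -/
def RowRelations (L : List (Fin n)) : Prop :=
  ∀ l, IsGeneric y l → ∀ J ⊆ L.toFinset, ∀ I ⊆ L.toFinset,
    (∑ I' ∈ L.toFinset.powerset, rowVec z y L l J I' * transfer z y w L.toFinset l I' I 1 1 =
      dEig z y w J * rowVec z y L (l + y) J I) ∧
    (∑ I' ∈ L.toFinset.powerset, rowVec z y L l J I' * transfer z y w L.toFinset l I' I 1 0 =
      ∑ m ∈ J, eEntry z y w l J m * rowVec z y L (l - y) (J.erase m) I)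

/-! ### Induction step for row vectors: adding a largest site `a` -/

section Step

variable (hz : GenericSites z y) (hw : ∀ a, w - z a - y ≠ 0) {a : Fin n} {L : List (Fin n)}
  (ha : ∀ b ∈ L.toFinset, b < a) (ih : RowRelations z y w L) {l : F} (hl : IsGeneric y l)
  {J I : Finset (Fin n)} (hJ : J ⊆ L.toFinset) (hI : I ⊆ L.toFinset)

include hz hw ha ih hl hJ hI

theorem row_in_in :
    (∑ I' ∈ L.toFinset.powerset, rowVec z y (a :: L) l (insert a J) (insert a I') *
        transfer z y w (insert a L.toFinset) l (insert a I') (insert a I) 1 1 =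
      dEig z y w (insert a J) * rowVec z y (a :: L) (l + y) (insert a J) (insert a I)) ∧
    (∑ I' ∈ L.toFinset.powerset, rowVec z y (a :: L) l (insert a J) (insert a I') *
        transfer z y w (insert a L.toFinset) l (insert a I') (insert a I) 1 0 =
      ∑ m ∈ insert a J, eEntry z y w l (insert a J) m *
        rowVec z y (a :: L) (l - y) ((insert a J).erase m) (insert a I)) := by
  have haL : ∀ {K : Finset (Fin n)}, K ⊆ L.toFinset → a ∉ K :=
    fun hK h' => lt_irrefl _ (ha a (hK h'))
  have haJ := haL hJ
  have haI := haL hI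
  obtain ⟨ih1, ih2⟩ := ih _ hl.sub J hJ I hI
  have n0 := hl.ne_zero
  have n1 := hl.sub.ne_zero
  have n2 := hl.sub.sub.ne_zero
  have nw := hw a
  constructor
  · have : ∀ I' ∈ L.toFinset.powerset, rowVec z y (a :: L) l (insert a J) (insert a I') *
        transfer z y w (insert a L.toFinset) l (insert a I') (insert a I) 1 1 =
        (l - y)⁻¹ * ((l - y) * (w - z a) * (l * (w - z a - y))⁻¹) *
          (rowVec z y L (l - y) J I' * transfer z y w L.toFinset (l - y) I' I 1 1) := by
      intro I' hI'
      rw [Finset.mem_powerset] at hI'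
      rw [rowVec_cons_in_in haJ (haL hI'), (transfer_max_in_in z y w ha l 1).2]
      ring
    rw [Finset.sum_congr rfl this, ← Finset.mul_sum, ih1, rowVec_cons_in_in haJ haI,
      dEig_erase z y w (Finset.mem_insert_self a J), Finset.erase_insert haJ]
    simp only [sub_add_cancel, add_sub_cancel_right]
    field_simp
  · have : ∀ I' ∈ L.toFinset.powerset, rowVec z y (a :: L) l (insert a J) (insert a I') *
        transfer z y w (insert a L.toFinset) l (insert a I') (insert a I) 1 0 =
        (l - y)⁻¹ *
          (rowVec z y L (l - y) J I' * transfer z y w L.toFinset (l - y) I' I 1 0) := by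
      intro I' hI'
      rw [Finset.mem_powerset] at hI'
      rw [rowVec_cons_in_in haJ (haL hI'), (transfer_max_in_in z y w ha l 1).1]
      ring
    -- The term `m = a` on the right is itself expanded into a sum over `J` by the recursion; after
    -- that both sides agree term by term.
    rw [Finset.sum_congr rfl this, ← Finset.mul_sum, ih2, Finset.sum_insert haJ,
      Finset.erase_insert haJ, rowVec_cons_out_in haJ haI, Finset.mul_sum, Finset.mul_sum,
      ← Finset.sum_add_distrib]
    refine Finset.sum_congr rfl fun m hm => ?_
    have hma : m ≠ a := fun e => haJ (e ▸ hm)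
    rw [Finset.erase_insert_of_ne hma.symm,
      rowVec_cons_in_in (fun h' => haJ (Finset.mem_of_mem_erase h')) haI]
    simp only [eEntry, rowEntry, Finset.erase_insert haJ, Finset.erase_insert_of_ne hma.symm]
    have haJ' : a ∉ J.erase m := fun h' => haJ (Finset.mem_of_mem_erase h')
    rw [qProd_erase z y (z m) (Finset.mem_insert_self a (J.erase m)),
      dEig_erase z y w (Finset.mem_insert_self a (J.erase m)), Finset.erase_insert haJ',
      qProd_erase z y (z a) hm, dEig_erase z y w hm]
    have q1 := hz.qProd_ne_zero haJ'
    have h1 := hz.sub_ne hma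
    have h2 := hz.sub_ne hma.symm
    have h3 := hz.add_ne m a
    have h4 := hw m
    have h2' : z a - z m = - (z m - z a) := by ring
    -- All factors involving `a` or `m` have been split off; the remaining products are independent
    -- unknowns in an identity of rational functions.
    generalize rowVec z y L _ (J.erase m) I = P
    generalize dEig z y w (J.erase m) = P1
    generalize qProd z y (z m) (J.erase m) = P2
    generalize qProd z y (z a) (J.erase m) = P3 at *
    rw [h2']
    field_simp
    ring

/-- A row vector with `a ∈ J` is supported on sets containing `a`. For L_22 both sides vanish, and
for L_21 only the term removing `a` itself survives on the right. -/
theorem row_in_out :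
    (∑ I' ∈ L.toFinset.powerset, rowVec z y (a :: L) l (insert a J) (insert a I') *
        transfer z y w (insert a L.toFinset) l (insert a I') I 1 1 =
      dEig z y w (insert a J) * rowVec z y (a :: L) (l + y) (insert a J) I) ∧
    (∑ I' ∈ L.toFinset.powerset, rowVec z y (a :: L) l (insert a J) (insert a I') *
        transfer z y w (insert a L.toFinset) l (insert a I') I 1 0 =
      ∑ m ∈ insert a J, eEntry z y w l (insert a J) m *
        rowVec z y (a :: L) (l - y) ((insert a J).erase m) I) := by
  have haL : ∀ {K : Finset (Fin n)}, K ⊆ L.toFinset → a ∉ K :=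
    fun hK h' => lt_irrefl _ (ha a (hK h'))
  have haJ := haL hJ
  have haI := haL hI
  obtain ⟨ih1, ih2⟩ := ih _ hl.sub J hJ I hI
  have n0 := hl.ne_zero
  have n1 := hl.sub.ne_zero
  have nw := hw a
  constructor
  · rw [rowVec_cons_in_out haI, mul_zero]
    refine Finset.sum_eq_zero fun I' hI' => ?_
    rw [(transfer_max_in_out z y w ha haI l 1).2, mul_zero]
  · have : ∀ I' ∈ L.toFinset.powerset, rowVec z y (a :: L) l (insert a J) (insert a I') *
        transfer z y w (insert a L.toFinset) l (insert a I') I 1 0 =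
        (l - y)⁻¹ * (-((l - (w - z a)) * y) * (l * (w - z a - y))⁻¹) *
          (rowVec z y L (l - y) J I' * transfer z y w L.toFinset (l - y) I' I 1 1) := by
      intro I' hI'
      rw [Finset.mem_powerset] at hI'
      rw [rowVec_cons_in_in haJ (haL hI'), (transfer_max_in_out z y w ha haI l 1).1]
      ring
    rw [Finset.sum_congr rfl this, ← Finset.mul_sum, ih1, Finset.sum_insert haJ,
      Finset.erase_insert haJ, rowVec_cons_out_out haJ haI, Finset.sum_eq_zero, add_zero]
    · have q1 := hz.qProd_ne_zero haJ
      simp only [eEntry, Finset.erase_insert haJ, sub_add_cancel]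
      generalize rowVec z y L _ J I = P
      field_simp
      ring
    · intro m hm
      have hma : m ≠ a := fun e => haJ (e ▸ hm)
      rw [Finset.erase_insert_of_ne hma.symm, rowVec_cons_in_out haI, mul_zero]

theorem row_out_out :
    (∑ I' ∈ L.toFinset.powerset, (rowVec z y (a :: L) l J I' *
        transfer z y w (insert a L.toFinset) l I' I 1 1 + rowVec z y (a :: L) l J (insert a I') *
        transfer z y w (insert a L.toFinset) l (insert a I') I 1 1) =
      dEig z y w J * rowVec z y (a :: L) (l + y) J I) ∧
    (∑ I' ∈ L.toFinset.powerset, (rowVec z y (a :: L) l J I' *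
        transfer z y w (insert a L.toFinset) l I' I 1 0 + rowVec z y (a :: L) l J (insert a I') *
        transfer z y w (insert a L.toFinset) l (insert a I') I 1 0) =
      ∑ m ∈ J, eEntry z y w l J m * rowVec z y (a :: L) (l - y) (J.erase m) I) := by
  have haL : ∀ {K : Finset (Fin n)}, K ⊆ L.toFinset → a ∉ K :=
    fun hK h' => lt_irrefl _ (ha a (hK h'))
  have haJ := haL hJ
  have haI := haL hI
  have n0 := hl.ne_zero
  have n1 := hl.sub.ne_zero
  have n2 := hl.add.ne_zero
  have nw := hw a
  constructor
  · have : ∀ I' ∈ L.toFinset.powerset, (rowVec z y (a :: L) l J I' *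
        transfer z y w (insert a L.toFinset) l I' I 1 1 + rowVec z y (a :: L) l J (insert a I') *
        transfer z y w (insert a L.toFinset) l (insert a I') I 1 1) =
        (qProd z y (z a) J)⁻¹ *
          (rowVec z y L (l + y) J I' * transfer z y w L.toFinset (l + y) I' I 1 1) := by
      intro I' hI'
      rw [Finset.mem_powerset] at hI'
      rw [(transfer_max_in_out z y w ha haI l 1).2, rowVec_cons_out_out haJ (haL hI'),
        (transfer_max_out_out z y w ha (haL hI') haI l 1).2]
      ring
    rw [Finset.sum_congr rfl this, ← Finset.mul_sum, (ih _ hl.add J hJ I hI).1,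
      rowVec_cons_out_out haJ haI]
    ring
  · have : ∀ I' ∈ L.toFinset.powerset, (rowVec z y (a :: L) l J I' *
        transfer z y w (insert a L.toFinset) l I' I 1 0 + rowVec z y (a :: L) l J (insert a I') *
        transfer z y w (insert a L.toFinset) l (insert a I') I 1 0) =
        (qProd z y (z a) J)⁻¹ * ((l + y) * (w - z a) * (l * (w - z a - y))⁻¹) *
          (rowVec z y L (l + y) J I' * transfer z y w L.toFinset (l + y) I' I 1 0) +
        ∑ m ∈ J, (-((l - (w - z a)) * y) * (l * (w - z a - y))⁻¹) * rowEntry z y l a J m *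
          (rowVec z y L (l - y) (J.erase m) I' * transfer z y w L.toFinset (l - y) I' I 1 1) := by
      intro I' hI'
      rw [Finset.mem_powerset] at hI'
      rw [(transfer_max_in_out z y w ha haI l 1).1, rowVec_cons_out_out haJ (haL hI'),
        (transfer_max_out_out z y w ha (haL hI') haI l 1).1, rowVec_cons_out_in haJ (haL hI'),
        Finset.sum_mul]
      congr 1
      · ring
      · exact Finset.sum_congr rfl fun m _ => by ring
    rw [Finset.sum_congr rfl this, Finset.sum_add_distrib, ← Finset.mul_sum,
      (ih _ hl.add J hJ I hI).2, Finset.sum_comm, Finset.mul_sum, ← Finset.sum_add_distrib]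
    refine Finset.sum_congr rfl fun m hm => ?_
    have hma : m ≠ a := fun e => haJ (e ▸ hm)
    have haJ' : a ∉ J.erase m := fun h' => haJ (Finset.mem_of_mem_erase h')
    rw [← Finset.mul_sum, (ih _ hl.sub (J.erase m) ((Finset.erase_subset _ _).trans hJ) I hI).1,
      rowVec_cons_out_out haJ' haI]
    simp only [eEntry, rowEntry, sub_add_cancel, add_sub_cancel_right]
    rw [qProd_erase z y (z a) hm]
    have q1 := hz.qProd_ne_zero haJ'
    have h1 := hz.sub_ne hma
    have h3 := hz.add_ne m a
    have h4 := hw m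
    generalize rowVec z y L _ (J.erase m) I = P
    generalize dEig z y w (J.erase m) = P1
    generalize qProd z y (z m) (J.erase m) = P2
    generalize qProd z y (z a) (J.erase m) = P3 at *
    field_simp
    ring

/-- Here L_22 of the larger system involves L_21 of the smaller one at `l + y` together with L_22 at
`l - y`; this is why the two relations have to be proved together. -/
theorem row_out_in :
    (∑ I' ∈ L.toFinset.powerset, (rowVec z y (a :: L) l J I' *
        transfer z y w (insert a L.toFinset) l I' (insert a I) 1 1 +
        rowVec z y (a :: L) l J (insert a I') *
        transfer z y w (insert a L.toFinset) l (insert a I') (insert a I) 1 1) =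
      dEig z y w J * rowVec z y (a :: L) (l + y) J (insert a I)) ∧
    (∑ I' ∈ L.toFinset.powerset, (rowVec z y (a :: L) l J I' *
        transfer z y w (insert a L.toFinset) l I' (insert a I) 1 0 +
        rowVec z y (a :: L) l J (insert a I') *
        transfer z y w (insert a L.toFinset) l (insert a I') (insert a I) 1 0) =
      ∑ m ∈ J, eEntry z y w l J m * rowVec z y (a :: L) (l - y) (J.erase m) (insert a I)) := by
  have haL : ∀ {K : Finset (Fin n)}, K ⊆ L.toFinset → a ∉ K :=
    fun hK h' => lt_irrefl _ (ha a (hK h'))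
  have haJ := haL hJ
  have haI := haL hI
  have n0 := hl.ne_zero
  have n1 := hl.sub.ne_zero
  have n2 := hl.add.ne_zero
  have n3 := hl.sub.sub.ne_zero
  have nw := hw a
  constructor
  · have : ∀ I' ∈ L.toFinset.powerset, (rowVec z y (a :: L) l J I' *
        transfer z y w (insert a L.toFinset) l I' (insert a I) 1 1 +
        rowVec z y (a :: L) l J (insert a I') *
        transfer z y w (insert a L.toFinset) l (insert a I') (insert a I) 1 1) =
        (qProd z y (z a) J)⁻¹ * (-((l + (w - z a)) * y) * (l * (w - z a - y))⁻¹) *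
          (rowVec z y L (l + y) J I' * transfer z y w L.toFinset (l + y) I' I 1 0) +
        ∑ m ∈ J, ((l - y) * (w - z a) * (l * (w - z a - y))⁻¹) * rowEntry z y l a J m *
          (rowVec z y L (l - y) (J.erase m) I' * transfer z y w L.toFinset (l - y) I' I 1 1) := by
      intro I' hI'
      rw [Finset.mem_powerset] at hI'
      rw [(transfer_max_out_in z y w ha (haL hI') l 1).2, rowVec_cons_out_out haJ (haL hI'),
        (transfer_max_in_in z y w ha l 1).2, rowVec_cons_out_in haJ (haL hI'),
        Finset.sum_mul]
      congr 1
      · ring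
      · exact Finset.sum_congr rfl fun m _ => by ring
    rw [Finset.sum_congr rfl this, Finset.sum_add_distrib, ← Finset.mul_sum,
      (ih _ hl.add J hJ I hI).2, Finset.sum_comm, Finset.mul_sum, ← Finset.sum_add_distrib,
      rowVec_cons_out_in haJ haI, Finset.mul_sum]
    refine Finset.sum_congr rfl fun m hm => ?_
    have hma : m ≠ a := fun e => haJ (e ▸ hm)
    have haJ' : a ∉ J.erase m := fun h' => haJ (Finset.mem_of_mem_erase h')
    rw [← Finset.mul_sum, (ih _ hl.sub (J.erase m) ((Finset.erase_subset _ _).trans hJ) I hI).1]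
    simp only [eEntry, rowEntry, sub_add_cancel, add_sub_cancel_right]
    rw [qProd_erase z y (z a) hm, dEig_erase z y w hm]
    have q1 := hz.qProd_ne_zero haJ'
    have h1 := hz.sub_ne hma
    have h3 := hz.add_ne m a
    have h4 := hw m
    generalize rowVec z y L _ (J.erase m) I = P
    generalize dEig z y w (J.erase m) = P1
    generalize qProd z y (z m) (J.erase m) = P2
    generalize qProd z y (z a) (J.erase m) = P3 at *
    field_simp
    ring
  · have : ∀ I' ∈ L.toFinset.powerset, (rowVec z y (a :: L) l J I' *
        transfer z y w (insert a L.toFinset) l I' (insert a I) 1 0 +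
        rowVec z y (a :: L) l J (insert a I') *
        transfer z y w (insert a L.toFinset) l (insert a I') (insert a I) 1 0) =
        ∑ m ∈ J, rowEntry z y l a J m *
          (rowVec z y L (l - y) (J.erase m) I' * transfer z y w L.toFinset (l - y) I' I 1 0) := by
      intro I' hI'
      rw [Finset.mem_powerset] at hI'
      rw [(transfer_max_out_in z y w ha (haL hI') l 1).1, mul_zero, zero_add,
        (transfer_max_in_in z y w ha l 1).1, rowVec_cons_out_in haJ (haL hI'),
        Finset.sum_mul]
      exact Finset.sum_congr rfl fun m _ => by ring
    rw [Finset.sum_congr rfl this, Finset.sum_comm]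
    have hL : ∀ m ∈ J, ∑ I' ∈ L.toFinset.powerset, rowEntry z y l a J m *
          (rowVec z y L (l - y) (J.erase m) I' * transfer z y w L.toFinset (l - y) I' I 1 0) =
        ∑ m' ∈ J.erase m, rowEntry z y l a J m * (eEntry z y w (l - y) (J.erase m) m' *
          rowVec z y L (l - y - y) ((J.erase m).erase m') I) := by
      intro m hm
      rw [← Finset.mul_sum,
        (ih _ hl.sub (J.erase m) ((Finset.erase_subset _ _).trans hJ) I hI).2, Finset.mul_sum]
    have hR : ∀ m ∈ J, eEntry z y w l J m *
          rowVec z y (a :: L) (l - y) (J.erase m) (insert a I) =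
        ∑ m' ∈ J.erase m, eEntry z y w l J m * (rowEntry z y (l - y) a (J.erase m) m' *
          rowVec z y L (l - y - y) ((J.erase m).erase m') I) := by
      intro m hm
      rw [rowVec_cons_out_in (fun h' => haJ (Finset.mem_of_mem_erase h')) haI, Finset.mul_sum]
    rw [Finset.sum_congr rfl hL, Finset.sum_congr rfl hR]
    -- The contributions of (m, m') and (m', m) are added before comparison: both multiply the row
    -- vector of `J` with `m` and `m'` removed.
    refine sum_offDiag_eq_of_symm _ _ _ fun m hm m' hm' hne => ?_
    rw [Finset.erase_right_comm (a := m') (b := m)]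
    have hma : m ≠ a := fun e => haJ (e ▸ hm)
    have hma' : m' ≠ a := fun e => haJ (e ▸ hm')
    have e1 : m' ∈ J.erase m := Finset.mem_erase.2 ⟨hne.symm, hm'⟩
    have e2 : m ∈ J.erase m' := Finset.mem_erase.2 ⟨hne, hm⟩
    have haJ' : a ∉ (J.erase m).erase m' :=
      fun h' => haJ (Finset.mem_of_mem_erase (Finset.mem_of_mem_erase h'))
    simp only [eEntry, rowEntry, Finset.erase_right_comm (a := m') (b := m)]
    rw [qProd_erase z y (z a) e1, qProd_erase z y (z a) e2, qProd_erase z y (z m) e1,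
      qProd_erase z y (z m') e2, dEig_erase z y w e1, dEig_erase z y w e2,
      Finset.erase_right_comm (a := m') (b := m)]
    have q1 := hz.qProd_ne_zero haJ'
    have h1 := hz.sub_ne hma
    have h1' := hz.sub_ne hma'
    have h2 := hz.sub_ne hne
    have h3 := hz.add_ne m a
    have h3' := hz.add_ne m' a
    have h4 := hw m
    have h4' := hw m'
    have h5 : z m' - z m = -(z m - z m') := by ring
    generalize rowVec z y L _ _ I = P
    generalize dEig z y w _ = P1
    generalize qProd z y (z m) _ = P2
    generalize qProd z y (z m') _ = P4
    generalize qProd z y (z a) _ = P3 at *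
    rw [h5]
    field_simp
    ring

end Step

theorem rowRelations (hz : GenericSites z y) (hw : ∀ a, w - z a - y ≠ 0) (L : List (Fin n))
    (hL : L.Pairwise (· > ·)) : RowRelations z y w L := by
  induction L with
  | nil =>
    intro l _ J hJ I hI
    obtain rfl : J = ∅ := by simpa using hJ
    obtain rfl : I = ∅ := by simpa using hI
    simp [rowVec, transfer, dEig]
  | cons a L ih =>
    have hL' := List.pairwise_cons.1 hL
    have ih := ih hL'.2
    have ha : ∀ b ∈ L.toFinset, b < a := fun b hb => hL'.1 b (List.mem_toFinset.1 hb)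
    have haL : a ∉ L.toFinset := fun h' => lt_irrefl _ (ha a h')
    intro l hl J hJ I hI
    rw [List.toFinset_cons] at hJ hI ⊢
    rw [sum_powerset_insert' haL, sum_powerset_insert' haL]
    have hI' := (Finset.subset_insert_iff).1 hI
    have hJ' := (Finset.subset_insert_iff).1 hJ
    by_cases h1 : a ∈ J <;> by_cases h2 : a ∈ I
    · have := row_in_in hz hw ha ih hl hJ' hI'
      rw [Finset.insert_erase h1, Finset.insert_erase h2] at this
      rw [← this.1, ← this.2]
      constructor <;> refine Finset.sum_congr rfl fun I' hI' => ?_ <;>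
        rw [← Finset.insert_erase h1, rowVec_cons_in_out
          (fun h' => haL (Finset.mem_powerset.1 hI' h')), zero_mul, zero_add]
    · rw [Finset.erase_eq_of_notMem h2] at hI'
      have := row_in_out hz hw ha ih hl hJ' hI'
      rw [Finset.insert_erase h1] at this
      rw [← this.1, ← this.2]
      constructor <;> refine Finset.sum_congr rfl fun I' hI' => ?_ <;>
        rw [← Finset.insert_erase h1, rowVec_cons_in_out
          (fun h' => haL (Finset.mem_powerset.1 hI' h')), zero_mul, zero_add]
    · rw [Finset.erase_eq_of_notMem h1] at hJ'
      have := row_out_in hz hw ha ih hl hJ' hI'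
      rwa [Finset.insert_erase h2] at this
    · rw [Finset.erase_eq_of_notMem h1] at hJ'
      rw [Finset.erase_eq_of_notMem h2] at hI'
      exact row_out_out hz hw ha ih hl hJ' hI'

end RowVec

/-! ### Column vectors: the dual basis of the row vectors -/

section ColVec

variable {n : ℕ} {F : Type} [Field F]

/-- The matrix coefficient of `L_{12}` between column vectors for `N` sites. -/
noncomputable def fEntry (z : Fin n → F) (y w : F) (N : ℕ) (l : F) (K : Finset (Fin n))
    (m : Fin n) : F :=
  -(y * (l + w - z m + y * (N - 2 * K.card + 1))) / (w - z m - y) *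
    qProd z y (z m) (K.erase m) * dEig z y w (K.erase m)

/-- The coefficient of the recursion of column vectors. -/
noncomputable def colEntry (z : Fin n → F) (y : F) (N : ℕ) (l : F) (a : Fin n)
    (K : Finset (Fin n)) (m : Fin n) : F :=
  (qProd z y (z a) (K.erase m))⁻¹ * y * qProd z y (z m) (K.erase m) *
    (l - (2 * (K.card - 1) - N) * y - y + z a - z m) / (z m - z a + y)

/-- The dual basis of `rowVec` up to normalization, for the sites in a list in increasing order. -/
noncomputable def colVec (z : Fin n → F) (y : F) :
    List (Fin n) → F → Finset (Fin n) → Finset (Fin n) → F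
  | [], _, _, _ => 1
  | a :: L, l, K, I =>
    if a ∈ K then
      if a ∈ I then (l - (2 * (K.card - 1) - L.length) * y - y) *
        colVec z y L l (K.erase a) (I.erase a) else 0
    else
      if a ∈ I then
        ∑ m ∈ K, colEntry z y L.length l a K m * colVec z y L l (K.erase m) (I.erase a)
      else (qProd z y (z a) K)⁻¹ * colVec z y L l K I

variable {z : Fin n → F} {y w : F}

theorem colVec_cons_in_in {a : Fin n} {L : List (Fin n)} {l : F} {K I : Finset (Fin n)}
    (hK : a ∉ K) (hI : a ∉ I) :
    colVec z y (a :: L) l (insert a K) (insert a I) =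
      (l - (2 * K.card - L.length) * y - y) * colVec z y L l K I := by
  simp [colVec, hK, hI]

theorem colVec_cons_in_out {a : Fin n} {L : List (Fin n)} {l : F} {K I : Finset (Fin n)}
    (hI : a ∉ I) : colVec z y (a :: L) l (insert a K) I = 0 := by
  simp [colVec, hI]

theorem colVec_cons_out_in {a : Fin n} {L : List (Fin n)} {l : F} {K I : Finset (Fin n)}
    (hK : a ∉ K) (hI : a ∉ I) :
    colVec z y (a :: L) l K (insert a I) =
      ∑ m ∈ K, colEntry z y L.length l a K m * colVec z y L l (K.erase m) I := by
  simp [colVec, hK, hI]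

theorem colVec_cons_out_out {a : Fin n} {L : List (Fin n)} {l : F} {K I : Finset (Fin n)}
    (hK : a ∉ K) (hI : a ∉ I) :
    colVec z y (a :: L) l K I = (qProd z y (z a) K)⁻¹ * colVec z y L l K I := by
  simp [colVec, hK, hI]

/-- Weight conservation. The R-matrix of the smallest site carries the parameter `l - hSum I y`,
which depends on the component `I`, while the recursion of column vectors knows only `K`. On the
support the two cardinalities agree and the parameter is determined by `K`. -/
theorem colVec_eq_zero (L : List (Fin n)) (hL : L.Nodup) (l : F) {K I : Finset (Fin n)}
    (hK : K ⊆ L.toFinset) (hI : I ⊆ L.toFinset) (h : I.card ≠ K.card) :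
    colVec z y L l K I = 0 := by
  induction L generalizing K I with
  | nil =>
    obtain rfl : K = ∅ := by simpa using hK
    obtain rfl : I = ∅ := by simpa using hI
    exact absurd rfl h
  | cons a L ih =>
    have hL' := List.nodup_cons.1 hL
    rw [List.toFinset_cons] at hK hI
    have hI' := (Finset.subset_insert_iff).1 hI
    have hK' := (Finset.subset_insert_iff).1 hK
    unfold colVec
    split_ifs with h1 h2 h2
    · rw [ih hL'.2 hK' hI', mul_zero]
      rw [Finset.card_erase_of_mem h1, Finset.card_erase_of_mem h2]
      have := Finset.card_pos.2 ⟨a, h1⟩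
      have := Finset.card_pos.2 ⟨a, h2⟩
      omega
    · rfl
    · rw [Finset.erase_eq_of_notMem h1] at hK'
      refine Finset.sum_eq_zero fun m hm => ?_
      rw [ih hL'.2 ((Finset.erase_subset _ _).trans hK') hI', mul_zero]
      rw [Finset.card_erase_of_mem hm, Finset.card_erase_of_mem h2]
      have := Finset.card_pos.2 ⟨m, hm⟩
      have := Finset.card_pos.2 ⟨a, h2⟩
      omega
    · rw [Finset.erase_eq_of_notMem h1] at hK'
      rw [Finset.erase_eq_of_notMem h2] at hI'
      rw [ih hL'.2 hK' hI' h, mul_zero]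

variable (z y w) in
/-- The action of `L_{22}` and `L_{12}` on column vectors. -/
def ColRelations (L : List (Fin n)) : Prop :=
  ∀ l, IsGeneric y l → ∀ K ⊆ L.toFinset, ∀ I ⊆ L.toFinset,
    (∑ I' ∈ L.toFinset.powerset, transfer z y w L.toFinset l I I' 1 1 * colVec z y L (l + y) K I' =
      dEig z y w K * colVec z y L l K I) ∧
    (∑ I' ∈ L.toFinset.powerset, transfer z y w L.toFinset l I I' 0 1 * colVec z y L (l + y) K I' =
      ∑ m ∈ K, fEntry z y w L.length l K m * colVec z y L l (K.erase m) I)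

/-! ### Induction step for column vectors: adding a smallest site `a` -/

section Step

variable (hz : GenericSites z y) (hw : ∀ a, w - z a - y ≠ 0) {a : Fin n} {L : List (Fin n)}
  (hL : L.Nodup)
  (ha : ∀ b ∈ L.toFinset, a < b) (ih : ColRelations z y w L) {l : F} (hl : IsGeneric y l)
  {K I : Finset (Fin n)} (hK : K ⊆ L.toFinset) (hI : I ⊆ L.toFinset)

include hl in
theorem IsGeneric.sub_hSum (A I : Finset (Fin n)) : l - (hSum A I : F) * y ≠ 0 := by
  have := hl (-(hSum A I))
  push_cast at this
  rwa [neg_mul, ← sub_eq_add_neg] at this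

include hL hI in
theorem hSum_eq_of_card {K : Finset (Fin n)} (h : I.card = K.card) :
    ((hSum L.toFinset I : ℤ) : F) = 2 * K.card - L.length := by
  rw [hSum_eq_card hI, List.toFinset_card_of_nodup hL, h]
  push_cast
  ring

include hz hw hL ha ih hl hK hI

theorem col_in_in :
    (∑ I' ∈ L.toFinset.powerset,
        transfer z y w (insert a L.toFinset) l (insert a I) (insert a I') 1 1 *
        colVec z y (a :: L) (l + y) (insert a K) (insert a I') =
      dEig z y w (insert a K) * colVec z y (a :: L) l (insert a K) (insert a I)) ∧
    (∑ I' ∈ L.toFinset.powerset,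
        transfer z y w (insert a L.toFinset) l (insert a I) (insert a I') 0 1 *
        colVec z y (a :: L) (l + y) (insert a K) (insert a I') =
      ∑ m ∈ insert a K, fEntry z y w (a :: L).length l (insert a K) m *
        colVec z y (a :: L) l ((insert a K).erase m) (insert a I)) := by
  have haL : ∀ {K : Finset (Fin n)}, K ⊆ L.toFinset → a ∉ K :=
    fun hK h' => lt_irrefl _ (ha a (hK h'))
  have haK := haL hK
  have haI := haL hI
  obtain ⟨ih1, ih2⟩ := ih _ hl K hK I hI
  have n0 := hl.sub_hSum L.toFinset I
  have nw := hw a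
  constructor
  · obtain ⟨μ, hμ⟩ : ∃ μ, μ = l - (hSum L.toFinset I : F) * y := ⟨_, rfl⟩
    have : ∀ I' ∈ L.toFinset.powerset,
        transfer z y w (insert a L.toFinset) l (insert a I) (insert a I') 1 1 *
        colVec z y (a :: L) (l + y) (insert a K) (insert a I') =
        ((μ - y) * (w - z a) * (μ * (w - z a - y))⁻¹) * (l - (2 * K.card - L.length) * y) *
          (transfer z y w L.toFinset l I I' 1 1 * colVec z y L (l + y) K I') := by
      intro I' hI'
      rw [Finset.mem_powerset] at hI'
      rw [colVec_cons_in_in haK (haL hI'), (transfer_min_in_in z y w ha l μ hμ 1).2]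
      ring
    rw [Finset.sum_congr rfl this, ← Finset.mul_sum, ih1, colVec_cons_in_in haK haI,
      dEig_erase z y w (Finset.mem_insert_self a K), Finset.erase_insert haK]
    -- If the cardinalities differ, both sides vanish. Otherwise the factor from the recursion at `l
    -- + y` is exactly `μ`, cancelling the denominator of the R-matrix, and the factor at `l` is `μ
    -- - y`.
    by_cases hc : I.card = K.card
    · rw [hSum_eq_of_card hL hI hc] at hμ
      rw [← hμ]
      rw [hSum_eq_of_card hL hI hc, ← hμ] at n0
      field_simp
    · rw [colVec_eq_zero L hL l hK hI hc]
      simp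
  · have : ∀ I' ∈ L.toFinset.powerset,
        transfer z y w (insert a L.toFinset) l (insert a I) (insert a I') 0 1 *
        colVec z y (a :: L) (l + y) (insert a K) (insert a I') =
        (l - (2 * K.card - L.length) * y) *
          (transfer z y w L.toFinset l I I' 0 1 * colVec z y L (l + y) K I') := by
      intro I' hI'
      rw [Finset.mem_powerset] at hI'
      rw [colVec_cons_in_in haK (haL hI'), (transfer_min_in_in z y w ha l _ rfl 1).1]
      ring
    rw [Finset.sum_congr rfl this, ← Finset.mul_sum, ih2, Finset.sum_insert haK,
      Finset.erase_insert haK, colVec_cons_out_in haK haI, Finset.mul_sum, Finset.mul_sum,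
      ← Finset.sum_add_distrib]
    refine Finset.sum_congr rfl fun m hm => ?_
    have hma : m ≠ a := fun e => haK (e ▸ hm)
    have haK' : a ∉ K.erase m := fun h' => haK (Finset.mem_of_mem_erase h')
    rw [Finset.erase_insert_of_ne hma.symm, colVec_cons_in_in haK' haI,
      Finset.cast_card_erase_of_mem hm]
    simp only [fEntry, colEntry, Finset.erase_insert haK, Finset.erase_insert_of_ne hma.symm,
      Finset.card_insert_of_notMem haK, List.length_cons]
    rw [qProd_erase z y (z m) (Finset.mem_insert_self a (K.erase m)),
      dEig_erase z y w (Finset.mem_insert_self a (K.erase m)), Finset.erase_insert haK',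
      qProd_erase z y (z a) hm, dEig_erase z y w hm]
    have q1 := hz.qProd_ne_zero haK'
    have h1 := hz.sub_ne hma
    have h3 := hz.add_ne m a
    have h4 := hw m
    have h2' : z a - z m = - (z m - z a) := by ring
    push_cast
    generalize colVec z y L _ (K.erase m) I = P
    generalize dEig z y w (K.erase m) = P1
    generalize qProd z y (z m) (K.erase m) = P2
    generalize qProd z y (z a) (K.erase m) = P3 at *
    generalize (K.card : F) = c
    generalize (L.length : F) = N
    rw [h2']
    field_simp
    ring

theorem col_in_out :
    (∑ I' ∈ L.toFinset.powerset,
        transfer z y w (insert a L.toFinset) l I (insert a I') 1 1 *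
        colVec z y (a :: L) (l + y) (insert a K) (insert a I') =
      dEig z y w (insert a K) * colVec z y (a :: L) l (insert a K) I) ∧
    (∑ I' ∈ L.toFinset.powerset,
        transfer z y w (insert a L.toFinset) l I (insert a I') 0 1 *
        colVec z y (a :: L) (l + y) (insert a K) (insert a I') =
      ∑ m ∈ insert a K, fEntry z y w (a :: L).length l (insert a K) m *
        colVec z y (a :: L) l ((insert a K).erase m) I) := by
  have haL : ∀ {K : Finset (Fin n)}, K ⊆ L.toFinset → a ∉ K :=
    fun hK h' => lt_irrefl _ (ha a (hK h'))
  have haK := haL hK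
  have haI := haL hI
  obtain ⟨ih1, ih2⟩ := ih _ hl K hK I hI
  have n0 := hl.sub_hSum L.toFinset I
  have nw := hw a
  constructor
  · rw [colVec_cons_in_out haI, mul_zero]
    refine Finset.sum_eq_zero fun I' hI' => ?_
    rw [(transfer_min_out_in z y w ha haI l _ rfl 1).2, zero_mul]
  · obtain ⟨μ, hμ⟩ : ∃ μ, μ = l - (hSum L.toFinset I : F) * y := ⟨_, rfl⟩
    have : ∀ I' ∈ L.toFinset.powerset,
        transfer z y w (insert a L.toFinset) l I (insert a I') 0 1 *
        colVec z y (a :: L) (l + y) (insert a K) (insert a I') =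
        (-((μ + (w - z a)) * y) * (μ * (w - z a - y))⁻¹) * (l - (2 * K.card - L.length) * y) *
          (transfer z y w L.toFinset l I I' 1 1 * colVec z y L (l + y) K I') := by
      intro I' hI'
      rw [Finset.mem_powerset] at hI'
      rw [colVec_cons_in_in haK (haL hI'), (transfer_min_out_in z y w ha haI l μ hμ 1).1]
      ring
    rw [Finset.sum_congr rfl this, ← Finset.mul_sum, ih1, Finset.sum_insert haK,
      Finset.erase_insert haK, colVec_cons_out_out haK haI, Finset.sum_eq_zero, add_zero]
    · by_cases hc : I.card = K.card
      · rw [hSum_eq_of_card hL hI hc] at hμ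
        rw [← hμ]
        rw [hSum_eq_of_card hL hI hc, ← hμ] at n0
        have q1 := hz.qProd_ne_zero haK
        simp only [fEntry, Finset.erase_insert haK, Finset.card_insert_of_notMem haK,
          List.length_cons]
        push_cast
        have hμ' : l = μ + (2 * K.card - L.length) * y := by rw [hμ]; ring
        rw [hμ']
        generalize colVec z y L _ K I = P
        field_simp
        ring
      · rw [colVec_eq_zero L hL l hK hI hc]
        simp
    · intro m hm
      have hma : m ≠ a := fun e => haK (e ▸ hm)
      rw [Finset.erase_insert_of_ne hma.symm, colVec_cons_in_out haI, mul_zero]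

theorem col_out_out :
    (∑ I' ∈ L.toFinset.powerset, (transfer z y w (insert a L.toFinset) l I I' 1 1 *
        colVec z y (a :: L) (l + y) K I' +
        transfer z y w (insert a L.toFinset) l I (insert a I') 1 1 *
        colVec z y (a :: L) (l + y) K (insert a I')) =
      dEig z y w K * colVec z y (a :: L) l K I) ∧
    (∑ I' ∈ L.toFinset.powerset, (transfer z y w (insert a L.toFinset) l I I' 0 1 *
        colVec z y (a :: L) (l + y) K I' +
        transfer z y w (insert a L.toFinset) l I (insert a I') 0 1 *
        colVec z y (a :: L) (l + y) K (insert a I')) =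
      ∑ m ∈ K, fEntry z y w (a :: L).length l K m * colVec z y (a :: L) l (K.erase m) I) := by
  have haL : ∀ {K : Finset (Fin n)}, K ⊆ L.toFinset → a ∉ K :=
    fun hK h' => lt_irrefl _ (ha a (hK h'))
  have haK := haL hK
  have haI := haL hI
  obtain ⟨ih1, ih2⟩ := ih _ hl K hK I hI
  have n0 := hl.sub_hSum L.toFinset I
  have nw := hw a
  constructor
  · have : ∀ I' ∈ L.toFinset.powerset, (transfer z y w (insert a L.toFinset) l I I' 1 1 *
        colVec z y (a :: L) (l + y) K I' +
        transfer z y w (insert a L.toFinset) l I (insert a I') 1 1 *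
        colVec z y (a :: L) (l + y) K (insert a I')) =
        (qProd z y (z a) K)⁻¹ *
          (transfer z y w L.toFinset l I I' 1 1 * colVec z y L (l + y) K I') := by
      intro I' hI'
      rw [Finset.mem_powerset] at hI'
      rw [(transfer_min_out_in z y w ha haI l _ rfl 1).2, colVec_cons_out_out haK (haL hI'),
        (transfer_min_out_out z y w ha haI (haL hI') l _ rfl 1).2]
      ring
    rw [Finset.sum_congr rfl this, ← Finset.mul_sum, ih1, colVec_cons_out_out haK haI]
    ring
  · obtain ⟨μ, hμ⟩ : ∃ μ, μ = l - (hSum L.toFinset I : F) * y := ⟨_, rfl⟩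
    have : ∀ I' ∈ L.toFinset.powerset, (transfer z y w (insert a L.toFinset) l I I' 0 1 *
        colVec z y (a :: L) (l + y) K I' +
        transfer z y w (insert a L.toFinset) l I (insert a I') 0 1 *
        colVec z y (a :: L) (l + y) K (insert a I')) =
        (qProd z y (z a) K)⁻¹ * ((μ + y) * (w - z a) * (μ * (w - z a - y))⁻¹) *
          (transfer z y w L.toFinset l I I' 0 1 * colVec z y L (l + y) K I') +
        ∑ m ∈ K, (-((μ + (w - z a)) * y) * (μ * (w - z a - y))⁻¹) *
          colEntry z y L.length (l + y) a K m *
          (transfer z y w L.toFinset l I I' 1 1 * colVec z y L (l + y) (K.erase m) I') := by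
      intro I' hI'
      rw [Finset.mem_powerset] at hI'
      rw [(transfer_min_out_in z y w ha haI l μ hμ 1).1, colVec_cons_out_out haK (haL hI'),
        (transfer_min_out_out z y w ha haI (haL hI') l μ hμ 1).1,
        colVec_cons_out_in haK (haL hI'), Finset.mul_sum]
      congr 1
      · ring
      · exact Finset.sum_congr rfl fun m _ => by ring
    rw [Finset.sum_congr rfl this, Finset.sum_add_distrib, ← Finset.mul_sum, ih2,
      Finset.sum_comm, Finset.mul_sum, ← Finset.sum_add_distrib]
    refine Finset.sum_congr rfl fun m hm => ?_
    have hma : m ≠ a := fun e => haK (e ▸ hm)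
    have haK' : a ∉ K.erase m := fun h' => haK (Finset.mem_of_mem_erase h')
    have hKm : K.erase m ⊆ L.toFinset := (Finset.erase_subset _ _).trans hK
    rw [← Finset.mul_sum, (ih _ hl (K.erase m) hKm I hI).1, colVec_cons_out_out haK' haI]
    by_cases hc : I.card = (K.erase m).card
    · rw [hSum_eq_of_card hL hI hc, Finset.cast_card_erase_of_mem hm] at hμ n0
      rw [← hμ] at n0
      simp only [fEntry, colEntry, List.length_cons]
      rw [qProd_erase z y (z a) hm]
      have q1 := hz.qProd_ne_zero haK'
      have h1 := hz.sub_ne hma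
      have h3 := hz.add_ne m a
      have h4 := hw m
      have hμ' : l = μ + (2 * (K.card - 1) - L.length) * y := by rw [hμ]; ring
      rw [hμ']
      push_cast
      generalize colVec z y L _ (K.erase m) I = P
      generalize dEig z y w (K.erase m) = P1
      generalize qProd z y (z m) (K.erase m) = P2
      generalize qProd z y (z a) (K.erase m) = P3 at *
      field_simp
      ring
    · rw [colVec_eq_zero L hL l hKm hI hc]
      simp

theorem col_out_in :
    (∑ I' ∈ L.toFinset.powerset, (transfer z y w (insert a L.toFinset) l (insert a I) I' 1 1 *
        colVec z y (a :: L) (l + y) K I' +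
        transfer z y w (insert a L.toFinset) l (insert a I) (insert a I') 1 1 *
        colVec z y (a :: L) (l + y) K (insert a I')) =
      dEig z y w K * colVec z y (a :: L) l K (insert a I)) ∧
    (∑ I' ∈ L.toFinset.powerset, (transfer z y w (insert a L.toFinset) l (insert a I) I' 0 1 *
        colVec z y (a :: L) (l + y) K I' +
        transfer z y w (insert a L.toFinset) l (insert a I) (insert a I') 0 1 *
        colVec z y (a :: L) (l + y) K (insert a I')) =
      ∑ m ∈ K, fEntry z y w (a :: L).length l K m *
        colVec z y (a :: L) l (K.erase m) (insert a I)) := by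
  have haL : ∀ {K : Finset (Fin n)}, K ⊆ L.toFinset → a ∉ K :=
    fun hK h' => lt_irrefl _ (ha a (hK h'))
  have haK := haL hK
  have haI := haL hI
  obtain ⟨ih1, ih2⟩ := ih _ hl K hK I hI
  have n0 := hl.sub_hSum L.toFinset I
  have nw := hw a
  constructor
  · obtain ⟨μ, hμ⟩ : ∃ μ, μ = l - (hSum L.toFinset I : F) * y := ⟨_, rfl⟩
    have : ∀ I' ∈ L.toFinset.powerset,
        (transfer z y w (insert a L.toFinset) l (insert a I) I' 1 1 *
        colVec z y (a :: L) (l + y) K I' +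
        transfer z y w (insert a L.toFinset) l (insert a I) (insert a I') 1 1 *
        colVec z y (a :: L) (l + y) K (insert a I')) =
        (qProd z y (z a) K)⁻¹ * (-((μ - (w - z a)) * y) * (μ * (w - z a - y))⁻¹) *
          (transfer z y w L.toFinset l I I' 0 1 * colVec z y L (l + y) K I') +
        ∑ m ∈ K, ((μ - y) * (w - z a) * (μ * (w - z a - y))⁻¹) *
          colEntry z y L.length (l + y) a K m *
          (transfer z y w L.toFinset l I I' 1 1 * colVec z y L (l + y) (K.erase m) I') := by
      intro I' hI'
      rw [Finset.mem_powerset] at hI'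
      rw [(transfer_min_in_out z y w ha (haL hI') l μ hμ 1).2, colVec_cons_out_out haK (haL hI'),
        (transfer_min_in_in z y w ha l μ hμ 1).2,
        colVec_cons_out_in haK (haL hI'), Finset.mul_sum]
      congr 1
      · ring
      · exact Finset.sum_congr rfl fun m _ => by ring
    rw [Finset.sum_congr rfl this, Finset.sum_add_distrib, ← Finset.mul_sum, ih2,
      Finset.sum_comm, Finset.mul_sum, ← Finset.sum_add_distrib, colVec_cons_out_in haK haI,
      Finset.mul_sum]
    refine Finset.sum_congr rfl fun m hm => ?_
    have hma : m ≠ a := fun e => haK (e ▸ hm)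
    have haK' : a ∉ K.erase m := fun h' => haK (Finset.mem_of_mem_erase h')
    have hKm : K.erase m ⊆ L.toFinset := (Finset.erase_subset _ _).trans hK
    rw [← Finset.mul_sum, (ih _ hl (K.erase m) hKm I hI).1]
    by_cases hc : I.card = (K.erase m).card
    · rw [hSum_eq_of_card hL hI hc, Finset.cast_card_erase_of_mem hm] at hμ n0
      rw [← hμ] at n0
      simp only [fEntry, colEntry]
      rw [qProd_erase z y (z a) hm, dEig_erase z y w hm]
      have q1 := hz.qProd_ne_zero haK'
      have h1 := hz.sub_ne hma
      have h3 := hz.add_ne m a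
      have h4 := hw m
      have hμ' : l = μ + (2 * (K.card - 1) - L.length) * y := by rw [hμ]; ring
      rw [hμ']
      generalize colVec z y L _ (K.erase m) I = P
      generalize dEig z y w (K.erase m) = P1
      generalize qProd z y (z m) (K.erase m) = P2
      generalize qProd z y (z a) (K.erase m) = P3 at *
      field_simp
      ring
    · rw [colVec_eq_zero L hL l hKm hI hc]
      simp
  · have : ∀ I' ∈ L.toFinset.powerset,
        (transfer z y w (insert a L.toFinset) l (insert a I) I' 0 1 *
        colVec z y (a :: L) (l + y) K I' +
        transfer z y w (insert a L.toFinset) l (insert a I) (insert a I') 0 1 *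
        colVec z y (a :: L) (l + y) K (insert a I')) =
        ∑ m ∈ K, colEntry z y L.length (l + y) a K m *
          (transfer z y w L.toFinset l I I' 0 1 * colVec z y L (l + y) (K.erase m) I') := by
      intro I' hI'
      rw [Finset.mem_powerset] at hI'
      rw [(transfer_min_in_out z y w ha (haL hI') l _ rfl 1).1, zero_mul, zero_add,
        (transfer_min_in_in z y w ha l _ rfl 1).1, colVec_cons_out_in haK (haL hI'),
        Finset.mul_sum]
      exact Finset.sum_congr rfl fun m _ => by ring
    rw [Finset.sum_congr rfl this, Finset.sum_comm]
    have hLm : ∀ m ∈ K, ∑ I' ∈ L.toFinset.powerset, colEntry z y L.length (l + y) a K m *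
          (transfer z y w L.toFinset l I I' 0 1 * colVec z y L (l + y) (K.erase m) I') =
        ∑ m' ∈ K.erase m, colEntry z y L.length (l + y) a K m *
          (fEntry z y w L.length l (K.erase m) m' *
          colVec z y L l ((K.erase m).erase m') I) := by
      intro m hm
      rw [← Finset.mul_sum,
        (ih _ hl (K.erase m) ((Finset.erase_subset _ _).trans hK) I hI).2, Finset.mul_sum]
    have hR : ∀ m ∈ K, fEntry z y w (a :: L).length l K m *
          colVec z y (a :: L) l (K.erase m) (insert a I) =
        ∑ m' ∈ K.erase m, fEntry z y w (a :: L).length l K m *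
          (colEntry z y L.length l a (K.erase m) m' *
          colVec z y L l ((K.erase m).erase m') I) := by
      intro m hm
      rw [colVec_cons_out_in (fun h' => haK (Finset.mem_of_mem_erase h')) haI, Finset.mul_sum]
    rw [Finset.sum_congr rfl hLm, Finset.sum_congr rfl hR]
    -- As for rows, the two orders of removing `m` and `m'` are compared together.
    refine sum_offDiag_eq_of_symm _ _ _ fun m hm m' hm' hne => ?_
    rw [Finset.erase_right_comm (a := m') (b := m)]
    have hma : m ≠ a := fun e => haK (e ▸ hm)
    have hma' : m' ≠ a := fun e => haK (e ▸ hm')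
    have e1 : m' ∈ K.erase m := Finset.mem_erase.2 ⟨hne.symm, hm'⟩
    have e2 : m ∈ K.erase m' := Finset.mem_erase.2 ⟨hne, hm⟩
    have haK' : a ∉ (K.erase m).erase m' :=
      fun h' => haK (Finset.mem_of_mem_erase (Finset.mem_of_mem_erase h'))
    simp only [fEntry, colEntry, Finset.erase_right_comm (a := m') (b := m),
      Finset.cast_card_erase_of_mem hm, Finset.cast_card_erase_of_mem hm', List.length_cons]
    rw [qProd_erase z y (z a) e1, qProd_erase z y (z a) e2, qProd_erase z y (z m) e1,
      qProd_erase z y (z m') e2, dEig_erase z y w e1, dEig_erase z y w e2,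
      Finset.erase_right_comm (a := m') (b := m)]
    have q1 := hz.qProd_ne_zero haK'
    have h1 := hz.sub_ne hma
    have h1' := hz.sub_ne hma'
    have h2 := hz.sub_ne hne
    have h3 := hz.add_ne m a
    have h3' := hz.add_ne m' a
    have h4 := hw m
    have h4' := hw m'
    have h5 : z m' - z m = -(z m - z m') := by ring
    push_cast
    generalize colVec z y L _ _ I = P
    generalize dEig z y w _ = P1
    generalize qProd z y (z m) _ = P2
    generalize qProd z y (z m') _ = P4
    generalize qProd z y (z a) _ = P3 at *
    generalize (K.card : F) = c
    generalize (L.length : F) = N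
    rw [h5]
    field_simp
    ring

end Step

theorem colRelations (hz : GenericSites z y) (hw : ∀ a, w - z a - y ≠ 0) (L : List (Fin n))
    (hL : L.Pairwise (· < ·)) : ColRelations z y w L := by
  induction L with
  | nil =>
    intro l _ J hJ I hI
    obtain rfl : J = ∅ := by simpa using hJ
    obtain rfl : I = ∅ := by simpa using hI
    simp [colVec, transfer, dEig]
  | cons a L ih =>
    have hL' := List.pairwise_cons.1 hL
    have ih := ih hL'.2
    have hnd : L.Nodup := hL'.2.imp ne_of_lt
    have ha : ∀ b ∈ L.toFinset, a < b := fun b hb => hL'.1 b (List.mem_toFinset.1 hb)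
    have haL : a ∉ L.toFinset := fun h' => lt_irrefl _ (ha a h')
    intro l hl J hJ I hI
    rw [List.toFinset_cons] at hJ hI ⊢
    rw [sum_powerset_insert' haL, sum_powerset_insert' haL]
    have hI' := (Finset.subset_insert_iff).1 hI
    have hJ' := (Finset.subset_insert_iff).1 hJ
    by_cases h1 : a ∈ J <;> by_cases h2 : a ∈ I
    · have := col_in_in hz hw hnd ha ih hl hJ' hI'
      rw [Finset.insert_erase h1, Finset.insert_erase h2] at this
      rw [← this.1, ← this.2]
      constructor <;> refine Finset.sum_congr rfl fun I' hI' => ?_ <;>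
        rw [← Finset.insert_erase h1, colVec_cons_in_out
          (fun h' => haL (Finset.mem_powerset.1 hI' h')), mul_zero, zero_add]
    · rw [Finset.erase_eq_of_notMem h2] at hI'
      have := col_in_out hz hw hnd ha ih hl hJ' hI'
      rw [Finset.insert_erase h1] at this
      rw [← this.1, ← this.2]
      constructor <;> refine Finset.sum_congr rfl fun I' hI' => ?_ <;>
        rw [← Finset.insert_erase h1, colVec_cons_in_out
          (fun h' => haL (Finset.mem_powerset.1 hI' h')), mul_zero, zero_add]
    · rw [Finset.erase_eq_of_notMem h1] at hJ'
      have := col_out_in hz hw hnd ha ih hl hJ' hI'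
      rwa [Finset.insert_erase h2] at this
    · rw [Finset.erase_eq_of_notMem h1] at hJ'
      rw [Finset.erase_eq_of_notMem h2] at hI'
      exact col_out_out hz hw hnd ha ih hl hJ' hI'

end ColVec

/-! ### The pairing of row and column vectors -/

section Pairing

variable {n : ℕ} {F : Type} [Field F] {z : Fin n → F} {y : F}

/-- A weight that is monotone for the Bruhat order on subsets. -/
def bruhatWeight (I : Finset (Fin n)) : ℕ := ∑ i ∈ I, 2 ^ (i : ℕ)

/-- Uniqueness of binary expansions. Injectivity makes the weight a total order on subsets, so
triangularity can be read off from it. -/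
theorem bruhatWeight_injective : Function.Injective (bruhatWeight (n := n)) := by
  intro I J h
  have h1 : ∀ K : Finset (Fin n), bruhatWeight K = ∑ i ∈ K.map Fin.valEmbedding, 2 ^ i := by
    intro K
    rw [Finset.sum_map]
    rfl
  rw [h1, h1] at h
  exact Finset.map_injective _ (Finset.geomSum_injective le_rfl h)

theorem bruhatWeight_erase {I : Finset (Fin n)} {a : Fin n} (h : a ∈ I) :
    bruhatWeight (I.erase a) + 2 ^ (a : ℕ) = bruhatWeight I :=
  Finset.sum_erase_add _ _ h

/-- Each step of the recursion either treats the site `a` alike in `J` and `I`, or matches `a ∈ I`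
with a smaller site `m ∈ J`. Either way the weight of `I` is not less than that of `J`. -/
theorem bruhatWeight_le_of_rowVec_ne_zero (L : List (Fin n)) (hL : L.Pairwise (· > ·)) (l : F)
    {J I : Finset (Fin n)} (hJ : J ⊆ L.toFinset) (hI : I ⊆ L.toFinset)
    (h : rowVec z y L l J I ≠ 0) : bruhatWeight J ≤ bruhatWeight I := by
  induction L generalizing J I l with
  | nil =>
    obtain rfl : J = ∅ := by simpa using hJ
    exact Nat.zero_le _
  | cons a L ih =>
    have hL' := List.pairwise_cons.1 hL
    rw [List.toFinset_cons] at hJ hI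
    have hI' := (Finset.subset_insert_iff).1 hI
    have hJ' := (Finset.subset_insert_iff).1 hJ
    unfold rowVec at h
    split_ifs at h with h1 h2 h2
    · have := ih hL'.2 _ hJ' hI' (right_ne_zero_of_mul h)
      rw [← bruhatWeight_erase h1, ← bruhatWeight_erase h2]
      omega
    · exact absurd rfl h
    · rw [Finset.erase_eq_of_notMem h1] at hJ'
      obtain ⟨m, hm, hne⟩ := Finset.exists_ne_zero_of_sum_ne_zero h
      have := ih hL'.2 _ ((Finset.erase_subset _ _).trans hJ') hI' (right_ne_zero_of_mul hne)
      have hma : m < a := hL'.1 m (List.mem_toFinset.1 (hJ' hm))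
      have : 2 ^ (m : ℕ) ≤ 2 ^ (a : ℕ) := Nat.pow_le_pow_right two_pos (Fin.le_def.1 hma.le)
      rw [← bruhatWeight_erase hm, ← bruhatWeight_erase h2]
      omega
    · rw [Finset.erase_eq_of_notMem h1] at hJ'
      rw [Finset.erase_eq_of_notMem h2] at hI'
      exact ih hL'.2 _ hJ' hI' (right_ne_zero_of_mul h)

/-- The opposite inequality, since the recursion now matches the smallest site `a ∈ I` with a larger
site of `K`. -/
theorem bruhatWeight_le_of_colVec_ne_zero (L : List (Fin n)) (hL : L.Pairwise (· < ·)) (l : F)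
    {K I : Finset (Fin n)} (hK : K ⊆ L.toFinset) (hI : I ⊆ L.toFinset)
    (h : colVec z y L l K I ≠ 0) : bruhatWeight I ≤ bruhatWeight K := by
  induction L generalizing K I with
  | nil =>
    obtain rfl : I = ∅ := by simpa using hI
    exact Nat.zero_le _
  | cons a L ih =>
    have hL' := List.pairwise_cons.1 hL
    rw [List.toFinset_cons] at hK hI
    have hI' := (Finset.subset_insert_iff).1 hI
    have hK' := (Finset.subset_insert_iff).1 hK
    unfold colVec at h
    split_ifs at h with h1 h2 h2
    · have := ih hL'.2 hK' hI' (right_ne_zero_of_mul h)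
      rw [← bruhatWeight_erase h1, ← bruhatWeight_erase h2]
      omega
    · exact absurd rfl h
    · rw [Finset.erase_eq_of_notMem h1] at hK'
      obtain ⟨m, hm, hne⟩ := Finset.exists_ne_zero_of_sum_ne_zero h
      have := ih hL'.2 ((Finset.erase_subset _ _).trans hK') hI' (right_ne_zero_of_mul hne)
      have hma : a < m := hL'.1 m (List.mem_toFinset.1 (hK' hm))
      have : 2 ^ (a : ℕ) ≤ 2 ^ (m : ℕ) := Nat.pow_le_pow_right two_pos (Fin.le_def.1 hma.le)
      rw [← bruhatWeight_erase hm, ← bruhatWeight_erase h2]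
      omega
    · rw [Finset.erase_eq_of_notMem h1] at hK'
      rw [Finset.erase_eq_of_notMem h2] at hI'
      exact ih hL'.2 hK' hI' (right_ne_zero_of_mul h)

variable (y) in
/-- The factor `λ - (w(i,J) + 1) y` for the sites in `A`. -/
def lamFactor (A J : Finset (Fin n)) (l : F) (i : Fin n) : F :=
  l - ((hSum (A.filter (i < ·)) J : F) + 1) * y

/-- On the diagonal the recursion never enters the branch with a sum, so it unwinds to a product. -/
theorem rowVec_self (L : List (Fin n)) (hL : L.Pairwise (· > ·)) (l : F)
    {J : Finset (Fin n)} (hJ : J ⊆ L.toFinset) :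
    rowVec z y L l J J = (∏ i ∈ J, (lamFactor y L.toFinset J l i)⁻¹) *
      ∏ b ∈ L.toFinset \ J, (qProd z y (z b) (J.filter (· < b)))⁻¹ := by
  induction L generalizing J l with
  | nil =>
    obtain rfl : J = ∅ := by simpa using hJ
    simp [rowVec]
  | cons a L ih =>
    have hL' := List.pairwise_cons.1 hL
    have ha : ∀ b ∈ L.toFinset, b < a := fun b hb => hL'.1 b (List.mem_toFinset.1 hb)
    have haL : a ∉ L.toFinset := fun h' => lt_irrefl _ (ha a h')
    rw [List.toFinset_cons] at hJ ⊢
    have hJ' := (Finset.subset_insert_iff).1 hJ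
    by_cases h1 : a ∈ J
    · obtain ⟨J', hJa, rfl⟩ : ∃ J', a ∉ J' ∧ insert a J' = J :=
        ⟨J.erase a, Finset.notMem_erase _ _, Finset.insert_erase h1⟩
      rw [Finset.erase_insert hJa] at hJ'
      rw [rowVec_cons_in_in hJa hJa, ih hL'.2 _ hJ', Finset.prod_insert hJa,
        Finset.insert_sdiff_insert, Finset.sdiff_insert_of_notMem haL, ← mul_assoc]
      congr 1
      · congr 1
        · rw [lamFactor, Finset.filter_insert, if_neg (lt_irrefl a),
            Finset.filter_false_of_mem fun x hx => (ha x hx).not_gt]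
          simp [hSum]
        · refine Finset.prod_congr rfl fun i hi => ?_
          have hia := ha i (hJ' hi)
          rw [lamFactor, lamFactor, Finset.filter_insert, if_pos hia]
          unfold hSum
          rw [Finset.sum_insert (by simp [haL])]
          have : ∑ m ∈ L.toFinset.filter (i < ·), (if m ∈ insert a J' then (1 : ℤ) else -1) =
              ∑ m ∈ L.toFinset.filter (i < ·), (if m ∈ J' then (1 : ℤ) else -1) :=
            hSum_congr fun m hm => by
              simp [(ha m (Finset.mem_filter.1 hm).1).ne]
          rw [this]
          simp only [Finset.mem_insert_self, if_true]
          push_cast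
          ring_nf
      · refine Finset.prod_congr rfl fun b hb => ?_
        rw [Finset.filter_insert, if_neg (ha b (Finset.mem_sdiff.1 hb).1).not_gt]
    · rw [Finset.erase_eq_of_notMem h1] at hJ'
      rw [rowVec_cons_out_out h1 h1, ih hL'.2 _ hJ', Finset.insert_sdiff_of_notMem _ h1,
        Finset.prod_insert (by simp [haL]), Finset.filter_true_of_mem fun x hx => ha x (hJ' hx),
        mul_left_comm]
      congr 1
      refine Finset.prod_congr rfl fun i hi => ?_
      have hia := ha i (hJ' hi)
      rw [lamFactor, lamFactor, Finset.filter_insert, if_pos hia]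
      unfold hSum
      rw [Finset.sum_insert (by simp [haL])]
      simp only [h1, if_false]
      push_cast
      ring_nf

theorem colVec_self (L : List (Fin n)) (hL : L.Pairwise (· < ·)) (l : F)
    {J : Finset (Fin n)} (hJ : J ⊆ L.toFinset) :
    colVec z y L l J J = (∏ i ∈ J, lamFactor y L.toFinset J l i) *
      ∏ b ∈ L.toFinset \ J, (qProd z y (z b) (J.filter (b < ·)))⁻¹ := by
  induction L generalizing J with
  | nil =>
    obtain rfl : J = ∅ := by simpa using hJ
    simp [colVec]
  | cons a L ih =>
    have hL' := List.pairwise_cons.1 hL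
    have hnd : L.Nodup := hL'.2.imp ne_of_lt
    have ha : ∀ b ∈ L.toFinset, a < b := fun b hb => hL'.1 b (List.mem_toFinset.1 hb)
    have haL : a ∉ L.toFinset := fun h' => lt_irrefl _ (ha a h')
    rw [List.toFinset_cons] at hJ ⊢
    have hJ' := (Finset.subset_insert_iff).1 hJ
    have hfilter : ∀ i ∈ L.toFinset, (insert a L.toFinset).filter (i < ·) =
        L.toFinset.filter (i < ·) := fun i hi => by
      rw [Finset.filter_insert, if_neg (ha i hi).not_gt]
    by_cases h1 : a ∈ J
    · obtain ⟨J', hJa, rfl⟩ : ∃ J', a ∉ J' ∧ insert a J' = J :=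
        ⟨J.erase a, Finset.notMem_erase _ _, Finset.insert_erase h1⟩
      rw [Finset.erase_insert hJa] at hJ'
      rw [colVec_cons_in_in hJa hJa, ih hL'.2 hJ', Finset.prod_insert hJa,
        Finset.insert_sdiff_insert, Finset.sdiff_insert_of_notMem haL, ← mul_assoc]
      congr 1
      · congr 1
        · rw [lamFactor, Finset.filter_insert, if_neg (lt_irrefl a),
            Finset.filter_true_of_mem ha, hSum_insert_min ha, hSum_eq_of_card hnd hJ' rfl]
          ring
        · refine Finset.prod_congr rfl fun i hi => ?_
          rw [lamFactor, lamFactor, hfilter i (hJ' hi), hSum_congr fun m hm => ?_]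
          simp [(ha m (Finset.mem_filter.1 hm).1).ne']
      · refine Finset.prod_congr rfl fun b hb => ?_
        rw [Finset.filter_insert, if_neg (ha b (Finset.mem_sdiff.1 hb).1).not_gt]
    · rw [Finset.erase_eq_of_notMem h1] at hJ'
      rw [colVec_cons_out_out h1 h1, ih hL'.2 hJ', Finset.insert_sdiff_of_notMem _ h1,
        Finset.prod_insert (by simp [haL]), Finset.filter_true_of_mem fun x hx => ha x (hJ' hx),
        mul_left_comm]
      congr 1
      refine Finset.prod_congr rfl fun i hi => ?_
      rw [lamFactor, lamFactor, hfilter i (hJ' hi)]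

/-! ### Duality of row and column vectors over the full set of sites -/

variable (z y) in
/-- `rowVec` for all sites. -/
noncomputable def rowAll (l : F) (J I : Finset (Fin n)) : F :=
  rowVec z y (List.finRange n).reverse l J I

variable (z y) in
/-- `colVec` for all sites. -/
noncomputable def colAll (l : F) (K I : Finset (Fin n)) : F :=
  colVec z y (List.finRange n) l K I

theorem pairwise_finRange_reverse : (List.finRange n).reverse.Pairwise (· > ·) :=
  List.pairwise_reverse.2 (List.pairwise_lt_finRange n)

theorem toFinset_finRange_reverse : (List.finRange n).reverse.toFinset = Finset.univ := by
  ext; simp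

variable (z y) in
/-- `∏_{b ∉ J} ∏_{j ∈ J} (z_j - z_b) / (z_j - z_b + y)`. -/
noncomputable def pairNorm (J : Finset (Fin n)) : F := ∏ b ∈ Jᶜ, (qProd z y (z b) J)⁻¹

theorem pairNorm_ne_zero (hz : GenericSites z y) (J : Finset (Fin n)) : pairNorm z y J ≠ 0 :=
  Finset.prod_ne_zero_iff.2 fun _ hb =>
    inv_ne_zero (hz.qProd_ne_zero (Finset.mem_compl.1 hb))

variable {w l : F}

theorem rowAll_relations (hz : GenericSites z y) (hw : ∀ a, w - z a - y ≠ 0)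
    (hl : IsGeneric y l) (J I : Finset (Fin n)) :
    (∑ I', rowAll z y l J I' * transfer z y w Finset.univ l I' I 1 1 =
      dEig z y w J * rowAll z y (l + y) J I) ∧
    (∑ I', rowAll z y l J I' * transfer z y w Finset.univ l I' I 1 0 =
      ∑ m ∈ J, eEntry z y w l J m * rowAll z y (l - y) (J.erase m) I) := by
  have := rowRelations hz hw _ pairwise_finRange_reverse l hl J (by simp) I (by simp)
  rw [toFinset_finRange_reverse, Finset.powerset_univ] at this
  exact this

theorem colAll_relations (hz : GenericSites z y) (hw : ∀ a, w - z a - y ≠ 0)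
    (hl : IsGeneric y l) (K I : Finset (Fin n)) :
    (∑ I', transfer z y w Finset.univ l I I' 1 1 * colAll z y (l + y) K I' =
      dEig z y w K * colAll z y l K I) ∧
    (∑ I', transfer z y w Finset.univ l I I' 0 1 * colAll z y (l + y) K I' =
      ∑ m ∈ K, fEntry z y w n l K m * colAll z y l (K.erase m) I) := by
  have := colRelations hz hw _ (List.pairwise_lt_finRange n) l hl K (by simp) I (by simp)
  rw [List.toFinset_finRange, Finset.powerset_univ, List.length_finRange] at this
  exact this

theorem pairing_intertwine (f g : Finset (Fin n) → F)
    (T : Finset (Fin n) → Finset (Fin n) → F) :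
    ∑ I, (∑ I', f I' * T I' I) * g I = ∑ I', f I' * ∑ I, T I' I * g I := by
  simp_rw [Finset.sum_mul, Finset.mul_sum]
  rw [Finset.sum_comm]
  simp_rw [mul_assoc]

/-- Letting L_22 act to the left or to the right gives d_J(w) P(l + y) = d_K(w) P(l) for the pairing
P. Specializing w to a site in exactly one of J and K kills one of the two eigenvalues but not the
other. -/
theorem pairing_of_ne (hz : GenericSites z y) (hl : IsGeneric y l) {J K : Finset (Fin n)}
    (hJK : J ≠ K) : ∑ I, rowAll z y l J I * colAll z y l K I = 0 := by
  have key : ∀ l, IsGeneric y l → ∀ j : Fin n,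
      dEig z y (z j) J * ∑ I, rowAll z y (l + y) J I * colAll z y (l + y) K I =
        dEig z y (z j) K * ∑ I, rowAll z y l J I * colAll z y l K I := by
    intro l hl j
    have hw : ∀ a, z j - z a - y ≠ 0 := fun a e => hz.add_ne a j (by linear_combination -e)
    have := pairing_intertwine (rowAll z y l J) (colAll z y (l + y) K)
      (fun I' I => transfer z y (z j) Finset.univ l I' I 1 1)
    simp only [(rowAll_relations hz hw hl J _).1, (colAll_relations hz hw hl K _).1] at this
    rw [Finset.mul_sum, Finset.mul_sum]
    simpa only [mul_assoc, mul_left_comm] using this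
  have h0 : ∀ (j : Fin n) (M : Finset (Fin n)), j ∈ M → dEig z y (z j) M = 0 :=
    fun j M hj => Finset.prod_eq_zero hj (by simp)
  have h1 : ∀ (j : Fin n) (M : Finset (Fin n)), j ∉ M → dEig z y (z j) M ≠ 0 :=
    fun j M hj => Finset.prod_ne_zero_iff.2 fun i hi =>
      div_ne_zero (hz.sub_ne fun e => hj (e ▸ hi))
        fun e => hz.add_ne i j (by linear_combination -e)
  -- A site of `J` outside `K` gives P(l) = 0 directly. A site of `K` outside `J` gives vanishing at
  -- the shifted parameter, so the relation is started from `l - y`.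
  by_cases h : J ⊆ K
  · obtain ⟨j, hjK, hjJ⟩ : ∃ j ∈ K, j ∉ J := by
      by_contra! h'
      exact hJK (Finset.Subset.antisymm h h')
    have := key (l - y) hl.sub j
    rw [h0 j K hjK, zero_mul, sub_add_cancel] at this
    exact (mul_eq_zero.1 this).resolve_left (h1 j J hjJ)
  · obtain ⟨j, hjJ, hjK⟩ := Finset.not_subset.1 h
    have := key l hl j
    rw [h0 j J hjJ, zero_mul] at this
    exact (mul_eq_zero.1 this.symm).resolve_left (h1 j K hjK)

theorem lamFactor_ne_zero (hl : IsGeneric y l) (A J : Finset (Fin n)) (i : Fin n) :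
    lamFactor y A J l i ≠ 0 := by
  have := hl (-(hSum (A.filter (i < ·)) J + 1))
  push_cast at this
  rw [lamFactor]
  intro e
  apply this
  linear_combination e

/-- The two triangularities point in opposite directions, so only `I = J` contributes. The λ-factors
of the two diagonal entries are inverse to each other, and the products over `j < b` and `j > b`
combine into `pairNorm`. -/
theorem pairing_self (hl : IsGeneric y l) (J : Finset (Fin n)) :
    ∑ I, rowAll z y l J I * colAll z y l J I = pairNorm z y J := by
  rw [Finset.sum_eq_single J]
  · rw [rowAll, colAll, rowVec_self _ pairwise_finRange_reverse l (by simp),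
      colVec_self _ (List.pairwise_lt_finRange n) l (by simp), toFinset_finRange_reverse,
      List.toFinset_finRange, mul_mul_mul_comm, ← Finset.prod_mul_distrib,
      ← Finset.prod_mul_distrib, Finset.prod_eq_one, one_mul, ← Finset.compl_eq_univ_sdiff]
    · refine Finset.prod_congr rfl fun b hb => ?_
      rw [← mul_inv]
      congr 1
      have hb' := Finset.mem_compl.1 hb
      rw [qProd, qProd, qProd, ← Finset.prod_union]
      · congr 1
        ext j
        simp only [Finset.mem_union, Finset.mem_filter]
        constructor
        · rintro (h | h) <;> exact h.1
        · intro h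
          rcases lt_or_gt_of_ne (fun e => hb' (e ▸ h) : j ≠ b) with h' | h'
          · exact Or.inl ⟨h, h'⟩
          · exact Or.inr ⟨h, h'⟩
      · rw [Finset.disjoint_filter]
        intro x _ h1 h2
        exact lt_asymm h1 h2
    · intro i _
      exact inv_mul_cancel₀ (lamFactor_ne_zero hl _ _ _)
  · intro I _ hne
    by_contra h
    refine hne (bruhatWeight_injective (le_antisymm ?_ ?_))
    · exact bruhatWeight_le_of_colVec_ne_zero _ (List.pairwise_lt_finRange n) l (by simp)
        (by simp) (right_ne_zero_of_mul h)
    · exact bruhatWeight_le_of_rowVec_ne_zero _ pairwise_finRange_reverse l (by simp)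
        (by simp) (left_ne_zero_of_mul h)
  · simp

/-- The normalized rows form a left inverse of the square matrix of columns, hence also a right
inverse, so pairings with the columns determine a vector. -/
theorem eq_of_pairing_eq (hz : GenericSites z y) (hl : IsGeneric y l) (f g : Finset (Fin n) → F)
    (h : ∀ K, ∑ I, f I * colAll z y l K I = ∑ I, g I * colAll z y l K I) : f = g := by
  let R : Matrix (Finset (Fin n)) (Finset (Fin n)) F :=
    Matrix.of fun J I => (pairNorm z y J)⁻¹ * rowAll z y l J I
  let C : Matrix (Finset (Fin n)) (Finset (Fin n)) F := Matrix.of fun I K => colAll z y l K I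
  have hRC : R * C = 1 := by
    ext J K
    simp only [R, C, Matrix.mul_apply, Matrix.of_apply, mul_assoc, ← Finset.mul_sum]
    by_cases hJK : J = K
    · subst hJK
      rw [pairing_self hl, inv_mul_cancel₀ (pairNorm_ne_zero hz J), Matrix.one_apply_eq]
    · rw [pairing_of_ne hz hl hJK, mul_zero, Matrix.one_apply_ne hJK]
  have hCR : C * R = 1 := mul_eq_one_comm.1 hRC
  have h' : Matrix.vecMul f C = Matrix.vecMul g C := funext fun K => h K
  have := congrArg (fun v => Matrix.vecMul v R) h'
  simpa [Matrix.vecMul_vecMul, hCR] using this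

/-- The action of `L_{12}` on row vectors. -/
theorem rowAll_relation_up (hz : GenericSites z y) (hw : ∀ a, w - z a - y ≠ 0)
    (hl : IsGeneric y l) (J I : Finset (Fin n)) :
    ∑ I', rowAll z y l J I' * transfer z y w Finset.univ l I' I 0 1 =
      ∑ i ∈ Jᶜ, (fEntry z y w n l (insert i J) i * pairNorm z y J *
        (pairNorm z y (insert i J))⁻¹) * rowAll z y (l + y) (insert i J) I := by
  refine congrFun (eq_of_pairing_eq hz hl.add
    (fun I => ∑ I', rowAll z y l J I' * transfer z y w Finset.univ l I' I 0 1)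
    (fun I => ∑ i ∈ Jᶜ, (fEntry z y w n l (insert i J) i * pairNorm z y J *
        (pairNorm z y (insert i J))⁻¹) * rowAll z y (l + y) (insert i J) I) ?_) I
  intro K
  -- Tested against column vectors at `l + y`, L_12 moves to the column side, where its action is
  -- known.
  have h1 := pairing_intertwine (rowAll z y l J) (colAll z y (l + y) K)
      (fun I' I => transfer z y w Finset.univ l I' I 0 1)
  simp only [(colAll_relations hz hw hl K _).2] at h1
  rw [h1]
  simp_rw [Finset.mul_sum, Finset.sum_mul]
  rw [Finset.sum_comm, Finset.sum_comm (t := Jᶜ)]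
  have e1 : ∀ m ∈ K, ∑ I', rowAll z y l J I' *
      (fEntry z y w n l K m * colAll z y l (K.erase m) I') =
      if K.erase m = J then fEntry z y w n l K m * pairNorm z y J else 0 := by
    intro m _
    simp_rw [mul_left_comm, ← Finset.mul_sum]
    split_ifs with h
    · rw [h, pairing_self hl]
    · rw [pairing_of_ne hz hl (Ne.symm h), mul_zero]
  have e2 : ∀ i ∈ Jᶜ, ∑ I', (fEntry z y w n l (insert i J) i * pairNorm z y J *
        (pairNorm z y (insert i J))⁻¹) * rowAll z y (l + y) (insert i J) I' *
          colAll z y (l + y) K I' =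
      if insert i J = K then fEntry z y w n l K i * pairNorm z y J else 0 := by
    intro i _
    simp_rw [mul_assoc, ← Finset.mul_sum]
    split_ifs with h
    · rw [h, pairing_self hl.add, inv_mul_cancel₀ (pairNorm_ne_zero hz K), mul_one]
    · rw [pairing_of_ne hz hl.add h]
      simp
  rw [Finset.sum_congr rfl e1, Finset.sum_congr rfl e2, ← Finset.sum_filter,
    ← Finset.sum_filter]
  -- The conditions K ∖ m = J with m ∈ K, and J ∪ m = K with m ∉ J, select the same indices.
  refine Finset.sum_congr ?_ fun _ _ => rfl
  ext m
  simp only [Finset.mem_filter, Finset.mem_compl]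
  constructor
  · rintro ⟨h, rfl⟩
    exact ⟨Finset.notMem_erase _ _, Finset.insert_erase h⟩
  · rintro ⟨h, rfl⟩
    exact ⟨Finset.mem_insert_self _ _, Finset.erase_insert h⟩

end Pairing

/-! ### Weight functions and row vectors -/

section Weight

variable {n : ℕ} {F : Type} [Field F] (z : Fin n → F) (y : F)

/-- The factor `l_I(r,a)` of the weight function of the sites in `A`. -/
def siteFactor (A I : Finset (Fin n)) (l : F) (i : Fin n) (t : F) (a : Fin n) : F :=
  if a < i then t - z a + y
  else if a = i then l + t - z a - (hSum (A.filter (i < ·)) I : F) * y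
  else t - z a

/-- The product `∏_{a<b} (t_a - t_b + y) / (t_a - t_b)` at `t_r = z_{g r}`. -/
noncomputable def pairProd {k : ℕ} (g : Fin k → Fin n) : F :=
  ∏ a, ∏ b, if a < b then (z (g a) - z (g b) + y) / (z (g a) - z (g b)) else 1

/-- The summand of the weight function of the sites in `A`. -/
noncomputable def weightTerm (A I : Finset (Fin n)) (l : F) {k : ℕ} (i g : Fin k → Fin n) : F :=
  (∏ r, ∏ a ∈ A, siteFactor z y A I l (i r) (z (g r)) a) * pairProd z y g

/-- The enumerations of `J` by `Fin k`. -/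
def enumerations (k : ℕ) (J : Finset (Fin n)) : Finset (Fin k → Fin n) :=
  Finset.univ.filter fun g => Function.Injective g ∧ Finset.univ.image g = J

/-- The weight function of the sites in `A`, without the power of `y`. -/
noncomputable def weightSum (A I : Finset (Fin n)) (l : F) {k : ℕ} (i : Fin k → Fin n)
    (J : Finset (Fin n)) : F :=
  ∑ g ∈ enumerations k J, weightTerm z y A I l i g

/-- `∏_{i ∈ I} (l - w(i,I) y) (l - (w(i,I) + 1) y)`. -/
def lamProd (A I : Finset (Fin n)) (l : F) : F :=
  ∏ i ∈ I, (l - (hSum (A.filter (i < ·)) I : F) * y) * lamFactor y A I l i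

/-- `∏_{j ∈ J} ∏_{b ∈ A} (z_j - z_b + y)`. -/
def addProd (A J : Finset (Fin n)) : F := ∏ j ∈ J, ∏ b ∈ A, (z j - z b + y)

variable {z y}

theorem prod_enumeration {k : ℕ} {J : Finset (Fin n)} {g : Fin k → Fin n}
    (hg : g ∈ enumerations k J) (f : Fin n → F) : ∏ r, f (g r) = ∏ j ∈ J, f j := by
  obtain ⟨h1, h2⟩ := (Finset.mem_filter.1 hg).2
  rw [← h2, Finset.prod_image fun a _ b _ h => h1 h]

theorem sum_enumerations_succ (k : ℕ) (J : Finset (Fin n)) (f : (Fin (k + 1) → Fin n) → F) :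
    ∑ g ∈ enumerations (k + 1) J, f g =
      ∑ m ∈ J, ∑ g ∈ enumerations k (J.erase m), f (Fin.snoc (α := fun _ => Fin n) g m) := by
  rw [Finset.sum_sigma']
  refine (Finset.sum_bij' (fun x _ => Fin.snoc (α := fun _ => Fin n) x.2 x.1)
    (fun g _ => ⟨g (Fin.last k), Fin.init g⟩) ?_ ?_ ?_ ?_ ?_).symm
  · rintro ⟨m, g⟩ hx
    obtain ⟨hm, hg⟩ := Finset.mem_sigma.1 hx
    obtain ⟨h1, h2⟩ := (Finset.mem_filter.1 hg).2
    refine Finset.mem_filter.2 ⟨Finset.mem_univ _, ?_, ?_⟩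
    · rw [Fin.snoc_injective_iff]
      refine ⟨h1, ?_⟩
      rintro ⟨r, hr⟩
      have : g r ∈ J.erase m := h2 ▸ Finset.mem_image_of_mem g (Finset.mem_univ r)
      exact (Finset.mem_erase.1 this).1 hr
    · ext x
      simp only [Finset.mem_image, Finset.mem_univ, true_and, Fin.exists_fin_succ', Fin.snoc_last,
        Fin.snoc_castSucc]
      have := Finset.ext_iff.1 h2 x
      simp only [Finset.mem_image, Finset.mem_univ, true_and, Finset.mem_erase] at this
      rw [this]
      constructor
      · rintro (h | rfl)
        · exact h.2
        · exact hm
      · intro h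
        by_cases hxm : m = x
        · exact Or.inr hxm
        · exact Or.inl ⟨Ne.symm hxm, h⟩
  · intro g hg
    obtain ⟨h1, h2⟩ := (Finset.mem_filter.1 hg).2
    refine Finset.mem_sigma.2 ⟨?_, Finset.mem_filter.2 ⟨Finset.mem_univ _, ?_, ?_⟩⟩
    · exact h2 ▸ Finset.mem_image_of_mem g (Finset.mem_univ _)
    · exact h1.comp (Fin.castSucc_injective k)
    · ext x
      rw [← h2]
      simp only [Finset.mem_image, Finset.mem_univ, true_and, Fin.exists_fin_succ',
        Finset.mem_erase, Fin.init]
      constructor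
      · rintro ⟨r, rfl⟩
        exact ⟨fun e => (Fin.castSucc_lt_last r).ne (h1 e), Or.inl ⟨r, rfl⟩⟩
      · rintro ⟨hne, ⟨r, hr⟩ | hr⟩
        · exact ⟨r, hr⟩
        · exact absurd hr.symm hne
  · rintro ⟨m, g⟩ _
    simp
  · intro g _
    simp
  · rintro ⟨m, g⟩ _
    rfl

theorem pairProd_snoc {k : ℕ} (g : Fin k → Fin n) (m : Fin n) :
    pairProd z y (Fin.snoc (α := fun _ => Fin n) g m : Fin (k + 1) → Fin n) =
      pairProd z y g * ∏ r, (z (g r) - z m + y) / (z (g r) - z m) := by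
  simp only [pairProd, Fin.prod_univ_castSucc, Fin.snoc_castSucc, Fin.snoc_last,
    Fin.castSucc_lt_castSucc_iff, Fin.castSucc_lt_last, if_true, lt_irrefl, if_false, mul_one]
  rw [Finset.prod_mul_distrib]
  convert mul_one _
  exact Finset.prod_eq_one fun b _ => if_neg (Fin.castSucc_lt_last b).not_gt

theorem siteFactor_insert {A I I' : Finset (Fin n)} {a : Fin n} (ha : ∀ b ∈ A, b < a)
    (hI : ∀ m ≠ a, m ∈ I ↔ m ∈ I') (l : F) {i : Fin n} (hi : i ∈ A) (t : F) (b : Fin n) :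
    siteFactor z y (insert a A) I l i t b =
      siteFactor z y A I' (l - (if a ∈ I then 1 else -1) * y) i t b := by
  have haA : a ∉ A := fun h' => lt_irrefl _ (ha a h')
  unfold siteFactor
  rw [Finset.filter_insert, if_pos (ha i hi), hSum, Finset.sum_insert (by simp [haA]), ← hSum,
    hSum_congr fun m hm => hI m (ha m (Finset.mem_filter.1 hm).1).ne]
  split_ifs <;> push_cast <;> ring

theorem prod_siteFactor_insert {A I I' : Finset (Fin n)} {a : Fin n} (ha : ∀ b ∈ A, b < a)
    (hI : ∀ m ≠ a, m ∈ I ↔ m ∈ I') (l : F) {i : Fin n} (hi : i ∈ A) (t : F) :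
    ∏ b ∈ insert a A, siteFactor z y (insert a A) I l i t b =
      (∏ b ∈ A, siteFactor z y A I' (l - (if a ∈ I then 1 else -1) * y) i t b) * (t - z a) := by
  have haA : a ∉ A := fun h' => lt_irrefl _ (ha a h')
  rw [Finset.prod_insert haA, mul_comm,
    Finset.prod_congr rfl fun b _ => siteFactor_insert ha hI l hi t b]
  congr 1
  rw [siteFactor, if_neg (ha i hi).not_gt, if_neg (ha i hi).ne']

theorem prod_siteFactor_max {A I : Finset (Fin n)} {a : Fin n} (ha : ∀ b ∈ A, b < a)
    (l : F) (t : F) :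
    ∏ b ∈ insert a A, siteFactor z y (insert a A) I l a t b =
      (l + t - z a) * ∏ b ∈ A, (t - z b + y) := by
  have haA : a ∉ A := fun h' => lt_irrefl _ (ha a h')
  rw [Finset.prod_insert haA]
  congr 1
  · rw [siteFactor, if_neg (lt_irrefl a), if_pos rfl, Finset.filter_insert,
      if_neg (lt_irrefl a), Finset.filter_false_of_mem fun x hx => (ha x hx).not_gt]
    simp [hSum]
  · exact Finset.prod_congr rfl fun b hb => by rw [siteFactor, if_pos (ha b hb)]

theorem lamProd_insert_notMem {A I : Finset (Fin n)} {a : Fin n} (ha : ∀ b ∈ A, b < a)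
    (hI : I ⊆ A) (l : F) : lamProd y (insert a A) I l = lamProd y A I (l + y) := by
  have haA : a ∉ A := fun h' => lt_irrefl _ (ha a h')
  refine Finset.prod_congr rfl fun i hi => ?_
  rw [lamFactor, lamFactor, Finset.filter_insert, if_pos (ha i (hI hi)), hSum,
    Finset.sum_insert (by simp [haA]), ← hSum, if_neg fun h => haA (hI h)]
  push_cast
  ring

theorem lamProd_insert_mem {A I : Finset (Fin n)} {a : Fin n} (ha : ∀ b ∈ A, b < a)
    (hI : I ⊆ A) (l : F) :
    lamProd y (insert a A) (insert a I) l = l * (l - y) * lamProd y A I (l - y) := by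
  have haA : a ∉ A := fun h' => lt_irrefl _ (ha a h')
  rw [lamProd, Finset.prod_insert fun h => haA (hI h)]
  congr 1
  · rw [lamFactor, Finset.filter_insert, if_neg (lt_irrefl a),
      Finset.filter_false_of_mem fun x hx => (ha x hx).not_gt]
    simp [hSum]
  · refine Finset.prod_congr rfl fun i hi => ?_
    rw [lamFactor, lamFactor, Finset.filter_insert, if_pos (ha i (hI hi)), hSum,
      Finset.sum_insert (by simp [haA]), ← hSum, if_pos (Finset.mem_insert_self a I),
      hSum_congr (I' := I) fun m hm => by simp [(ha m (Finset.mem_filter.1 hm).1).ne]]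
    push_cast
    ring

theorem addProd_insert_left {A J : Finset (Fin n)} {a : Fin n} (ha : a ∉ A) :
    addProd z y (insert a A) J = (∏ j ∈ J, (z j - z a + y)) * addProd z y A J := by
  rw [addProd, addProd, ← Finset.prod_mul_distrib]
  exact Finset.prod_congr rfl fun j _ => Finset.prod_insert ha

theorem qProd_mul_prod (hz : GenericSites z y) {J : Finset (Fin n)} {a : Fin n} (ha : a ∉ J) :
    qProd z y (z a) J * ∏ j ∈ J, (z j - z a) = ∏ j ∈ J, (z j - z a + y) := by
  rw [qProd, ← Finset.prod_mul_distrib]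
  exact Finset.prod_congr rfl fun j hj =>
    div_mul_cancel₀ _ (hz.sub_ne fun e => ha (e ▸ hj))

/-- A site above all of `I` contributes the factor `t_r - z_a` for every variable, so its total
contribution does not depend on the enumeration; it vanishes as soon as `a ∈ J`. -/
theorem weightSum_of_notMem {A I : Finset (Fin n)} {a : Fin n} (ha : ∀ b ∈ A, b < a) (l : F)
    {k : ℕ} {i : Fin k → Fin n} (hi : ∀ r, i r ∈ A) (haI : a ∉ I) (J : Finset (Fin n)) :
    weightSum z y (insert a A) I l i J =
      (∏ j ∈ J, (z j - z a)) * weightSum z y A I (l + y) i J := by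
  rw [weightSum, weightSum, Finset.mul_sum]
  refine Finset.sum_congr rfl fun g hg => ?_
  rw [weightTerm, weightTerm, Finset.prod_congr rfl fun r _ =>
    prod_siteFactor_insert ha (fun _ _ => Iff.rfl) l (hi r) _, Finset.prod_mul_distrib,
    prod_enumeration hg (fun j => z j - z a), if_neg haI]
  rw [neg_one_mul, sub_neg_eq_add]
  ring

/-- The largest site is the last element of the index set, and the sum is split by the value `z_m`
of the last variable. That variable supplies the λ-dependent factor and the product over `A`; its
pair factors with the others form `qProd`. -/
theorem weightSum_of_mem {A I : Finset (Fin n)} {a : Fin n} (ha : ∀ b ∈ A, b < a) (l : F)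
    {k : ℕ} {i : Fin k → Fin n} (hi : ∀ r, i r ∈ A) (J : Finset (Fin n)) :
    weightSum z y (insert a A) (insert a I) l (Fin.snoc (α := fun _ => Fin n) i a) J =
      ∑ m ∈ J, (∏ j ∈ J.erase m, (z j - z a)) * qProd z y (z m) (J.erase m) *
        (l + z m - z a) * (∏ b ∈ A, (z m - z b + y)) *
        weightSum z y A I (l - y) i (J.erase m) := by
  rw [weightSum, sum_enumerations_succ]
  refine Finset.sum_congr rfl fun m _ => ?_
  rw [weightSum, Finset.mul_sum]
  refine Finset.sum_congr rfl fun g hg => ?_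
  rw [weightTerm, weightTerm, pairProd_snoc, Fin.prod_univ_castSucc]
  simp only [Fin.snoc_castSucc, Fin.snoc_last]
  rw [prod_siteFactor_max ha, Finset.prod_congr rfl fun r _ =>
    prod_siteFactor_insert (I' := I) ha (fun m hm => by simp [hm]) l (hi r) _,
    Finset.prod_mul_distrib,
    prod_enumeration hg (fun j => z j - z a),
    prod_enumeration hg (fun j => (z j - z m + y) / (z j - z m)), ← qProd,
    if_pos (Finset.mem_insert_self a I), one_mul]
  ring

/-- Both sides obey the same recursion in the largest site. The factor `lamProd` clears the
λ-denominators, and `addProd` contains, besides e_k, the product over `J` and its complement that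
later becomes `compNorm`. -/
theorem weightSum_eq_rowVec (hz : GenericSites z y) (L : List (Fin n))
    (hL : L.Pairwise (· > ·)) {l : F} (hl : IsGeneric y l) {k : ℕ} {i : Fin k → Fin n}
    (hi : StrictMono i) {I J : Finset (Fin n)} (hiI : Finset.univ.image i = I)
    (hI : I ⊆ L.toFinset) (hJ : J ⊆ L.toFinset) (hc : J.card = k) :
    y ^ k * weightSum z y L.toFinset I l i J =
      rowVec z y L l J I * lamProd y L.toFinset I l * addProd z y L.toFinset J := by
  induction L generalizing k i I J l with
  | nil =>
    obtain rfl : J = ∅ := by simpa using hJ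
    obtain rfl : I = ∅ := by simpa using hI
    obtain rfl : k = 0 := by simpa using hc.symm
    have : enumerations 0 (∅ : Finset (Fin n)) = Finset.univ :=
      Finset.filter_true_of_mem fun g _ => ⟨fun r => r.elim0, rfl⟩
    rw [weightSum, this, Fintype.sum_unique]
    simp [rowVec, lamProd, addProd, weightTerm, pairProd]
  | cons a L ih =>
    have hL' := List.pairwise_cons.1 hL
    have ha : ∀ b ∈ L.toFinset, b < a := fun b hb => hL'.1 b (List.mem_toFinset.1 hb)
    have haL : a ∉ L.toFinset := fun h' => lt_irrefl _ (ha a h')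
    rw [List.toFinset_cons] at hI hJ ⊢
    have hJ' := (Finset.subset_insert_iff).1 hJ
    have hI' := (Finset.subset_insert_iff).1 hI
    by_cases h2 : a ∈ I
    · obtain ⟨r₀, hr₀⟩ : ∃ r, i r = a := by
        rw [← hiI] at h2
        simpa using h2
      obtain ⟨k, rfl⟩ : ∃ k', k = k' + 1 := ⟨k - 1, by have := r₀.2; omega⟩
      have hle : ∀ r, i r ≤ a := fun r => by
        have : i r ∈ insert a L.toFinset := hI (hiI ▸ Finset.mem_image_of_mem i (Finset.mem_univ r))
        rcases Finset.mem_insert.1 this with h | h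
        · exact h.le
        · exact (ha _ h).le
      have hlast : i (Fin.last k) = a :=
        le_antisymm (hle _) (hr₀ ▸ hi.monotone (Fin.le_last r₀))
      have hlt : ∀ r : Fin k, i r.castSucc < a := fun r => hlast ▸ hi (Fin.castSucc_lt_last r)
      obtain ⟨i', rfl⟩ : ∃ i' : Fin k → Fin n, i = Fin.snoc (α := fun _ => Fin n) i' a :=
        ⟨Fin.init i, by rw [← hlast]; exact (Fin.snoc_init_self i).symm⟩
      simp only [Fin.snoc_castSucc] at hlt
      have hi' : StrictMono i' := fun r s hrs => by
        simpa using hi (Fin.castSucc_lt_castSucc_iff.2 hrs)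
      have hiI' : Finset.univ.image i' = I.erase a := by
        ext x
        rw [← hiI]
        simp only [Finset.mem_image, Finset.mem_univ, true_and, Fin.exists_fin_succ',
          Finset.mem_erase, Fin.snoc_castSucc, Fin.snoc_last]
        constructor
        · rintro ⟨r, rfl⟩
          exact ⟨(hlt r).ne, Or.inl ⟨r, rfl⟩⟩
        · rintro ⟨hne, ⟨r, hr⟩ | hr⟩
          · exact ⟨r, hr⟩
          · exact absurd hr.symm hne
      have hmem : ∀ r, i' r ∈ L.toFinset := fun r =>
        hI' (hiI' ▸ Finset.mem_image_of_mem i' (Finset.mem_univ r))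
      obtain ⟨I', hIa, rfl⟩ : ∃ I', a ∉ I' ∧ insert a I' = I :=
        ⟨I.erase a, Finset.notMem_erase _ _, Finset.insert_erase h2⟩
      rw [Finset.erase_insert hIa] at hI' hiI'
      rw [weightSum_of_mem ha l hmem, lamProd_insert_mem ha hI']
      have n0 := hl.ne_zero
      have n1 := hl.sub.ne_zero
      by_cases h1 : a ∈ J
      · obtain ⟨J', hJa, rfl⟩ : ∃ J', a ∉ J' ∧ insert a J' = J :=
          ⟨J.erase a, Finset.notMem_erase _ _, Finset.insert_erase h1⟩
        rw [Finset.erase_insert hJa] at hJ'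
        rw [Finset.card_insert_of_notMem hJa, Nat.add_right_cancel_iff] at hc
        have h := ih hL'.2 hl.sub hi' hiI' hI' hJ' hc
        -- Only `m = a` survives: for any other `m` the product over the remaining sites contains
        -- `z_a - z_a`.
        rw [Finset.sum_insert hJa, Finset.sum_eq_zero fun m hm => ?_, Finset.erase_insert hJa,
          rowVec_cons_in_in hJa hIa, add_zero, addProd_insert_left haL,
          Finset.prod_insert hJa, ← qProd_mul_prod hz hJa]
        · rw [addProd, Finset.prod_insert hJa, ← addProd]
          field_simp
          linear_combination (l * y * (∏ j ∈ J', (z j - z a)) * qProd z y (z a) J' *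
            (∏ b ∈ L.toFinset, (z a - z b + y))) * h
        · rw [Finset.prod_eq_zero (i := a)]
          · ring
          · exact Finset.mem_erase.2 ⟨fun e => hJa (e ▸ hm), Finset.mem_insert_self _ _⟩
          · exact sub_self _
      · rw [Finset.erase_eq_of_notMem h1] at hJ'
        rw [rowVec_cons_out_in h1 hIa, Finset.sum_mul, Finset.sum_mul, Finset.mul_sum]
        refine Finset.sum_congr rfl fun m hm => ?_
        have haJ' : a ∉ J.erase m := fun h' => h1 (Finset.mem_of_mem_erase h')
        have hcm : (J.erase m).card = k := by rw [Finset.card_erase_of_mem hm, hc]; rfl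
        have h := ih hL'.2 hl.sub hi' hiI' hI' ((Finset.erase_subset _ _).trans hJ') hcm
        have e1 : addProd z y L.toFinset J =
            (∏ b ∈ L.toFinset, (z m - z b + y)) * addProd z y L.toFinset (J.erase m) :=
          (Finset.mul_prod_erase J _ hm).symm
        rw [addProd_insert_left haL, ← Finset.mul_prod_erase J _ hm, ← qProd_mul_prod hz haJ', e1,
          rowEntry]
        have q1 := hz.qProd_ne_zero haJ'
        have h3 := hz.add_ne m a
        field_simp
        linear_combination (y * (∏ j ∈ J.erase m, (z j - z a)) * qProd z y (z m) (J.erase m) *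
            (l + z m - z a) * (∏ b ∈ L.toFinset, (z m - z b + y))) * h
    · rw [Finset.erase_eq_of_notMem h2] at hI'
      have hmem : ∀ r, i r ∈ L.toFinset := fun r =>
        hI' (hiI ▸ Finset.mem_image_of_mem i (Finset.mem_univ r))
      rw [weightSum_of_notMem ha l hmem h2, lamProd_insert_notMem ha hI']
      by_cases h1 : a ∈ J
      · rw [← Finset.insert_erase h1, rowVec_cons_in_out h2, Finset.prod_insert
          (Finset.notMem_erase _ _)]
        simp
      · rw [Finset.erase_eq_of_notMem h1] at hJ'
        have h := ih hL'.2 hl.add hi hiI hI' hJ' hc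
        rw [rowVec_cons_out_out h1 h2, addProd_insert_left haL, ← qProd_mul_prod hz h1]
        have q1 := hz.qProd_ne_zero h1
        field_simp
        linear_combination (∏ j ∈ J, (z j - z a)) * h

end Weight

/-! ### Specializations of the coefficient ring -/

section Specialization

variable {n : ℕ}

theorem zBase_injective : Function.Injective (zBase (n := n)) := fun _ _ h =>
  Option.some_injective _ (MvPolynomial.X_injective h)

theorem zBase_add_ne_zero (a b : Fin n) : zBase a - zBase b + yBase n ≠ 0 := by
  intro h
  have := congrArg (MvPolynomial.eval (fun o : Option (Fin n) => o.elim (1 : ℂ) fun _ => 0)) h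
  erw [map_add, map_sub, map_zero, MvPolynomial.eval_X, MvPolynomial.eval_X,
    MvPolynomial.eval_X] at this
  simp at this

theorem isUnit_zz_sub {a b : Fin n} (h : a ≠ b) : IsUnit (zz a - zz b) := by
  rw [zz, zz, ← map_sub]
  exact isUnit_base n _ (sub_ne_zero.2 fun e => h (zBase_injective e))

theorem isUnit_zz_add (a b : Fin n) : IsUnit (zz a - zz b + yy n) := by
  rw [zz, zz, yy, ← map_sub, ← map_add]
  exact isUnit_base n _ (zBase_add_ne_zero a b)

theorem isUnit_lam_sub (l : ℤ) : IsUnit (lam n - (l : CoeffRing n) * yy n) := by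
  have := isUnit_lam_add n (-l)
  push_cast at this
  rwa [neg_mul, ← sub_eq_add_neg] at this

variable {F : Type} [Field F] (θ : CoeffRing n →+* F)

theorem map_inverse_of_isUnit {A : Type*} [CommRing A] {F : Type*} [Field F] (θ : A →+* F) {u : A}
    (h : IsUnit u) : θ (Ring.inverse u) = (θ u)⁻¹ := by
  obtain ⟨u, rfl⟩ := h
  rw [Ring.inverse_unit, map_units_inv]

/-- Genericity holds along every homomorphism from 𝓛 to a field, because the relevant elements are
units. The freedom in `θ` is used for the fraction field, for Laurent series over it, and for these
preceded by a shift of λ. -/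
theorem isGeneric_map : IsGeneric (θ (yy n)) (θ (lam n)) := by
  intro m
  have := ((isUnit_lam_add n m).map θ).ne_zero
  simpa using this

theorem genericSites_map : GenericSites (fun i => θ (zz i)) (θ (yy n)) where
  inj a b h := by
    by_contra hab
    have := ((isUnit_zz_sub hab).map θ).ne_zero
    rw [map_sub] at this
    exact this (sub_eq_zero.2 h)
  add_ne a b := by
    have := ((isUnit_zz_add a b).map θ).ne_zero
    simpa using this

theorem wNum_eq_hSum (i : Fin n) (I : Finset (Fin n)) :
    wNum i I = hSum (Finset.univ.filter (i < ·)) I := by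
  rw [wNum, hSum, Finset.sum_ite, Finset.filter_filter, Finset.filter_filter]
  simp
  ring

theorem hAfter_eq_hSum (I : Finset (Fin n)) (j : Fin n) :
    hAfter I j = hSum (Finset.univ.filter (j < ·)) I := by
  rw [hAfter, hSum]
  congr 1
  ext
  simp

theorem map_lFactor (I : Finset (Fin n)) (i : Fin n) (t : CoeffRing n) (a : Fin n) :
    θ (lFactor I i t a) =
      siteFactor (fun i => θ (zz i)) (θ (yy n)) Finset.univ I (θ (lam n)) i (θ t) a := by
  unfold lFactor siteFactor
  rw [wNum_eq_hSum]
  split_ifs <;> simp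

theorem sum_perm_eq_sum_enumerations {M : Type*} [AddCommMonoid M] {k : ℕ} {J : Finset (Fin n)}
    (h : J.card = k) (f : (Fin k → Fin n) → M) :
    ∑ σ : Equiv.Perm (Fin k), f (fun r => J.orderEmbOfFin h (σ r)) =
      ∑ g ∈ enumerations k J, f g := by
  refine Finset.sum_bij (fun σ _ r => J.orderEmbOfFin h (σ r)) ?_ ?_ ?_ ?_
  · intro σ _
    refine Finset.mem_filter.2 ⟨Finset.mem_univ _,
      (J.orderEmbOfFin h).injective.comp σ.injective, ?_⟩
    ext x
    have := Finset.ext_iff.1 (Finset.image_orderEmbOfFin_univ J h) x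
    rw [← this]
    simp only [Finset.mem_image, Finset.mem_univ, true_and]
    exact (σ.surjective.exists (p := fun a => J.orderEmbOfFin h a = x)).symm
  · intro σ _ τ _ e
    ext r
    exact congrArg _ ((J.orderEmbOfFin h).injective (congrFun e r))
  · intro g hg
    obtain ⟨h1, h2⟩ := (Finset.mem_filter.1 hg).2
    have hr : ∀ r, ∃ s, J.orderEmbOfFin h s = g r := fun r => by
      have : g r ∈ J := h2 ▸ Finset.mem_image_of_mem g (Finset.mem_univ r)
      rw [← Finset.image_orderEmbOfFin_univ J h] at this
      obtain ⟨s, _, hs⟩ := Finset.mem_image.1 this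
      exact ⟨s, hs⟩
    choose s hs using hr
    have hinj : Function.Injective s := fun a b e => h1 (by rw [← hs, ← hs, e])
    exact ⟨Equiv.ofBijective s (Finite.injective_iff_bijective.1 hinj), Finset.mem_univ _,
      funext hs⟩
  · intro _ _
    rfl

theorem map_weightFn (I J : Finset (Fin n)) (h : J.card = I.card) :
    θ (weightFn I (fun r => zz (J.orderEmbOfFin h r))) =
      θ (yy n) ^ I.card * weightSum (fun i => θ (zz i)) (θ (yy n)) Finset.univ I (θ (lam n))
        (I.orderEmbOfFin rfl) J := by
  rw [weightFn, map_mul, map_pow, map_sum, weightSum, ← sum_perm_eq_sum_enumerations h]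
  congr 1
  refine Finset.sum_congr rfl fun σ _ => ?_
  rw [weightTerm, map_mul, map_prod, map_prod]
  congr 1
  · refine Finset.prod_congr rfl fun r _ => ?_
    rw [map_prod]
    exact Finset.prod_congr rfl fun a _ => map_lFactor θ I _ _ a
  · refine Finset.prod_congr rfl fun a _ => ?_
    rw [map_prod, ← Finset.prod_filter]
    have : Finset.Ioi a = Finset.univ.filter (a < ·) := by ext; simp
    rw [this]
    refine Finset.prod_congr rfl fun b hb => ?_
    have hab := (Finset.mem_filter.1 hb).2
    rw [map_mul, map_inverse_of_isUnit θ (isUnit_zz_sub ?_)]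
    · simp [div_eq_mul_inv]
    · intro e
      exact hab.ne (σ.injective ((J.orderEmbOfFin h).injective e))

theorem isUnit_cFactor (r : ℤ) (I : Finset (Fin n)) : IsUnit (cFactor r I) := by
  unfold cFactor
  exact IsUnit.prod_iff.2 fun i _ => isUnit_lam_sub _

theorem isUnit_eFactor {k : ℕ} (g : Fin k → Fin n) : IsUnit (eFactor fun r => zz (g r)) := by
  unfold eFactor
  exact IsUnit.prod_iff.2 fun a _ => IsUnit.prod_iff.2 fun b _ => isUnit_zz_add _ _

/-- `∏_{j ∈ J, b ∉ J} (z_j - z_b + y)`. -/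
def compNorm {R : Type} [CommRing R] (z : Fin n → R) (y : R) (J : Finset (Fin n)) : R :=
  ∏ j ∈ J, ∏ b ∈ Jᶜ, (z j - z b + y)

theorem prod_orderEmbOfFin {M : Type*} [CommMonoid M] {k : ℕ} {J : Finset (Fin n)}
    (h : J.card = k) (f : Fin n → M) : ∏ r, f (J.orderEmbOfFin h r) = ∏ j ∈ J, f j := by
  conv_rhs => rw [← Finset.image_orderEmbOfFin_univ J h]
  rw [Finset.prod_image fun a _ b _ e => (J.orderEmbOfFin h).injective e]

/-- Dividing by C^{(0)} C^{(1)} removes `lamProd`, and dividing by e_k removes the factors of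
`addProd` with both sites in `J`. What is left beside the row vector is `compNorm`. -/
theorem map_weightPlus (I J : Finset (Fin n)) (h : J.card = I.card) :
    θ (weightPlus I (fun r => zz (J.orderEmbOfFin h r))) =
      rowAll (fun i => θ (zz i)) (θ (yy n)) (θ (lam n)) J I *
        compNorm (fun i => θ (zz i)) (θ (yy n)) J := by
  have key := weightSum_eq_rowVec (genericSites_map θ) _ pairwise_finRange_reverse
    (isGeneric_map θ) (I.orderEmbOfFin rfl).strictMono (Finset.image_orderEmbOfFin_univ I rfl)
    (by simp) (J := J) (by simp) h
  have hu := ((isUnit_cFactor 0 I).mul (isUnit_cFactor 1 I)).mul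
    (isUnit_eFactor (J.orderEmbOfFin h))
  have hne := (hu.map θ).ne_zero
  rw [weightPlus, map_mul, map_inverse_of_isUnit θ hu, map_weightFn, ← div_eq_mul_inv,
    div_eq_iff hne, ← toFinset_finRange_reverse, key, ← rowAll, map_mul, map_mul, mul_assoc,
    mul_assoc]
  congr 1
  have e1 : lamProd (θ (yy n)) (List.finRange n).reverse.toFinset I (θ (lam n)) =
      θ (cFactor 0 I) * θ (cFactor 1 I) := by
    rw [lamProd, cFactor, cFactor, map_prod, map_prod, ← Finset.prod_mul_distrib,
      toFinset_finRange_reverse]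
    refine Finset.prod_congr rfl fun i _ => ?_
    rw [lamFactor, wNum_eq_hSum]
    simp
  have e2 : addProd (fun i => θ (zz i)) (θ (yy n)) (List.finRange n).reverse.toFinset J =
      compNorm (fun i => θ (zz i)) (θ (yy n)) J *
        θ (eFactor fun r => zz (J.orderEmbOfFin h r)) := by
    rw [addProd, compNorm, eFactor, prod_orderEmbOfFin h fun j => ∏ b : Fin I.card,
      (zz j - zz (J.orderEmbOfFin h b) + yy n), map_prod, ← Finset.prod_mul_distrib,
      toFinset_finRange_reverse]
    refine Finset.prod_congr rfl fun j _ => ?_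
    rw [prod_orderEmbOfFin h fun b => (zz j - zz b + yy n), map_prod, mul_comm,
      ← Finset.prod_mul_prod_compl J]
    simp
  rw [e1, e2]
  ring

/-- Matches the convention that a stable class restricts to zero on the other components of 𝒳_n. -/
theorem rowVec_eq_zero {z : Fin n → F} {y : F} (L : List (Fin n)) (hL : L.Nodup) (l : F)
    {J I : Finset (Fin n)} (hJ : J ⊆ L.toFinset) (hI : I ⊆ L.toFinset) (h : J.card ≠ I.card) :
    rowVec z y L l J I = 0 := by
  induction L generalizing J I l with
  | nil =>
    obtain rfl : J = ∅ := by simpa using hJ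
    obtain rfl : I = ∅ := by simpa using hI
    exact absurd rfl h
  | cons a L ih =>
    have hL' := List.nodup_cons.1 hL
    rw [List.toFinset_cons] at hJ hI
    have hI' := (Finset.subset_insert_iff).1 hI
    have hJ' := (Finset.subset_insert_iff).1 hJ
    unfold rowVec
    split_ifs with h1 h2 h2
    · rw [ih hL'.2 _ hJ' hI', mul_zero]
      rw [Finset.card_erase_of_mem h1, Finset.card_erase_of_mem h2]
      have := Finset.card_pos.2 ⟨a, h1⟩
      have := Finset.card_pos.2 ⟨a, h2⟩
      omega
    · rfl
    · rw [Finset.erase_eq_of_notMem h1] at hJ'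
      refine Finset.sum_eq_zero fun m hm => ?_
      rw [ih hL'.2 _ ((Finset.erase_subset _ _).trans hJ') hI', mul_zero]
      rw [Finset.card_erase_of_mem hm, Finset.card_erase_of_mem h2]
      have := Finset.card_pos.2 ⟨m, hm⟩
      have := Finset.card_pos.2 ⟨a, h2⟩
      omega
    · rw [Finset.erase_eq_of_notMem h1] at hJ'
      rw [Finset.erase_eq_of_notMem h2] at hI'
      rw [ih hL'.2 _ hJ' hI' h, mul_zero]

theorem map_kappaRestriction (I J : Finset (Fin n)) :
    θ (kappaRestriction I J) = rowAll (fun i => θ (zz i)) (θ (yy n)) (θ (lam n)) J I *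
        compNorm (fun i => θ (zz i)) (θ (yy n)) J := by
  unfold kappaRestriction
  split_ifs with h
  · exact map_weightPlus θ I J h
  · rw [map_zero, rowAll, rowVec_eq_zero _ (List.nodup_reverse.2 (List.nodup_finRange n)) _
      (by simp) (by simp) h, zero_mul]

/-! ### The matrix of restrictions is invertible -/

variable (n) in
/-- The matrix of the restrictions `κ_{id,I}|_{x_J}`. -/
noncomputable def kappaMatrix : Matrix (Finset (Fin n)) (Finset (Fin n)) (CoeffRing n) :=
  Matrix.of fun J I => kappaRestriction I J

theorem det_eq_prod_of_triangular {m R : Type*} [Fintype m] [DecidableEq m] [CommRing R]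
    (M : Matrix m m R) (b : m → ℕ) (hb : Function.Injective b)
    (h : ∀ i j, b j < b i → M i j = 0) : M.det = ∏ i, M i i := by
  let _ : LinearOrder m := LinearOrder.lift' b hb
  have := Matrix.det_of_isUpperTriangular (M := M) (fun i j hij => h i j hij)
  convert this

/-- The image of the units of the coefficient ring. -/
def IsUnitImage (x : F) : Prop := ∃ u : (CoeffRing n)ˣ, θ u = x

variable {θ} in
theorem IsUnitImage.mul {x x' : F} (h : IsUnitImage θ x) (h' : IsUnitImage θ x') :
    IsUnitImage θ (x * x') := by
  obtain ⟨u, rfl⟩ := h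
  obtain ⟨u', rfl⟩ := h'
  exact ⟨u * u', by simp⟩

variable {θ} in
theorem IsUnitImage.inv {x : F} (h : IsUnitImage θ x) : IsUnitImage θ x⁻¹ := by
  obtain ⟨u, rfl⟩ := h
  exact ⟨u⁻¹, by simp⟩

variable {θ} in
theorem IsUnitImage.prod {ι : Type*} (s : Finset ι) {f : ι → F}
    (h : ∀ i ∈ s, IsUnitImage θ (f i)) : IsUnitImage θ (∏ i ∈ s, f i) :=
  Finset.prod_induction f (IsUnitImage θ) (fun _ _ => IsUnitImage.mul) ⟨1, by simp⟩ h

variable {θ} in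
theorem IsUnitImage.of_isUnit {x : CoeffRing n} {x' : F} (h : IsUnit x) (hx : θ x = x') :
    IsUnitImage θ x' := by
  obtain ⟨u, rfl⟩ := h
  exact ⟨u, hx⟩

/-- The product formula for the diagonal entry lives in the fraction field, where being nonzero says
nothing about units of 𝓛. Each factor is therefore exhibited as the image of a unit, and injectivity
brings the product back. -/
theorem isUnit_kappaRestriction_self (I : Finset (Fin n)) : IsUnit (kappaRestriction I I) := by
  let θ : CoeffRing n →+* FractionRing (CoeffRing n) := algebraMap _ _
  have hθ : Function.Injective θ := IsFractionRing.injective _ _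
  have hadd : ∀ a b : Fin n, IsUnitImage θ (θ (zz a) - θ (zz b) + θ (yy n)) := fun a b =>
    .of_isUnit (isUnit_zz_add a b) (by simp)
  have : IsUnitImage θ (θ (kappaRestriction I I)) := by
    rw [map_kappaRestriction, rowAll, rowVec_self _ pairwise_finRange_reverse _ (by simp)]
    refine IsUnitImage.mul (IsUnitImage.mul ?_ ?_) ?_
    · refine IsUnitImage.prod _ fun i _ => IsUnitImage.inv ?_
      refine .of_isUnit (isUnit_lam_sub (hSum (Finset.filter (i < ·)
        (List.finRange n).reverse.toFinset) I + 1)) ?_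
      rw [lamFactor]
      simp
    · refine IsUnitImage.prod _ fun b hb => IsUnitImage.inv (IsUnitImage.prod _ fun j hj => ?_)
      rw [div_eq_mul_inv]
      refine (hadd j b).mul (IsUnitImage.inv (.of_isUnit (isUnit_zz_sub (a := j) (b := b) ?_) ?_))
      · exact ((Finset.mem_filter.1 hj).2).ne
      · simp
    · exact IsUnitImage.prod _ fun j _ => IsUnitImage.prod _ fun b _ => hadd j b
  obtain ⟨u, hu⟩ := this
  rw [← hθ hu]
  exact u.isUnit

theorem isUnit_det_kappaMatrix : IsUnit (kappaMatrix n).det := by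
  rw [det_eq_prod_of_triangular _ bruhatWeight bruhatWeight_injective]
  · exact IsUnit.prod_iff.2 fun I _ => isUnit_kappaRestriction_self I
  · intro J I h
    let θ : CoeffRing n →+* FractionRing (CoeffRing n) := algebraMap _ _
    have hθ : Function.Injective θ := IsFractionRing.injective _ _
    apply hθ
    rw [kappaMatrix, Matrix.of_apply, map_kappaRestriction, map_zero]
    by_contra hne
    exact h.not_ge (bruhatWeight_le_of_rowVec_ne_zero _ pairwise_finRange_reverse _ (by simp)
      (by simp) (left_ne_zero_of_mul hne))

end Specialization

/-! ### The L-operator as a transfer matrix -/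

section LOperator

variable {n : ℕ}

/-- Each factor changes only its own site. The sum over intermediate states on the sites thus
collapses to one term, leaving a product of 2×2 matrices in the auxiliary space. -/
theorem list_prod_rFactor (L : List (Fin n)) (hL : L.Pairwise (· < ·)) (α β : Fin 2)
    (I J : Finset (Fin n)) :
    (L.map (rFactor n)).prod (α, I) (β, J) =
      if ∀ m ∉ L, m ∈ I ↔ m ∈ J then
        (L.map fun j => siteBlock (fun i => HahnSeries.C (zz i)) (HahnSeries.C (yy n))
          (wVar (CoeffRing n)) (HahnSeries.C (lam n - (hAfter I j : CoeffRing n) * yy n))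
          I J j).prod α β
      else 0 := by
  induction L generalizing α β I J with
  | nil =>
    simp only [List.map_nil, List.prod_nil, List.not_mem_nil, not_false_eq_true, forall_const]
    by_cases h : I = J
    · subst h
      simp [Matrix.one_apply]
    · rw [if_neg fun h' => h (Finset.ext h'), Matrix.one_apply_ne (by simp [h])]
  | cons a L ih =>
    have hL' := List.pairwise_cons.1 hL
    have haL : a ∉ L := fun h => lt_irrefl _ (hL'.1 a h)
    rw [List.map_cons, List.prod_cons, Matrix.mul_apply, Fintype.sum_prod_type]
    by_cases hIJ : ∀ m ∉ a :: L, m ∈ I ↔ m ∈ J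
    · rw [if_pos hIJ, List.map_cons, List.prod_cons, Matrix.mul_apply]
      refine Finset.sum_congr rfl fun γ _ => ?_
      -- The only intermediate state that contributes: site `a` as in the input `J`, all other sites
      -- as in the output `I`.
      set K : Finset (Fin n) := if a ∈ J then insert a I else I.erase a with hK
      have haK : a ∈ K ↔ a ∈ J := by
        rw [hK]
        split_ifs with h <;> simp [h]
      have hmK : ∀ m ≠ a, m ∈ K ↔ m ∈ I := by
        intro m hm
        rw [hK]
        split_ifs <;> simp [hm]
      rw [Finset.sum_eq_single K]
      · rw [ih hL'.2, if_pos]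
        · congr 1
          · have e1 : I.erase a = K.erase a := by
              ext m
              by_cases hm : m = a
              · simp [hm]
              · simp [hm, hmK m hm]
            -- The factors to the right act first, so at the sites after `a` the state is already
            -- the output `I`; this is why the dynamical parameters in `transfer` use `I`.
            have e2 : hAfter K a = hAfter I a := by
              refine Finset.sum_congr rfl fun m hm => ?_
              simp only [hmK m (Finset.mem_Ioi.1 hm).ne']
            have e3 : spin K a = spin J a := by simp only [spin, haK]
            simp only [rFactor, siteBlock, Matrix.of_apply]
            rw [if_pos e1, e2, e3]
          · refine congrArg (fun M : List (Matrix (Fin 2) (Fin 2)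
                (LaurentSeries (CoeffRing n))) => M.prod γ β) (List.map_congr_left fun j hj => ?_)
            have haj := hL'.1 j hj
            have e2 : hAfter K j = hAfter I j := by
              refine Finset.sum_congr rfl fun m hm => ?_
              simp only [hmK m (haj.trans (Finset.mem_Ioi.1 hm)).ne']
            have e3 : spin K j = spin I j := by simp only [spin, hmK j haj.ne']
            rw [e2]
            ext
            simp only [siteBlock, Matrix.of_apply, e3]
        · intro m hm
          by_cases hma : m = a
          · rw [hma, haK]
          · rw [hmK m hma]
            exact hIJ m (by simp [hma, hm])
      · intro K' _ hne
        rw [ih hL'.2]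
        by_cases h1 : I.erase a = K'.erase a
        · rw [if_neg, mul_zero]
          intro h2
          apply hne
          ext m
          by_cases hma : m = a
          · rw [hma, haK, h2 a haL]
          · rw [hmK m hma]
            have := Finset.ext_iff.1 h1 m
            simpa [hma] using this.symm
        · simp only [rFactor]
          rw [if_neg h1, zero_mul]
      · simp
    · rw [if_neg hIJ]
      refine Finset.sum_eq_zero fun γ _ => Finset.sum_eq_zero fun K _ => ?_
      by_cases h1 : I.erase a = K.erase a
      · rw [ih hL'.2, if_neg, mul_zero]
        intro h2
        apply hIJ
        intro m hm
        rw [List.mem_cons, not_or] at hm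
        rw [← h2 m hm.2]
        have := Finset.ext_iff.1 h1 m
        simpa [hm.1] using this
      · simp only [rFactor]
        rw [if_neg h1, zero_mul]

theorem lOperator_apply (α β : Fin 2) (I J : Finset (Fin n)) :
    lOperator n (α, I) (β, J) =
      transfer (fun i => HahnSeries.C (zz i)) (HahnSeries.C (yy n)) (wVar (CoeffRing n))
        Finset.univ (HahnSeries.C (lam n)) I J α β := by
  rw [lOperator, List.ofFn_eq_map, list_prod_rFactor _ (List.pairwise_lt_finRange n),
    if_pos (by simp), transfer, Fin.sort_univ]
  refine congrArg (fun M : List (Matrix (Fin 2) (Fin 2) (LaurentSeries (CoeffRing n))) =>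
    M.prod α β) (List.map_congr_left fun j _ => ?_)
  rw [hAfter_eq_hSum, map_sub, map_mul, map_intCast]

/-! ### Base change of Laurent series -/

/-- The map of Laurent series induced by a homomorphism of coefficient rings. -/
def laurentMap {R S : Type} [CommRing R] [CommRing S] (f : R →+* S) :
    LaurentSeries R →+* LaurentSeries S where
  toFun x := x.map f
  map_one' := by
    rw [← HahnSeries.C_one, HahnSeries.map_C, map_one, HahnSeries.C_one]
  map_mul' _ _ := HahnSeries.map_mul (f : R →ₙ+* S)
  map_zero' := by
    rw [← HahnSeries.C_zero, HahnSeries.map_C, map_zero, HahnSeries.C_zero]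
  map_add' _ _ := HahnSeries.map_add (f : R →+ S)

theorem laurentMap_coeff {R S : Type} [CommRing R] [CommRing S] (f : R →+* S)
    (x : LaurentSeries R) (s : ℤ) : (laurentMap f x).coeff s = f (x.coeff s) := rfl

theorem laurentMap_C {R S : Type} [CommRing R] [CommRing S] (f : R →+* S) (a : R) :
    laurentMap f (HahnSeries.C a) = HahnSeries.C (f a) := HahnSeries.map_C a f

theorem laurentMap_wVar {R S : Type} [CommRing R] [CommRing S] (f : R →+* S) :
    laurentMap f (wVar R) = wVar S := by
  ext s
  rw [laurentMap_coeff, wVar, wVar, HahnSeries.coeff_single, HahnSeries.coeff_single]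
  split_ifs <;> simp

/-- The geometric series `∑ aˢ Xˢ`. -/
def geomSeries {R : Type} [CommRing R] (a : R) : PowerSeries R := PowerSeries.mk fun s => a ^ s

theorem one_sub_mul_geomSeries {R : Type} [CommRing R] (a : R) :
    (1 - PowerSeries.C a * PowerSeries.X) * geomSeries a = 1 := by
  ext s
  rw [sub_mul, one_mul, map_sub, mul_assoc, PowerSeries.coeff_C_mul]
  cases s with
  | zero => simp [geomSeries]
  | succ s =>
    rw [PowerSeries.coeff_succ_X_mul]
    simp [geomSeries, PowerSeries.coeff_one, pow_succ']

theorem wVar_mul_single {R : Type} [CommRing R] :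
    wVar R * HahnSeries.single (1 : ℤ) 1 = 1 := by
  rw [wVar, HahnSeries.single_mul_single]
  simp

theorem wVar_sub_mul {R : Type} [CommRing R] (a : R) :
    (wVar R - HahnSeries.C a) * (HahnSeries.single (1 : ℤ) 1 *
      HahnSeries.ofPowerSeries ℤ R (geomSeries a)) = 1 := by
  have h1 := congrArg (HahnSeries.ofPowerSeries ℤ R) (one_sub_mul_geomSeries a)
  rw [map_mul, map_sub, map_mul, map_one, HahnSeries.ofPowerSeries_C,
    HahnSeries.ofPowerSeries_X] at h1
  rw [← mul_assoc, sub_mul, wVar_mul_single, h1]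

theorem isUnit_wVar_sub {R : Type} [CommRing R] (a : R) : IsUnit (wVar R - HahnSeries.C a) :=
  IsUnit.of_mul_eq_one _ (wVar_sub_mul a)

/-- The invertibility hypothesis is essential because `Ring.inverse` is zero at non-units and is
then not respected by homomorphisms. -/
theorem map_rMatrix {A F : Type} [CommRing A] [Field F] (f : A →+* F) {l z y : A}
    (h : IsUnit (l * (z - y))) (r c : Fin 2 × Fin 2) :
    f (rMatrix l z y r c) = rMatrix (f l) (f z) (f y) r c := by
  have h1 := map_inverse_of_isUnit f h
  rw [map_mul, map_sub] at h1
  obtain ⟨r1, r2⟩ := r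
  obtain ⟨c1, c2⟩ := c
  fin_cases r1 <;> fin_cases r2 <;> fin_cases c1 <;> fin_cases c2 <;>
    simp [rMatrix, h1]

theorem map_transfer {A F : Type} [CommRing A] [Field F] (f : A →+* F) (z : Fin n → A)
    (y w l : A) (I J : Finset (Fin n))
    (h : ∀ (j : Fin n) (m : ℤ), IsUnit ((l - m * y) * (w - z j - y))) (α β : Fin 2) :
    f (transfer z y w Finset.univ l I J α β) =
      transfer (fun i => f (z i)) (f y) (f w) Finset.univ (f l) I J α β := by
  have : f.mapMatrix (transfer z y w Finset.univ l I J) =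
      transfer (fun i => f (z i)) (f y) (f w) Finset.univ (f l) I J := by
    rw [transfer, transfer, map_list_prod, List.map_map]
    congr 1
    refine List.map_congr_left fun j _ => ?_
    ext α β
    simp only [Function.comp_apply, RingHom.mapMatrix_apply, Matrix.map_apply, siteBlock,
      Matrix.of_apply]
    rw [map_rMatrix f (h j _)]
    simp
  rw [← this]
  rfl

/-! ### The action of the coefficients of the L-operator on the matrix of restrictions -/

variable (n) in
/-- The embedding of the coefficient ring into its field of fractions. -/
noncomputable abbrev toFrac : CoeffRing n →+* FractionRing (CoeffRing n) := algebraMap _ _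

variable (n) in
/-- The embedding of the coefficient ring into Laurent series over its field of fractions. -/
noncomputable def toLaurent : CoeffRing n →+* LaurentSeries (FractionRing (CoeffRing n)) :=
  HahnSeries.C.comp (toFrac n)

variable (n) in
/-- Power series in `w⁻¹` as Laurent series over the field of fractions. -/
noncomputable def seriesToLaurent :
    PowerSeries (CoeffRing n) →+* LaurentSeries (FractionRing (CoeffRing n)) :=
  (HahnSeries.ofPowerSeries ℤ (FractionRing (CoeffRing n))).comp (PowerSeries.map (toFrac n))

theorem toLaurent_apply (a : CoeffRing n) : toLaurent n a = HahnSeries.C (toFrac n a) := rfl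

theorem seriesToLaurent_coeff (p : PowerSeries (CoeffRing n)) (s : ℕ) :
    (seriesToLaurent n p).coeff (s : ℤ) = toFrac n (PowerSeries.coeff s p) := by
  rw [seriesToLaurent, RingHom.comp_apply, HahnSeries.ofPowerSeries_apply_coeff,
    PowerSeries.coeff_map]

theorem seriesToLaurent_C (a : CoeffRing n) :
    seriesToLaurent n (PowerSeries.C a) = toLaurent n a := by
  rw [seriesToLaurent, RingHom.comp_apply, PowerSeries.map_C, HahnSeries.ofPowerSeries_C,
    toLaurent_apply]

theorem seriesToLaurent_X :
    seriesToLaurent n PowerSeries.X = (wVar (FractionRing (CoeffRing n)))⁻¹ := by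
  rw [seriesToLaurent, RingHom.comp_apply, PowerSeries.map_X, HahnSeries.ofPowerSeries_X]
  exact eq_inv_of_mul_eq_one_right wVar_mul_single

theorem wVar_ne_zero {K : Type} [Field K] : wVar K ≠ 0 :=
  left_ne_zero_of_mul_eq_one wVar_mul_single

theorem wVar_sub_ne_zero {K : Type} [Field K] (a : K) : wVar K - HahnSeries.C a ≠ 0 :=
  left_ne_zero_of_mul_eq_one (wVar_sub_mul a)

theorem seriesToLaurent_geomSeries (a : CoeffRing n) :
    seriesToLaurent n (geomSeries a) =
      wVar (FractionRing (CoeffRing n)) *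
        (wVar (FractionRing (CoeffRing n)) - toLaurent n a)⁻¹ := by
  have h1 := congrArg (seriesToLaurent n) (one_sub_mul_geomSeries a)
  rw [map_mul, map_sub, map_mul, map_one, seriesToLaurent_C, seriesToLaurent_X] at h1
  have h2 := wVar_ne_zero (K := FractionRing (CoeffRing n))
  have h3 := wVar_sub_ne_zero (toFrac n a)
  rw [← toLaurent_apply] at h3
  rw [eq_inv_of_mul_eq_one_right h1]
  have h4 : 1 - toLaurent n a * (wVar (FractionRing (CoeffRing n)))⁻¹ =
      (wVar (FractionRing (CoeffRing n)) - toLaurent n a) *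
        (wVar (FractionRing (CoeffRing n)))⁻¹ := by
    rw [sub_mul, mul_inv_cancel₀ h2]
  rw [h4, mul_inv, inv_inv, mul_comm]

theorem laurentMap_lOperator (α β : Fin 2) (I J : Finset (Fin n)) :
    laurentMap (toFrac n) (lOperator n (α, I) (β, J)) =
      transfer (fun i => toLaurent n (zz i)) (toLaurent n (yy n))
        (wVar (FractionRing (CoeffRing n))) Finset.univ (toLaurent n (lam n)) I J α β := by
  rw [lOperator_apply, map_transfer]
  · simp only [laurentMap_C, laurentMap_wVar, toLaurent_apply]
  · intro j m
    refine IsUnit.mul ?_ ?_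
    · have := (isUnit_lam_sub (n := n) m).map (HahnSeries.C (Γ := ℤ))
      rwa [map_sub, map_mul, map_intCast] at this
    · have := isUnit_wVar_sub (zz j + yy n)
      rwa [map_add, ← sub_sub] at this

theorem shift_lam (m : ℤ) : shift n m (lam n) = lam n + (m : CoeffRing n) * yy n := by
  have := IsLocalization.lift_eq (M := denominators n) (S := CoeffRing n) (isUnit_shift n m)
    Polynomial.X
  rw [lam]
  exact this.trans (by simp [lam])

theorem shift_zz (m : ℤ) (i : Fin n) : shift n m (zz i) = zz i := (shift n m).commutes _

theorem shift_yy (m : ℤ) : shift n m (yy n) = yy n := (shift n m).commutes _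

/-- The series `∏_{j ∈ J} (w - z_j) / (w - z_j - y)` in `w⁻¹`. -/
noncomputable def dSeries (J : Finset (Fin n)) : PowerSeries (CoeffRing n) :=
  ∏ j ∈ J, (1 - PowerSeries.C (zz j) * PowerSeries.X) * geomSeries (zz j + yy n)

/-- The matrix coefficient of `F̃(w)` between the fixed points `x_{J ∪ i}` and `x_J`. -/
noncomputable def fSeries (J : Finset (Fin n)) (i : Fin n) : PowerSeries (CoeffRing n) :=
  PowerSeries.C (-(yy n) * (∏ j ∈ J, (zz j - zz i + yy n)) *
    ∏ b ∈ (insert i J)ᶜ, Ring.inverse (zz i - zz b)) *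
  (1 + PowerSeries.C (lam n + ((n : CoeffRing n) - 2 * J.card - 1) * yy n) * PowerSeries.X *
    geomSeries (zz i))

/-- The matrix coefficient of `Ẽ(w)` between the fixed points `x_{J ∖ m}` and `x_J`. -/
noncomputable def eSeries (J : Finset (Fin n)) (m : Fin n) : PowerSeries (CoeffRing n) :=
  PowerSeries.C (-(yy n) * Ring.inverse ((lam n - yy n) * (lam n - 2 * yy n)) *
    (∏ b ∈ Jᶜ, (zz m - zz b + yy n)) * ∏ j ∈ J.erase m, Ring.inverse (zz j - zz m)) *
  (-1 + PowerSeries.C (lam n - yy n) * PowerSeries.X * geomSeries (zz m))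

theorem seriesToLaurent_dSeries (J : Finset (Fin n)) :
    seriesToLaurent n (dSeries J) = dEig (fun i => toLaurent n (zz i)) (toLaurent n (yy n))
      (wVar (FractionRing (CoeffRing n))) J := by
  rw [dSeries, dEig, map_prod]
  refine Finset.prod_congr rfl fun j _ => ?_
  rw [map_mul, map_sub, map_mul, map_one, seriesToLaurent_C, seriesToLaurent_X,
    seriesToLaurent_geomSeries]
  have h2 := wVar_ne_zero (K := FractionRing (CoeffRing n))
  have h3 := wVar_sub_ne_zero (toFrac n (zz j + yy n))
  rw [← toLaurent_apply, map_add, ← sub_sub] at h3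
  rw [map_add, ← sub_sub]
  field_simp

theorem seriesToLaurent_fSeries (J : Finset (Fin n)) (i : Fin n) :
    seriesToLaurent n (fSeries J i) = -(toLaurent n (yy n)) *
      (∏ j ∈ J, (toLaurent n (zz j) - toLaurent n (zz i) + toLaurent n (yy n))) *
      (∏ b ∈ (insert i J)ᶜ, (toLaurent n (zz i) - toLaurent n (zz b)))⁻¹ *
      (1 + (toLaurent n (lam n) + ((n : LaurentSeries (FractionRing (CoeffRing n))) -
        2 * J.card - 1) * toLaurent n (yy n)) *
        (wVar (FractionRing (CoeffRing n)) - toLaurent n (zz i))⁻¹) := by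
  have hinv : toLaurent n (∏ b ∈ (insert i J)ᶜ, Ring.inverse (zz i - zz b)) =
      (∏ b ∈ (insert i J)ᶜ, (toLaurent n (zz i) - toLaurent n (zz b)))⁻¹ := by
    rw [map_prod, ← Finset.prod_inv_distrib]
    refine Finset.prod_congr rfl fun b hb => ?_
    rw [map_inverse_of_isUnit _ (isUnit_zz_sub ?_), map_sub]
    rintro rfl
    simp at hb
  have hX : seriesToLaurent n (PowerSeries.X * geomSeries (zz i)) =
      (wVar (FractionRing (CoeffRing n)) - toLaurent n (zz i))⁻¹ := by
    rw [map_mul, seriesToLaurent_X, seriesToLaurent_geomSeries,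
      inv_mul_cancel_left₀ wVar_ne_zero]
  rw [fSeries, map_mul (seriesToLaurent n), map_add (seriesToLaurent n),
    mul_assoc (PowerSeries.C _) PowerSeries.X, map_mul (seriesToLaurent n), hX,
    map_one (seriesToLaurent n), seriesToLaurent_C, seriesToLaurent_C, map_mul (toLaurent n), hinv]
  simp only [map_neg, map_mul, map_prod, map_add, map_sub, map_natCast, map_one, map_ofNat]

/-- The shift by `y` turns the denominator (λ - y)(λ - 2y) of c_E into the λ(λ - y) of `eEntry`. It
arises because δ from L̃_22 has to pass the coefficients of Ẽ. -/
theorem seriesToLaurent_map_shift_eSeries (J : Finset (Fin n)) (m : Fin n) :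
    seriesToLaurent n
        (PowerSeries.map (shift n 1 : CoeffRing n →+* CoeffRing n) (eSeries J m)) =
      -(toLaurent n (yy n)) *
        (toLaurent n (lam n) * (toLaurent n (lam n) - toLaurent n (yy n)))⁻¹ *
        (∏ b ∈ Jᶜ, (toLaurent n (zz m) - toLaurent n (zz b) + toLaurent n (yy n))) *
        (∏ j ∈ J.erase m, (toLaurent n (zz j) - toLaurent n (zz m)))⁻¹ *
        (-1 + toLaurent n (lam n) *
          (wVar (FractionRing (CoeffRing n)) - toLaurent n (zz m))⁻¹) := by
  have hgeom : PowerSeries.map (shift n 1 : CoeffRing n →+* CoeffRing n) (geomSeries (zz m)) =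
      geomSeries (zz m) := by
    ext s
    rw [PowerSeries.coeff_map, geomSeries, PowerSeries.coeff_mk, map_pow]
    exact congrArg (· ^ s) (shift_zz 1 m)
  have hX : seriesToLaurent n (PowerSeries.X * geomSeries (zz m)) =
      (wVar (FractionRing (CoeffRing n)) - toLaurent n (zz m))⁻¹ := by
    rw [map_mul, seriesToLaurent_X, seriesToLaurent_geomSeries,
      inv_mul_cancel_left₀ wVar_ne_zero]
  have sh : ∀ x : CoeffRing n, toLaurent n ((shift n 1 : CoeffRing n →+* CoeffRing n) x) =
      ((toLaurent n).comp (shift n 1 : CoeffRing n →+* CoeffRing n)) x := fun _ => rfl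
  have tz : ∀ i, ((toLaurent n).comp (shift n 1 : CoeffRing n →+* CoeffRing n)) (zz i) =
      toLaurent n (zz i) := fun i => congrArg (toLaurent n) (shift_zz 1 i)
  have ty : ((toLaurent n).comp (shift n 1 : CoeffRing n →+* CoeffRing n)) (yy n) =
      toLaurent n (yy n) := congrArg (toLaurent n) (shift_yy 1)
  have tl : ((toLaurent n).comp (shift n 1 : CoeffRing n →+* CoeffRing n)) (lam n) =
      toLaurent n (lam n) + toLaurent n (yy n) := by
    have := congrArg (toLaurent n) (shift_lam (n := n) 1)
    rw [Int.cast_one, one_mul, map_add] at this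
    exact this
  have hu : IsUnit ((lam n - yy n) * (lam n - 2 * yy n)) := by
    have h1 := isUnit_lam_sub (n := n) 1
    have h2 := isUnit_lam_sub (n := n) 2
    push_cast at h1 h2
    rw [one_mul] at h1
    exact h1.mul h2
  rw [eSeries, map_mul (PowerSeries.map _), map_add (PowerSeries.map _),
    mul_assoc (PowerSeries.C _) PowerSeries.X, map_neg (PowerSeries.map _),
    map_one (PowerSeries.map _), map_mul (PowerSeries.map _), map_mul (PowerSeries.map _), hgeom,
    PowerSeries.map_X, PowerSeries.map_C, PowerSeries.map_C, map_mul (seriesToLaurent n),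
    map_add (seriesToLaurent n), map_mul (seriesToLaurent n), hX, map_neg (seriesToLaurent n),
    map_one (seriesToLaurent n), seriesToLaurent_C, seriesToLaurent_C, sh, sh]
  generalize (toLaurent n).comp (shift n 1 : CoeffRing n →+* CoeffRing n) = θ at *
  have hinv : θ (∏ j ∈ J.erase m, Ring.inverse (zz j - zz m)) =
      (∏ j ∈ J.erase m, (toLaurent n (zz j) - toLaurent n (zz m)))⁻¹ := by
    rw [map_prod, ← Finset.prod_inv_distrib]
    refine Finset.prod_congr rfl fun b hb => ?_
    rw [map_inverse_of_isUnit _ (isUnit_zz_sub ?_), map_sub, tz, tz]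
    rintro rfl
    simp at hb
  rw [map_mul θ, hinv, map_mul θ, map_mul θ, map_inverse_of_isUnit θ hu]
  simp only [map_neg, map_mul, map_prod, map_add, map_sub, map_ofNat, tz, ty, tl]
  have e2 : ∀ l y : LaurentSeries (FractionRing (CoeffRing n)),
      (l + y - y) * (l + y - 2 * y) = l * (l - y) := fun l y => by ring
  rw [e2, add_sub_cancel_right]

theorem compNorm_insert {R : Type} [CommRing R] (z : Fin n → R) (y : R) {J : Finset (Fin n)}
    {i : Fin n} (hi : i ∉ J) :
    compNorm z y (insert i J) * ∏ j ∈ J, (z j - z i + y) =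
      compNorm z y J * ∏ b ∈ (insert i J)ᶜ, (z i - z b + y) := by
  have e : Jᶜ = insert i (insert i J)ᶜ := by
    ext m
    by_cases hm : m = i
    · simp [hm, hi]
    · simp [hm]
  have e2 : compNorm z y J = (∏ j ∈ J, (z j - z i + y)) *
      ∏ j ∈ J, ∏ b ∈ (insert i J)ᶜ, (z j - z b + y) := by
    rw [compNorm, ← Finset.prod_mul_distrib]
    refine Finset.prod_congr rfl fun j _ => ?_
    rw [e, Finset.prod_insert (by simp)]
  rw [e2, compNorm, Finset.prod_insert hi]
  ring

/-- The factors containing `y` cancel, leaving the products of z_j - z_b that appear as denominators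
in the formula for F̃. -/
theorem pairNorm_mul_compNorm {F : Type} [Field F] {z : Fin n → F} {y : F}
    (hz : GenericSites z y) (J : Finset (Fin n)) :
    pairNorm z y J * compNorm z y J = compNorm z 0 J := by
  rw [pairNorm, compNorm, compNorm, Finset.prod_comm, Finset.prod_comm (s := J),
    ← Finset.prod_mul_distrib]
  refine Finset.prod_congr rfl fun b hb => ?_
  have hb' := Finset.mem_compl.1 hb
  rw [← qProd_mul_prod hz hb', inv_mul_cancel_left₀ (hz.qProd_ne_zero hb')]
  simp

variable (I J : Finset (Fin n))

theorem genericSites_toLaurent :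
    GenericSites (fun i => toLaurent n (zz i)) (toLaurent n (yy n)) := genericSites_map _

theorem wVar_sub_sub_ne_zero (a : Fin n) : wVar (FractionRing (CoeffRing n)) -
    toLaurent n (zz a) - toLaurent n (yy n) ≠ 0 := by
  have h3 := wVar_sub_ne_zero (toFrac n (zz a + yy n))
  rwa [← toLaurent_apply, map_add, ← sub_sub] at h3

theorem toLaurent_shift_kappa (m : ℤ) : toLaurent n (shift n m (kappaRestriction I J)) =
    rowAll (fun i => toLaurent n (zz i)) (toLaurent n (yy n))
      (toLaurent n (lam n) + m * toLaurent n (yy n)) J I *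
        compNorm (fun i => toLaurent n (zz i)) (toLaurent n (yy n)) J := by
  have := map_kappaRestriction ((toLaurent n).comp (shift n m : CoeffRing n →+* CoeffRing n)) I J
  rw [RingHom.comp_apply] at this
  refine this.trans ?_
  simp only [RingHom.comp_apply (toLaurent n), RingHom.coe_coe, shift_lam, shift_zz, shift_yy,
    map_add, map_mul, map_intCast]

/-- Transfers an identity of Laurent series over the fraction field to single coefficients in 𝓛, by
injectivity of 𝓛 into its fraction field. -/
theorem coeff_kappa_lOperator (α β : Fin 2) (p : PowerSeries (CoeffRing n))
    (h : ∑ I', toLaurent n (kappaRestriction I' J) *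
      transfer (fun i => toLaurent n (zz i)) (toLaurent n (yy n))
        (wVar (FractionRing (CoeffRing n))) Finset.univ (toLaurent n (lam n)) I' I α β =
      seriesToLaurent n p) (s : ℕ) :
    ∑ I', kappaRestriction I' J * (lOperator n (α, I') (β, I)).coeff (s : ℤ) =
      PowerSeries.coeff s p := by
  have h1 : laurentMap (toFrac n) (∑ I', HahnSeries.C (kappaRestriction I' J) *
      lOperator n (α, I') (β, I)) = seriesToLaurent n p := by
    rw [← h, map_sum]
    refine Finset.sum_congr rfl fun I' _ => ?_
    rw [map_mul, laurentMap_C, laurentMap_lOperator,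
      ← toLaurent_apply (kappaRestriction I' J)]
  have h2 := congrArg (fun x => HahnSeries.coeff x (s : ℤ)) h1
  simp only [laurentMap_coeff, seriesToLaurent_coeff] at h2
  rw [← IsFractionRing.injective (CoeffRing n) (FractionRing (CoeffRing n)) h2]
  simp only [HahnSeries.coeff_sum, HahnSeries.C_mul_eq_smul, HahnSeries.coeff_smul, smul_eq_mul]

theorem kappa_lOperator_diag (s : ℕ) :
    ∑ I', kappaRestriction I' J * (lOperator n (1, I') (1, I)).coeff (s : ℤ) =
      PowerSeries.coeff s (dSeries J) * shift n 1 (kappaRestriction I J) := by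
  rw [coeff_kappa_lOperator I J 1 1 (dSeries J * PowerSeries.C (shift n 1 (kappaRestriction I J))),
    PowerSeries.coeff_mul_C]
  have := (rowAll_relations genericSites_toLaurent wVar_sub_sub_ne_zero
    (isGeneric_map (toLaurent n)) J I).1
  rw [map_mul, seriesToLaurent_dSeries, seriesToLaurent_C, toLaurent_shift_kappa]
  simp only [map_kappaRestriction (toLaurent n)]
  simp only [mul_right_comm _ (compNorm _ _ _)]
  rw [← Finset.sum_mul, this, Int.cast_one, one_mul]
  ring

/-- Since L̃_12 = F̃ L̃_22, the coefficient of F̃ comes multiplied by the eigenvalue of L_22 at the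
larger set. -/
theorem kappa_lOperator_up (s : ℕ) :
    ∑ I', kappaRestriction I' J * (lOperator n (0, I') (1, I)).coeff (s : ℤ) =
      ∑ i ∈ Jᶜ, PowerSeries.coeff s (fSeries J i * dSeries (insert i J)) *
        shift n 1 (kappaRestriction I (insert i J)) := by
  rw [coeff_kappa_lOperator I J 0 1 (∑ i ∈ Jᶜ, fSeries J i * dSeries (insert i J) *
    PowerSeries.C (shift n 1 (kappaRestriction I (insert i J)))), map_sum]
  · exact Finset.sum_congr rfl fun i _ => PowerSeries.coeff_mul_C _ _ _
  have hz := genericSites_toLaurent (n := n)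
  have hw := wVar_sub_sub_ne_zero (n := n)
  have := rowAll_relation_up hz hw (isGeneric_map (toLaurent n)) J I
  rw [map_sum]
  simp only [map_kappaRestriction (toLaurent n)]
  simp only [mul_right_comm _ (compNorm _ _ _)]
  rw [← Finset.sum_mul, this, Finset.sum_mul]
  refine Finset.sum_congr rfl fun i hi => ?_
  have hi' := Finset.mem_compl.1 hi
  rw [map_mul, map_mul, seriesToLaurent_dSeries, seriesToLaurent_C, toLaurent_shift_kappa,
    Int.cast_one, one_mul, fEntry, dEig_erase _ _ _ (Finset.mem_insert_self i J),
    Finset.erase_insert hi', Finset.card_insert_of_notMem hi', seriesToLaurent_fSeries]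
  have c1 := pairNorm_mul_compNorm hz J
  have c2 := pairNorm_mul_compNorm hz (insert i J)
  have c3 := compNorm_insert (fun i => toLaurent n (zz i)) 0 hi'
  have c4 := qProd_mul_prod hz hi'
  have n1 := pairNorm_ne_zero hz (insert i J)
  have n2 : ∏ b ∈ (insert i J)ᶜ, (toLaurent n (zz i) - toLaurent n (zz b) + 0) ≠ 0 := by
    refine Finset.prod_ne_zero_iff.2 fun b hb => ?_
    rw [add_zero]
    refine hz.sub_ne (a := i) (b := b) ?_
    rintro rfl
    simp at hb
  have n3 := hw i
  have n4 : wVar (FractionRing (CoeffRing n)) - toLaurent n (zz i) ≠ 0 :=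
    wVar_sub_ne_zero (toFrac n (zz i))
  have n5 := wVar_ne_zero (K := FractionRing (CoeffRing n))
  have n6 : ∏ j ∈ J, (toLaurent n (zz j) - toLaurent n (zz i)) ≠ 0 :=
    Finset.prod_ne_zero_iff.2 fun j hj => hz.sub_ne fun e => hi' (e ▸ hj)
  rw [← c4]
  simp only [add_zero] at c3 n2
  generalize rowAll (fun i => toLaurent n (zz i)) (toLaurent n (yy n)) _ _ _ = P
  generalize dEig (fun i => toLaurent n (zz i)) _ _ _ = P1
  generalize compNorm (fun i => toLaurent n (zz i)) (toLaurent n (yy n)) J = N1 at *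
  generalize compNorm (fun i => toLaurent n (zz i)) (toLaurent n (yy n)) (insert i J) = N2 at *
  generalize compNorm (fun i => toLaurent n (zz i)) 0 J = V1 at *
  generalize compNorm (fun i => toLaurent n (zz i)) 0 (insert i J) = V2 at *
  generalize pairNorm (fun i => toLaurent n (zz i)) _ J = M1 at *
  generalize pairNorm (fun i => toLaurent n (zz i)) _ (insert i J) = M2 at *
  generalize qProd (fun i => toLaurent n (zz i)) _ _ J = Q at *
  generalize ∏ j ∈ J, (toLaurent n (zz j) - toLaurent n (zz i)) = B at *
  generalize ∏ b ∈ (insert i J)ᶜ, (toLaurent n (zz i) - toLaurent n (zz b)) = D at *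
  generalize toLaurent n (yy n) = y at *
  generalize toLaurent n (zz i) = z at *
  generalize toLaurent n (lam n) = l at *
  generalize wVar (FractionRing (CoeffRing n)) = w at *
  -- The ratio of the normalizations at `J` and `J ∪ i`, from duality and from `compNorm`, reduces
  -- to a ratio of products of differences of the z's.
  have c5 : M1 * N1 * D = M2 * N2 * B := by rw [c1, c2, c3]
  push_cast
  field_simp
  linear_combination (-1 * Q * P * P1 * y * (l + w - z + y * (n - 2 * (J.card + 1) + 1))) * c5

/-- Since L̃_21 = L̃_22 Ẽ, the eigenvalue is taken at `J` and the coefficient of Ẽ is shifted by the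
δ in L̃_22. -/
theorem kappa_lOperator_down (s : ℕ) :
    ∑ I', kappaRestriction I' J * (lOperator n (1, I') (0, I)).coeff (s : ℤ) =
      ∑ m ∈ J, PowerSeries.coeff s (dSeries J *
        PowerSeries.map (shift n 1 : CoeffRing n →+* CoeffRing n) (eSeries J m)) *
        shift n (-1) (kappaRestriction I (J.erase m)) := by
  rw [coeff_kappa_lOperator I J 1 0 (∑ m ∈ J, dSeries J *
    PowerSeries.map (shift n 1 : CoeffRing n →+* CoeffRing n) (eSeries J m) *
    PowerSeries.C (shift n (-1) (kappaRestriction I (J.erase m)))), map_sum]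
  · exact Finset.sum_congr rfl fun i _ => PowerSeries.coeff_mul_C _ _ _
  have hz := genericSites_toLaurent (n := n)
  have hw := wVar_sub_sub_ne_zero (n := n)
  have hl := isGeneric_map (toLaurent n)
  have := (rowAll_relations hz hw hl J I).2
  rw [map_sum]
  simp only [map_kappaRestriction (toLaurent n)]
  simp only [mul_right_comm _ (compNorm _ _ _)]
  rw [← Finset.sum_mul, this, Finset.sum_mul]
  refine Finset.sum_congr rfl fun m hm => ?_
  rw [map_mul, map_mul, seriesToLaurent_dSeries, seriesToLaurent_C, toLaurent_shift_kappa,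
    eEntry, dEig_erase _ _ _ hm, seriesToLaurent_map_shift_eSeries]
  have e0 : J = insert m (J.erase m) := (Finset.insert_erase hm).symm
  have hi' : m ∉ J.erase m := Finset.notMem_erase _ _
  have c3 := compNorm_insert (fun i => toLaurent n (zz i)) (toLaurent n (yy n)) hi'
  rw [← e0] at c3
  have c4 := qProd_mul_prod hz hi'
  rw [← c4] at c3
  have n3 := hw m
  have n4 : wVar (FractionRing (CoeffRing n)) - toLaurent n (zz m) ≠ 0 :=
    wVar_sub_ne_zero (toFrac n (zz m))
  have n5 := wVar_ne_zero (K := FractionRing (CoeffRing n))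
  have n6 : ∏ j ∈ J.erase m, (toLaurent n (zz j) - toLaurent n (zz m)) ≠ 0 :=
    Finset.prod_ne_zero_iff.2 fun j hj => hz.sub_ne (Finset.ne_of_mem_erase hj)
  have n7 := hl.ne_zero
  have n8 := hl.sub.ne_zero
  have e1 : toLaurent n (lam n) + (((-1 : ℤ) : ℤ) : LaurentSeries (FractionRing (CoeffRing n))) *
      toLaurent n (yy n) = toLaurent n (lam n) - toLaurent n (yy n) := by
    push_cast
    ring
  rw [e1]
  generalize rowAll (fun i => toLaurent n (zz i)) (toLaurent n (yy n)) _ _ _ = P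
  generalize dEig (fun i => toLaurent n (zz i)) _ _ _ = P1
  generalize compNorm (fun i => toLaurent n (zz i)) (toLaurent n (yy n)) J = N1 at *
  generalize compNorm (fun i => toLaurent n (zz i)) (toLaurent n (yy n)) (J.erase m) = N2 at *
  generalize qProd (fun i => toLaurent n (zz i)) _ _ (J.erase m) = Q at *
  generalize ∏ j ∈ J.erase m, (toLaurent n (zz j) - toLaurent n (zz m)) = B at *
  generalize ∏ b ∈ Jᶜ, (toLaurent n (zz m) - toLaurent n (zz b) + toLaurent n (yy n)) = D at *
  generalize toLaurent n (yy n) = y at *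
  generalize toLaurent n (zz m) = z at *
  generalize toLaurent n (lam n) = l at *
  generalize wVar (FractionRing (CoeffRing n)) = w at *
  field_simp
  linear_combination (-1 * P * P1 * y * (l - w + z)) * c3

end LOperator

/-! ### Evaluation modulo the relations of the equivariant cohomology -/

section LagrangeIdempotents

open Polynomial

variable {n : ℕ} {A S σ : Type*} [CommRing A] [CommRing S] [Algebra A S] [Fintype σ]

/-- The Lagrange basis polynomial `∏_{b ≠ a} (U - z_b) / (z_a - z_b)`. -/
noncomputable def lagrangeBasis (z : Fin n → A) (a : Fin n) : Polynomial A :=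
  ∏ b ∈ Finset.univ.erase a, (C (Ring.inverse (z a - z b)) * (X - C (z b)))

/-- Both sides have degree less than `n` and agree at the `n` nodes. For `n = 0` the sum is empty,
hence the assumption. -/
theorem sum_lagrangeBasis [IsDomain A] [NeZero n] {z : Fin n → A}
    (hz : ∀ a b, a ≠ b → IsUnit (z a - z b)) :
    ∑ a, lagrangeBasis z a = 1 := by
  have hinj : Function.Injective z := fun a b h => by
    by_contra hab
    exact (hz a b hab).ne_zero (sub_eq_zero.2 h)
  have hn : (Finset.univ : Finset (Fin n)).card = n := by simp
  refine Polynomial.eq_of_degrees_lt_of_eval_index_eq (s := Finset.univ) (v := z) hinj.injOn ?_ ?_ ?_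
  · refine lt_of_le_of_lt (b := (↑(n - 1) : WithBot ℕ)) ?_ ?_
    · refine (Polynomial.degree_sum_le _ _).trans (Finset.sup_le fun a _ => ?_)
      rw [lagrangeBasis]
      refine (Polynomial.degree_prod_le _ _).trans ?_
      refine (Finset.sum_le_card_nsmul _ _ 1 fun b _ => ?_).trans ?_
      · exact (Polynomial.degree_mul_le _ _).trans
          ((add_le_add Polynomial.degree_C_le (Polynomial.degree_X_sub_C_le _)).trans (by simp))
      · simp [Finset.card_erase_of_mem]
    · rw [hn]
      exact_mod_cast Nat.sub_lt (NeZero.pos n) one_pos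
  · rw [hn]
    refine Polynomial.degree_one_le.trans_lt ?_
    exact_mod_cast NeZero.pos n
  · intro c _
    rw [Polynomial.eval_finsetSum, Polynomial.eval_one, Finset.sum_eq_single c]
    · rw [lagrangeBasis, Polynomial.eval_prod]
      refine Finset.prod_eq_one fun b hb => ?_
      simp [Ring.inverse_mul_cancel _ (hz c b (Finset.ne_of_mem_erase hb).symm)]
    · intro a _ hac
      rw [lagrangeBasis, Polynomial.eval_prod]
      exact Finset.prod_eq_zero (i := c) (by simp [hac.symm]) (by simp)
    · simp

theorem sub_mul_lagrangeBasis (z : Fin n → A) (a : Fin n) :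
    ∃ c : A, (X - C (z a)) * lagrangeBasis z a = C c * ∏ b, (X - C (z b)) := by
  refine ⟨∏ b ∈ Finset.univ.erase a, Ring.inverse (z a - z b), ?_⟩
  rw [lagrangeBasis, Finset.prod_mul_distrib, map_prod,
    ← Finset.mul_prod_erase Finset.univ _ (Finset.mem_univ a)]
  ring

/-- A polynomial that vanishes at all orderings of the sites vanishes at every root system of
`∏_a (U - z_a)`. -/
theorem aeval_eq_zero_of_prod_eq [IsDomain A] {z : Fin n → A} (hz : ∀ a b, a ≠ b → IsUnit (z a - z b))
    (hσ : Fintype.card σ = n) (g : σ → S)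
    (hg : ∏ s, (X - C (g s)) = ∏ a, (X - C (algebraMap A S (z a))))
    (F : MvPolynomial σ A)
    (hF : ∀ φ : σ → Fin n, Function.Bijective φ → MvPolynomial.aeval (z ∘ φ) F = 0) :
    MvPolynomial.aeval g F = 0 := by
  classical
  have hroot : ∀ s a, (g s - algebraMap A S (z a)) * aeval (g s) (lagrangeBasis z a) = 0 := by
    intro s a
    obtain ⟨c, hc⟩ := sub_mul_lagrangeBasis z a
    have h1 := congrArg (aeval (g s)) hc
    rw [map_mul, map_sub, aeval_X, aeval_C] at h1
    rw [h1, map_mul, map_prod]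
    have h2 := congrArg (Polynomial.eval (g s)) hg
    rw [Polynomial.eval_prod, Polynomial.eval_prod] at h2
    simp only [eval_sub, eval_X, eval_C] at h2
    simp only [map_sub, aeval_X, aeval_C]
    rw [← h2, Finset.prod_eq_zero (Finset.mem_univ s) (sub_self _), mul_zero]
  -- `E φ` projects to the part where each root `g s` equals `z_{φ s}`: multiplication by `E φ`
  -- replaces every root by its value.
  set E : (σ → Fin n) → S := fun φ => ∏ s, aeval (g s) (lagrangeBasis z (φ s)) with hE
  have hEg : ∀ φ s, E φ * g s = E φ * algebraMap A S (z (φ s)) := by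
    intro φ s
    have h1 := hroot s (φ s)
    rw [← sub_eq_zero, ← mul_sub, hE]
    simp only
    rw [← Finset.mul_prod_erase Finset.univ _ (Finset.mem_univ s)]
    linear_combination (∏ x ∈ Finset.univ.erase s, aeval (g x) (lagrangeBasis z (φ x))) * h1
  have hEF : ∀ φ (G : MvPolynomial σ A), E φ * MvPolynomial.aeval g G =
      E φ * algebraMap A S (MvPolynomial.aeval (z ∘ φ) G) := by
    intro φ G
    induction G using MvPolynomial.induction_on with
    | C a => simp
    | add p q hp hq => rw [map_add, map_add, map_add, mul_add, mul_add, hp, hq]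
    | mul_X p s hp =>
      rw [map_mul, map_mul, map_mul, MvPolynomial.aeval_X, MvPolynomial.aeval_X, ← mul_assoc, hp,
        mul_right_comm, hEg]
      simp only [Function.comp_apply]
      ring
  -- Expand the product over the roots `s` of the partitions of unity ∑_a ℓ_a(g_s) = 1.
  have hsum : ∑ φ : σ → Fin n, E φ = 1 := by
    have h := Finset.prod_univ_sum (fun _ : σ => (Finset.univ : Finset (Fin n)))
      fun s a => aeval (g s) (lagrangeBasis z a)
    rw [Fintype.piFinset_univ] at h
    rw [hE, ← h]
    refine Finset.prod_eq_one fun s _ => ?_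
    have : NeZero n := ⟨by rw [← hσ]; exact (Fintype.card_pos_iff.2 ⟨s⟩).ne'⟩
    rw [← map_sum, sum_lagrangeBasis hz, map_one]
  rw [← one_mul (MvPolynomial.aeval g F), ← hsum, Finset.sum_mul]
  refine Finset.sum_eq_zero fun φ _ => ?_
  rw [hEF]
  by_cases hφ : Function.Surjective φ
  · rw [hF φ ((Fintype.bijective_iff_surjective_and_card φ).2 ⟨hφ, by simp [hσ]⟩), map_zero,
      mul_zero]
  -- If `φ` misses `a`, then ∏_s (z_a - g_s) = 0 becomes, after multiplication by `E φ`, a unit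
  -- times `E φ`; so `E φ` vanishes.
  · obtain ⟨a, ha⟩ := not_forall.1 hφ
    have h1 : ∏ s, (algebraMap A S (z a) - g s) = 0 := by
      have h2 := congrArg (Polynomial.eval (algebraMap A S (z a))) hg
      rw [Polynomial.eval_prod, Polynomial.eval_prod] at h2
      simp only [eval_sub, eval_X, eval_C] at h2
      rw [h2, Finset.prod_eq_zero (Finset.mem_univ a) (sub_self _)]
    have h3 := hEF φ (∏ s, (MvPolynomial.C (z a) - MvPolynomial.X s))
    simp only [map_prod, map_sub, MvPolynomial.aeval_C, MvPolynomial.aeval_X] at h3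
    rw [h1, mul_zero] at h3
    have hu : IsUnit (algebraMap A S (∏ s, (z a - z (φ s)))) := by
      refine IsUnit.map _ ?_
      rw [IsUnit.prod_univ_iff]
      exact fun s => hz _ _ fun e => ha ⟨s, e.symm⟩
    have h4 : E φ = 0 := by
      have h5 : E φ * algebraMap A S (∏ s, (z a - z (φ s))) = 0 := by
        rw [h3, map_prod]
        simp only [map_sub, Algebra.algebraMap_self, RingHom.id_apply, Function.comp_apply]
      exact (hu.mul_left_eq_zero).1 h5
    rw [h4, zero_mul]

end LagrangeIdempotents

/-! ### Symmetrization -/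

section Reynolds

/-- Polynomials in the Chern roots over `𝓛_{λ,(z,y)}`. -/
abbrev RootRingL (n p q : ℕ) : Type := MvPolynomial (Fin p ⊕ Fin q) (CoeffRing n)

variable {n p q : ℕ}

/-- The average of a polynomial over `S_p × S_q`. -/
noncomputable def reynolds (n p q : ℕ) : RootRing n p q →ₗ[BaseRing n] invRing n p q where
  toFun g := ⟨(algebraMap ℂ (BaseRing n) ((p.factorial * q.factorial : ℕ) : ℂ)⁻¹) •
      ∑ x : Equiv.Perm (Fin p) × Equiv.Perm (Fin q),
        MvPolynomial.rename (Equiv.sumCongr x.1 x.2) g, by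
    intro σ τ
    rw [map_smul, map_sum]
    congr 1
    simp only [MvPolynomial.rename_rename]
    refine Fintype.sum_equiv (Equiv.prodCongr (Equiv.mulLeft σ) (Equiv.mulLeft τ)) _ _ fun x => ?_
    refine congrArg (fun e => MvPolynomial.rename e g) ?_
    funext s
    rcases s with s | s <;> rfl⟩
  map_add' g h := by
    ext1
    simp [Finset.sum_add_distrib, smul_add]
  map_smul' r g := by
    ext1
    simp only [map_smul, ← Finset.smul_sum, RingHom.id_apply]
    rw [smul_comm]
    rfl

/-- Linearity over the invariants is what lets averaging carry a combination of symmetric relations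
with arbitrary coefficients to one with symmetric coefficients. -/
theorem reynolds_coe_mul (x : invRing n p q) (g : RootRing n p q) :
    reynolds n p q (x * g) = x * reynolds n p q g := by
  ext1
  change _ • _ = (x : RootRing n p q) * (_ • _)
  rw [mul_smul_comm, Finset.mul_sum]
  congr 1
  refine Finset.sum_congr rfl fun y _ => ?_
  rw [map_mul, x.2]

theorem reynolds_one : reynolds n p q 1 = 1 := by
  ext1
  change _ • _ = (1 : RootRing n p q)
  simp only [map_one, Finset.sum_const, Finset.card_univ, Fintype.card_prod, Fintype.card_perm,
    Fintype.card_fin, Algebra.smul_def, mul_one]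
  rw [MvPolynomial.algebraMap_eq, eq_natCast (algebraMap ℕ _),
    ← map_natCast (MvPolynomial.C.comp (algebraMap ℂ (BaseRing n))),
    RingHom.comp_apply, ← map_mul, ← map_mul, inv_mul_cancel₀, map_one, map_one]
  exact_mod_cast (Nat.mul_pos p.factorial_pos q.factorial_pos).ne'

/-- The symmetrization of polynomials over `𝓛_{λ,(z,y)}`. -/
noncomputable def symmetrize (n p q : ℕ) :
    MvPolynomial (Fin p ⊕ Fin q) (CoeffRing n) →ₗ[CoeffRing n] InvL n p q :=
  (reynolds n p q).baseChange (CoeffRing n) ∘ₗ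
    (MvPolynomial.algebraTensorAlgEquiv (BaseRing n) (CoeffRing n)).symm.toLinearMap

theorem toPoly_tmul (a : CoeffRing n) (x : invRing n p q) :
    toPoly n p q (a ⊗ₜ x) =
      a • MvPolynomial.map (algebraMap (BaseRing n) (CoeffRing n)) (x : RootRing n p q) := by
  rw [toPoly, Algebra.TensorProduct.lift_tmul, Algebra.smul_def]
  congr 1
  change MvPolynomial.aeval MvPolynomial.X (x : RootRing n p q) = _
  induction (x : RootRing n p q) using MvPolynomial.induction_on with
  | C a => rw [MvPolynomial.aeval_C, MvPolynomial.map_C]; rfl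
  | add f g hf hg => rw [map_add, map_add, hf, hg]
  | mul_X f i hf => rw [map_mul, map_mul, hf, MvPolynomial.aeval_X, MvPolynomial.map_X]

theorem symmetrize_smul_map (a : CoeffRing n) (g : RootRing n p q) :
    symmetrize n p q (a • MvPolynomial.map (algebraMap (BaseRing n) (CoeffRing n)) g) =
      a ⊗ₜ reynolds n p q g := by
  rw [← MvPolynomial.algebraTensorAlgEquiv_tmul, symmetrize, LinearMap.comp_apply,
    AlgEquiv.toLinearMap_apply, AlgEquiv.symm_apply_apply, LinearMap.baseChange_tmul]

theorem exists_smul_map_induction {P : RootRingL n p q → Prop} (g : RootRingL n p q)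
    (h0 : ∀ (a : CoeffRing n) (g : RootRing n p q),
      P (a • MvPolynomial.map (algebraMap (BaseRing n) (CoeffRing n)) g))
    (h1 : ∀ g g', P g → P g' → P (g + g')) : P g := by
  obtain ⟨t, rfl⟩ := (MvPolynomial.algebraTensorAlgEquiv (BaseRing n) (CoeffRing n)).surjective g
  induction t using TensorProduct.induction_on with
  | zero => simpa using h0 0 0
  | tmul a g => simpa using h0 a g
  | add x y hx hy => simpa using h1 _ _ hx hy

theorem symmetrize_toPoly_mul (f : InvL n p q) (g : RootRingL n p q) :
    symmetrize n p q (toPoly n p q f * g) = f * symmetrize n p q g := by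
  induction f using TensorProduct.induction_on with
  | zero => simp
  | add x y hx hy => rw [map_add, add_mul, map_add, hx, hy, add_mul]
  | tmul a x =>
    induction g using exists_smul_map_induction with
    | h1 g g' hg hg' => rw [mul_add, map_add, map_add, hg, hg', mul_add]
    | h0 b g =>
      rw [toPoly_tmul, smul_mul_smul_comm, ← map_mul, symmetrize_smul_map, symmetrize_smul_map,
        reynolds_coe_mul, Algebra.TensorProduct.tmul_mul_tmul]

theorem symmetrize_toPoly (f : InvL n p q) : symmetrize n p q (toPoly n p q f) = f := by
  have h : symmetrize n p q 1 = 1 := by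
    have := symmetrize_smul_map (n := n) (p := p) (q := q) 1 1
    rw [map_one, one_smul, reynolds_one] at this
    exact this
  rw [← mul_one (toPoly n p q f), symmetrize_toPoly_mul, h, mul_one]

/-- Invariance under `S_p × S_q`. -/
def IsSymmetricIn (g : RootRingL n p q) : Prop :=
  ∀ (σ : Equiv.Perm (Fin p)) (τ : Equiv.Perm (Fin q)),
    MvPolynomial.rename (Equiv.sumCongr σ τ) g = g

theorem isSymmetricIn_toPoly (f : InvL n p q) : IsSymmetricIn (toPoly n p q f) := by
  intro σ τ
  induction f using TensorProduct.induction_on with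
  | zero => simp
  | add x y hx hy => rw [map_add, map_add, hx, hy]
  | tmul a x => rw [toPoly_tmul, map_smul, ← MvPolynomial.map_rename, x.2]

theorem toPoly_symmetrize_eq_sum (g : RootRingL n p q) : toPoly n p q (symmetrize n p q g) =
    (algebraMap (BaseRing n) (CoeffRing n)
      (algebraMap ℂ (BaseRing n) ((p.factorial * q.factorial : ℕ) : ℂ)⁻¹)) •
      ∑ x : Equiv.Perm (Fin p) × Equiv.Perm (Fin q),
        MvPolynomial.rename (Equiv.sumCongr x.1 x.2) g := by
  induction g using exists_smul_map_induction with
  | h1 g g' hg hg' => simp only [map_add, hg, hg', Finset.sum_add_distrib, smul_add]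
  | h0 b g =>
    rw [symmetrize_smul_map, toPoly_tmul]
    simp only [map_smul, ← Finset.smul_sum]
    rw [smul_comm]
    congr 1
    change MvPolynomial.map _ (_ • _) = _
    rw [MvPolynomial.smul_eq_C_mul, map_mul, MvPolynomial.map_C, map_sum,
      ← MvPolynomial.smul_eq_C_mul]
    simp only [MvPolynomial.map_rename]

/-- Shows that every symmetric polynomial over 𝓛 comes from ℂ[Γ,z,y]^{S_p × S_q} ⊗ 𝓛 and so has a
class. -/
theorem toPoly_symmetrize {g : RootRingL n p q} (hg : IsSymmetricIn g) :
    toPoly n p q (symmetrize n p q g) = g := by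
  rw [toPoly_symmetrize_eq_sum]
  -- The averaging formula at `1` says that the scalar times the number of permutations is one, so
  -- the constant need not be computed again.
  have h1 := toPoly_symmetrize_eq_sum (1 : RootRingL n p q)
  have h2 : toPoly n p q (symmetrize n p q 1) = 1 := by
    have : symmetrize n p q 1 = 1 := by
      have := symmetrize_toPoly (1 : InvL n p q)
      rwa [map_one] at this
    rw [this, map_one]
  rw [h2] at h1
  conv_rhs => rw [← mul_one g, h1, mul_smul_comm, Finset.mul_sum]
  refine congrArg _ (Finset.sum_congr rfl fun x _ => ?_)
  rw [hg, map_one, mul_one]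

end Reynolds

/-! ### Restriction to the fixed points -/

section FixedPoints

variable {n p q : ℕ}

/-- Two injective labelings with the same ranges on both blocks differ by block permutations. -/
theorem exists_sumCongr_of_range_eq {X : Type*} {g h : Fin p ⊕ Fin q → X}
    (hg : Function.Injective g) (hh : Function.Injective h)
    (h1 : Set.range (g ∘ Sum.inl) = Set.range (h ∘ Sum.inl))
    (h2 : Set.range (g ∘ Sum.inr) = Set.range (h ∘ Sum.inr)) :
    ∃ (σ : Equiv.Perm (Fin p)) (τ : Equiv.Perm (Fin q)), g = h ∘ Equiv.sumCongr σ τ := by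
  have key : ∀ {m : ℕ} {u v : Fin m → X}, Function.Injective u → Function.Injective v →
      Set.range u = Set.range v → ∃ σ : Equiv.Perm (Fin m), u = v ∘ σ := by
    intro m u v hu hv huv
    refine ⟨(Equiv.ofInjective u hu).trans
      ((Equiv.setCongr huv).trans (Equiv.ofInjective v hv).symm), funext fun i => ?_⟩
    have := Equiv.apply_ofInjective_symm hv (Equiv.setCongr huv (Equiv.ofInjective u hu i))
    exact this.symm
  obtain ⟨σ, hσ⟩ := key (hg.comp Sum.inl_injective) (hh.comp Sum.inl_injective) h1
  obtain ⟨τ, hτ⟩ := key (hg.comp Sum.inr_injective) (hh.comp Sum.inr_injective) h2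
  refine ⟨σ, τ, funext fun s => ?_⟩
  rcases s with s | s
  · exact congrFun hσ s
  · exact congrFun hτ s

/-- The labeling of the sites for which the first block is `J` and the second its complement. -/
def siteAt (J : Finset (Fin n)) (h1 : J.card = p) (h2 : Jᶜ.card = q) : Fin p ⊕ Fin q → Fin n :=
  Sum.elim (J.orderEmbOfFin h1) (Jᶜ.orderEmbOfFin h2)

theorem range_siteAt_inl (J : Finset (Fin n)) (h1 : J.card = p) (h2 : Jᶜ.card = q) :
    Set.range (siteAt J h1 h2 ∘ Sum.inl) = (J : Set (Fin n)) :=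
  Finset.range_orderEmbOfFin J h1

theorem range_siteAt_inr (J : Finset (Fin n)) (h1 : J.card = p) (h2 : Jᶜ.card = q) :
    Set.range (siteAt J h1 h2 ∘ Sum.inr) = (J : Set (Fin n))ᶜ := by
  rw [← Finset.coe_compl]
  exact Finset.range_orderEmbOfFin Jᶜ h2

theorem siteAt_injective (J : Finset (Fin n)) (h1 : J.card = p) (h2 : Jᶜ.card = q) :
    Function.Injective (siteAt J h1 h2) := by
  refine Function.Injective.sumElim (J.orderEmbOfFin h1).injective (Jᶜ.orderEmbOfFin h2).injective
    fun a b h => ?_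
  have := Finset.orderEmbOfFin_mem Jᶜ h2 b
  rw [← h] at this
  exact Finset.mem_compl.1 this (Finset.orderEmbOfFin_mem J h1 a)

/-- The value of a polynomial at the Chern roots of the fixed point `x_J`. -/
noncomputable def valueAt (J : Finset (Fin n)) (h1 : J.card = p) (h2 : Jᶜ.card = q) :
    RootRingL n p q →ₐ[CoeffRing n] CoeffRing n :=
  MvPolynomial.aeval fun s => zz (siteAt J h1 h2 s)

/-- A symmetric polynomial takes the same value on any labeling of the sites by blocks. -/
theorem aeval_eq_valueAt {F : RootRingL n p q} (hF : IsSymmetricIn F) (J : Finset (Fin n))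
    (h1 : J.card = p) (h2 : Jᶜ.card = q) {g : Fin p ⊕ Fin q → Fin n} (hg : Function.Injective g)
    (hl : Set.range (g ∘ Sum.inl) = (J : Set (Fin n)))
    (hr : Set.range (g ∘ Sum.inr) = (J : Set (Fin n))ᶜ) :
    MvPolynomial.aeval (fun s => zz (g s)) F = valueAt J h1 h2 F := by
  obtain ⟨σ, τ, e⟩ := exists_sumCongr_of_range_eq hg (siteAt_injective J h1 h2)
    (hl.trans (range_siteAt_inl J h1 h2).symm) (hr.trans (range_siteAt_inr J h1 h2).symm)
  conv_rhs => rw [← hF σ τ, valueAt, MvPolynomial.aeval_rename]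
  rw [e]
  rfl

theorem rename_eq_of_range_eq {X : Type*} {F : RootRingL n p q} (hF : IsSymmetricIn F)
    {g h : Fin p ⊕ Fin q → X} (hg : Function.Injective g) (hh : Function.Injective h)
    (h1 : Set.range (g ∘ Sum.inl) = Set.range (h ∘ Sum.inl))
    (h2 : Set.range (g ∘ Sum.inr) = Set.range (h ∘ Sum.inr)) :
    MvPolynomial.rename g F = MvPolynomial.rename h F := by
  obtain ⟨σ, τ, e⟩ := exists_sumCongr_of_range_eq hg hh h1 h2
  conv_rhs => rw [← hF σ τ, MvPolynomial.rename_rename]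
  rw [e]

theorem cohClass_mul (f g : InvL n p q) :
    cohClass n p q (f * g) = cohClass n p q f * cohClass n p q g := by
  induction f using TensorProduct.induction_on with
  | zero => simp
  | add x y hx hy => rw [add_mul, map_add, map_add, hx, hy, add_mul]
  | tmul a x =>
    induction g using TensorProduct.induction_on with
    | zero => simp
    | add x y hx hy => rw [mul_add, map_add, map_add, hx, hy, mul_add]
    | tmul b y =>
      simp only [cohClass, Algebra.TensorProduct.tmul_mul_tmul, LinearMap.baseChange_tmul,
        AlgHom.toLinearMap_apply, map_mul]

theorem cohClass_surjective (n p q : ℕ) : Function.Surjective (cohClass n p q) :=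
  LinearMap.lTensor_surjective _ Ideal.Quotient.mk_surjective

theorem Loc_inclCoh_of_card (h : p + q = n) (f : InvL n p q) (J : Finset (Fin n))
    (h1 : J.card = p) (h2 : Jᶜ.card = q) :
    Loc n (inclCoh n p q h (cohClass n p q f)) J = valueAt J h1 h2 (toPoly n p q f) := by
  subst h1 h2
  have e : Loc n (inclCoh n _ _ h (cohClass n _ _ f)) J =
      (Algebra.TensorProduct.rid (BaseRing n) (CoeffRing n) (CoeffRing n))
        ((cohAt J).toLinearMap.baseChange (CoeffRing n) (cohClass n _ _ f)) := by
    rw [Loc, LinearMap.pi_apply]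
    simp only [LinearMap.comp_apply, inclCoh, LinearMap.proj_apply, LinearMap.single_apply,
      Pi.single_eq_same, AlgEquiv.toLinearMap_apply]
  rw [e]
  induction f using TensorProduct.induction_on with
  | zero => simp
  | add x y hx hy =>
    rw [map_add, map_add, map_add, map_add, map_add, hx _, hy _]
    all_goals
      rw [Loc, LinearMap.pi_apply]
      simp only [LinearMap.comp_apply, inclCoh, LinearMap.proj_apply, LinearMap.single_apply,
        Pi.single_eq_same, AlgEquiv.toLinearMap_apply]
  | tmul a x =>
    rw [toPoly_tmul, map_smul, cohClass, LinearMap.baseChange_tmul, LinearMap.baseChange_tmul,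
      Algebra.TensorProduct.rid_tmul, valueAt, smul_eq_mul, Algebra.smul_def, mul_comm]
    congr 1
    have e2 : (cohAt J).toLinearMap ((cohMk n _ _).toLinearMap x) =
        MvPolynomial.aeval (rootsAt J) (x : RootRing n J.card Jᶜ.card) := rfl
    rw [e2]
    generalize (x : RootRing n J.card Jᶜ.card) = g
    induction g using MvPolynomial.induction_on with
    | C a => rw [MvPolynomial.map_C, MvPolynomial.aeval_C, MvPolynomial.aeval_C]; rfl
    | add f g hf hg => rw [map_add, map_add, map_add, map_add, hf, hg]
    | mul_X f i hf =>
      rw [map_mul, map_mul, map_mul, map_mul, hf, MvPolynomial.map_X, MvPolynomial.aeval_X,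
        MvPolynomial.aeval_X]
      congr 1
      rcases i with i | i <;> rfl

theorem Loc_inclCoh_of_card_ne (h : p + q = n) (x : CohL n p q) (J : Finset (Fin n))
    (h1 : J.card ≠ p) : Loc n (inclCoh n p q h x) J = 0 := by
  rw [Loc, LinearMap.pi_apply]
  simp only [LinearMap.comp_apply, inclCoh, LinearMap.proj_apply, LinearMap.single_apply]
  rw [Pi.single_eq_of_ne, map_zero, map_zero]
  intro e
  exact h1 (congrArg (fun c => c.1.1) e)

theorem card_compl_eq {J : Finset (Fin n)} (h : p + q = n) (h1 : J.card = p) : Jᶜ.card = q := by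
  rw [Finset.card_compl, Fintype.card_fin]
  omega

/-- The relations of `H*_T(T*Gr_p)` over `𝓛_{λ,(z,y)}`. -/
noncomputable def relIdealL (n p q : ℕ) : Ideal (RootRingL n p q) :=
  Ideal.span (Set.range fun m =>
    MvPolynomial.map (algebraMap (BaseRing n) (CoeffRing n)) ((relPoly n p q).coeff m))

theorem prod_roots_quotient (n p q : ℕ) :
    ∏ s : Fin p ⊕ Fin q, (Polynomial.X - Polynomial.C
      (Ideal.Quotient.mk (relIdealL n p q) (MvPolynomial.X s))) =
    ∏ a : Fin n, (Polynomial.X - Polynomial.C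
      (algebraMap (CoeffRing n) (RootRingL n p q ⧸ relIdealL n p q) (zz a))) := by
  rw [← sub_eq_zero, Fintype.prod_sum_type]
  have : (relPoly n p q).map ((Ideal.Quotient.mk (relIdealL n p q)).comp
      (MvPolynomial.map (algebraMap (BaseRing n) (CoeffRing n)))) = 0 := by
    ext m
    rw [Polynomial.coeff_map, RingHom.comp_apply, Polynomial.coeff_zero,
      Ideal.Quotient.eq_zero_iff_mem]
    exact Ideal.subset_span ⟨m, rfl⟩
  rw [← this, relPoly]
  simp only [Polynomial.map_sub, Polynomial.map_mul, Polynomial.map_prod, Polynomial.map_X,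
    Polynomial.map_C, RingHom.comp_apply, MvPolynomial.map_X, MvPolynomial.map_C]
  rfl

/-- In the quotient the Chern roots have the same characteristic polynomial as the z_a, so it
suffices to test bijective substitutions. By symmetry such a substitution depends only on the set
assigned to the first block, that is, on a fixed point. -/
theorem mem_relIdealL {F : RootRingL n p q} (h : p + q = n) (hF : IsSymmetricIn F)
    (h0 : ∀ (J : Finset (Fin n)) (h1 : J.card = p) (h2 : Jᶜ.card = q), valueAt J h1 h2 F = 0) :
    F ∈ relIdealL n p q := by
  have h3 := aeval_eq_zero_of_prod_eq (z := fun a : Fin n => zz a) (fun a b => isUnit_zz_sub)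
    (by simpa using h) _ (prod_roots_quotient n p q) F (fun φ hφ => by
      have hl := hφ.1.comp (Sum.inl_injective (α := Fin p) (β := Fin q))
      have h1 : (Finset.univ.map ⟨_, hl⟩).card = p := by simp
      have e : ((Finset.univ.map ⟨_, hl⟩ : Finset (Fin n)) : Set (Fin n)) =
          Set.range (φ ∘ Sum.inl) := by
        rw [Finset.coe_map, Finset.coe_univ, Set.image_univ]
        rfl
      refine (aeval_eq_valueAt hF _ h1 (card_compl_eq h h1) hφ.1 e.symm ?_).trans (h0 _ _ _)
      rw [e]
      ext x
      obtain ⟨s, rfl⟩ := hφ.2 x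
      rcases s with s | s <;> simp [hφ.1.eq_iff])
  rw [← Ideal.Quotient.eq_zero_iff_mem, ← h3]
  have : (MvPolynomial.aeval fun s => Ideal.Quotient.mk (relIdealL n p q) (MvPolynomial.X s)) =
      Ideal.Quotient.mkₐ (CoeffRing n) (relIdealL n p q) := by
    ext s
    simp
  rw [this]
  rfl

theorem coeff_relPoly_mem (m : ℕ) : (relPoly n p q).coeff m ∈ invRing n p q := by
  intro σ τ
  have : (relPoly n p q).map (MvPolynomial.rename (R := BaseRing n)
      (Equiv.sumCongr σ τ)).toRingHom = relPoly n p q := by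
    simp only [relPoly, Polynomial.map_sub, Polynomial.map_mul, Polynomial.map_prod,
      Polynomial.map_X, Polynomial.map_C]
    simp only [AlgHom.toRingHom_eq_coe, RingHom.coe_coe, MvPolynomial.rename_X,
      MvPolynomial.rename_C, Equiv.sumCongr_apply, Sum.map_inl, Sum.map_inr]
    rw [Equiv.prod_comp σ fun i => Polynomial.X - Polynomial.C (MvPolynomial.X (Sum.inl i)),
      Equiv.prod_comp τ fun i => Polynomial.X - Polynomial.C (MvPolynomial.X (Sum.inr i))]
  conv_rhs => rw [← this]
  rw [Polynomial.coeff_map]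
  rfl

/-- The cohomology is a quotient of the invariant ring, whereas membership was found in the ideal
generated in the full polynomial ring. Averaging bridges the two, the generators being symmetric. -/
theorem cohClass_eq_zero {f : InvL n p q} (h : toPoly n p q f ∈ relIdealL n p q) :
    cohClass n p q f = 0 := by
  rw [← symmetrize_toPoly f]
  generalize toPoly n p q f = F at h
  rw [← one_mul F]
  -- An arbitrary cofactor `b` is needed for the induction over the span to pass through
  -- multiplication by non-symmetric polynomials.
  generalize (1 : RootRingL n p q) = b
  refine Submodule.span_induction
    (p := fun F _ => ∀ b, cohClass n p q (symmetrize n p q (b * F)) = 0) ?_ (by simp)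
    (fun x y _ _ hx hy b => by rw [mul_add, map_add, map_add, hx, hy, add_zero])
    (fun a x _ hx b => by rw [smul_eq_mul, ← mul_assoc, hx]) h b
  rintro _ ⟨m, rfl⟩ b
  have e : MvPolynomial.map (algebraMap (BaseRing n) (CoeffRing n)) ((relPoly n p q).coeff m) =
      toPoly n p q (1 ⊗ₜ ⟨_, coeff_relPoly_mem m⟩) := by
    rw [toPoly_tmul, one_smul]
  have h0 : (cohMk n p q) ⟨_, coeff_relPoly_mem m⟩ = 0 :=
    Ideal.Quotient.eq_zero_iff_mem.2 (Ideal.subset_span ⟨m, rfl⟩)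
  simp only
  rw [e, mul_comm b, symmetrize_toPoly_mul, cohClass_mul, cohClass, LinearMap.baseChange_tmul,
    AlgHom.toLinearMap_apply, h0, TensorProduct.tmul_zero, zero_mul]

theorem Loc_apply_eq (x : TotalCoh n) (h : p + q = n) (J : Finset (Fin n)) (h1 : J.card = p) :
    Loc n x J = Loc n (inclCoh n p q h (x ⟨(p, q), h⟩)) J := by
  obtain rfl := card_compl_eq h h1
  subst h1
  rw [Loc, LinearMap.pi_apply, LinearMap.pi_apply]
  simp only [LinearMap.comp_apply, inclCoh, LinearMap.proj_apply, LinearMap.single_apply,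
    Pi.single_eq_same]

theorem Loc_injective (n : ℕ) : Function.Injective (Loc n) := by
  rw [injective_iff_map_eq_zero]
  intro x hx
  funext ⟨⟨p, q⟩, h⟩
  obtain ⟨f, hf⟩ := cohClass_surjective n p q (x ⟨(p, q), h⟩)
  rw [← hf]
  refine cohClass_eq_zero (mem_relIdealL h (isSymmetricIn_toPoly f) fun J h1 h2 => ?_)
  rw [← Loc_inclCoh_of_card h f J h1 h2, hf, ← Loc_apply_eq x h J h1, hx]
  rfl

/-- The class ∏_i ∏_{a ∉ K} (γ_{1,i} - z_a) vanishes at `x_J` whenever `J` contains a site outside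
`K`. Among sets of the same size this excludes only `J = K`, where the value is a product of units.
-/
theorem exists_Loc_eq_single (K : Finset (Fin n)) :
    ∃ (x : TotalCoh n) (u : CoeffRing n), IsUnit u ∧ Loc n x = Pi.single K u := by
  set F : RootRingL n K.card Kᶜ.card :=
    ∏ i, ∏ a ∈ Kᶜ, (MvPolynomial.X (Sum.inl i) - MvPolynomial.C (zz a)) with hF
  have hs : IsSymmetricIn F := by
    intro σ τ
    simp only [hF, map_prod, map_sub, MvPolynomial.rename_X, MvPolynomial.rename_C,
      Equiv.sumCongr_apply, Sum.map_inl]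
    exact Equiv.prod_comp σ fun i => ∏ a ∈ Kᶜ, (MvPolynomial.X (Sum.inl i) - MvPolynomial.C (zz a))
  have hv : ∀ (J : Finset (Fin n)) (h1 : J.card = K.card) (h2 : Jᶜ.card = Kᶜ.card),
      valueAt J h1 h2 F = ∏ j ∈ J, ∏ a ∈ Kᶜ, (zz j - zz a) := by
    intro J h1 h2
    simp only [hF, map_prod, map_sub, valueAt, MvPolynomial.aeval_X, MvPolynomial.aeval_C,
      Algebra.algebraMap_self, RingHom.id_apply, siteAt, Sum.elim_inl]
    exact prod_orderEmbOfFin h1 fun j => ∏ a ∈ Kᶜ, (zz j - zz a)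
  have h : K.card + Kᶜ.card = n := by simp [Finset.card_add_card_compl]
  refine ⟨inclCoh n _ _ h (cohClass n _ _ (symmetrize n _ _ F)), ∏ j ∈ K, ∏ a ∈ Kᶜ, (zz j - zz a),
    ?_, funext fun J => ?_⟩
  · rw [IsUnit.prod_iff]
    refine fun j hj => IsUnit.prod_iff.2 fun a ha => isUnit_zz_sub ?_
    rintro rfl
    exact Finset.mem_compl.1 ha hj
  · by_cases h1 : J.card = K.card
    · have h2 := card_compl_eq h h1
      rw [Loc_inclCoh_of_card h _ J h1 h2, toPoly_symmetrize hs, hv]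
      by_cases hJ : J = K
      · rw [hJ, Pi.single_eq_same]
      · rw [Pi.single_eq_of_ne hJ]
        obtain ⟨a, haJ, haK⟩ : ∃ a ∈ J, a ∉ K := by
          by_contra! hcon
          exact hJ (Finset.eq_of_subset_of_card_le hcon h1.ge)
        exact Finset.prod_eq_zero haJ (Finset.prod_eq_zero (Finset.mem_compl.2 haK) (sub_self _))
    · rw [Loc_inclCoh_of_card_ne h _ J h1, Pi.single_eq_of_ne]
      rintro rfl
      exact h1 rfl

theorem Loc_surjective (n : ℕ) : Function.Surjective (Loc n) := by
  choose x u hu hx using exists_Loc_eq_single (n := n)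
  intro X
  refine ⟨∑ K, (X K * Ring.inverse (u K)) • x K, ?_⟩
  rw [map_sum]
  funext J
  rw [Finset.sum_apply, Finset.sum_eq_single J]
  · rw [map_smul, hx, Pi.smul_apply, Pi.single_eq_same, smul_eq_mul,
      Ring.inverse_mul_cancel_right _ _ (hu J)]
  · intro K _ hK
    rw [map_smul, hx, Pi.smul_apply, Pi.single_eq_of_ne hK.symm, smul_zero]
  · simp

theorem Loc_bijective (n : ℕ) : Function.Bijective (Loc n) := ⟨Loc_injective n, Loc_surjective n⟩

/-- `kappa` is chosen by `Function.invFun`, which is meaningful only on the range; surjectivity of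
`Loc` guarantees a genuine preimage. -/
theorem Loc_kappa (I : Finset (Fin n)) : Loc n (kappa I) = kappaRestriction I :=
  Function.rightInverse_invFun (Loc_surjective n) _

theorem Loc_stab (ζ : TensorSpace n) : Loc n (stab n ζ) = (kappaMatrix n).mulVec ζ := by
  rw [stab, Fintype.linearCombination_apply, map_sum]
  funext J
  rw [Finset.sum_apply, Matrix.mulVec, dotProduct]
  refine Finset.sum_congr rfl fun I _ => ?_
  rw [map_smul, Loc_kappa, Pi.smul_apply, smul_eq_mul, mul_comm]
  rfl

theorem bijective_mulVec_kappaMatrix (n : ℕ) : Function.Bijective (kappaMatrix n).mulVec := by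
  have h := isUnit_det_kappaMatrix (n := n)
  refine ⟨Matrix.mulVec_injective_of_isUnit ((Matrix.isUnit_iff_isUnit_det _).2 h), fun X =>
    ⟨(kappaMatrix n)⁻¹.mulVec X, ?_⟩⟩
  rw [Matrix.mulVec_mulVec, Matrix.mul_nonsing_inv _ h, Matrix.one_mulVec]

theorem stab_bijective (n : ℕ) : Function.Bijective (stab n) := by
  have h : Loc n ∘ stab n = (kappaMatrix n).mulVec := funext Loc_stab
  exact (Loc_bijective n).of_comp_iff' _ |>.1 (h ▸ bijective_mulVec_kappaMatrix n)

end FixedPoints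

/-! ### Divided differences -/

section DividedDifferences

variable {R K ι : Type*} [CommRing R] [Field K] [Algebra R K] [IsFractionRing R K]
  [DecidableEq ι]

/-- The divided difference `∑_{i ∈ s} N_i / ∏_{j ∈ s, j ≠ i} (x_i - x_j)`. -/
noncomputable def divDiff (K : Type*) [Field K] [Algebra R K] (x N : ι → R) (s : Finset ι) : K :=
  ∑ i ∈ s, algebraMap R K (N i) / ∏ j ∈ s.erase i, (algebraMap R K (x i) - algebraMap R K (x j))

/-- Newton's recursion, from the partial fraction (x_a - x_b)/((x_i - x_a)(x_i - x_b)) = 1/(x_i -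
x_a) - 1/(x_i - x_b). -/
theorem divDiff_insert_insert {x : ι → R} (hx : Function.Injective x) (N : ι → R) {a b : ι}
    {t : Finset ι} (hab : a ≠ b) (ha : a ∉ t) (hb : b ∉ t) :
    divDiff K x N (insert a (insert b t)) * (algebraMap R K (x a) - algebraMap R K (x b)) =
      divDiff K x N (insert a t) - divDiff K x N (insert b t) := by
  have hne : ∀ {i j : ι}, i ≠ j → algebraMap R K (x i) - algebraMap R K (x j) ≠ 0 := fun h =>
    sub_ne_zero.2 fun e => h (hx (IsFractionRing.injective R K e))
  have h1 : a ∉ insert b t := by simp [hab, ha]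
  have p1 : ∏ j ∈ (insert a (insert b t)).erase a,
      (algebraMap R K (x a) - algebraMap R K (x j)) =
      (algebraMap R K (x a) - algebraMap R K (x b)) *
        ∏ j ∈ (insert a t).erase a, (algebraMap R K (x a) - algebraMap R K (x j)) := by
    rw [Finset.erase_insert h1, Finset.erase_insert ha, Finset.prod_insert hb]
  have p2 : ∏ j ∈ (insert a (insert b t)).erase b,
      (algebraMap R K (x b) - algebraMap R K (x j)) =
      (algebraMap R K (x b) - algebraMap R K (x a)) *
        ∏ j ∈ (insert b t).erase b, (algebraMap R K (x b) - algebraMap R K (x j)) := by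
    rw [Finset.erase_insert_of_ne hab, Finset.erase_insert hb, Finset.prod_insert ha]
  have p3 : ∀ i ∈ t, ∏ j ∈ (insert a (insert b t)).erase i,
      (algebraMap R K (x i) - algebraMap R K (x j)) =
      (algebraMap R K (x i) - algebraMap R K (x a)) *
        ((algebraMap R K (x i) - algebraMap R K (x b)) *
        ∏ j ∈ t.erase i, (algebraMap R K (x i) - algebraMap R K (x j))) := by
    intro i hi
    rw [Finset.erase_insert_of_ne fun e : a = i => ha (e ▸ hi),
      Finset.erase_insert_of_ne fun e : b = i => hb (e ▸ hi),
      Finset.prod_insert (by simp [hab, ha]), Finset.prod_insert (by simp [hb])]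
  have p4 : ∀ c, c ∉ t → ∀ i ∈ t, ∏ j ∈ (insert c t).erase i,
      (algebraMap R K (x i) - algebraMap R K (x j)) =
      (algebraMap R K (x i) - algebraMap R K (x c)) *
        ∏ j ∈ t.erase i, (algebraMap R K (x i) - algebraMap R K (x j)) := by
    intro c hc i hi
    rw [Finset.erase_insert_of_ne fun e : c = i => hc (e ▸ hi), Finset.prod_insert (by simp [hc])]
  have q : ∀ i (u : Finset ι), ∏ j ∈ u.erase i,
      (algebraMap R K (x i) - algebraMap R K (x j)) ≠ 0 := fun i u =>
    Finset.prod_ne_zero_iff.2 fun j hj => hne (Finset.ne_of_mem_erase hj).symm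
  have n1 := hne hab
  have n2 := hne hab.symm
  have qa := q a (insert a t)
  have qb := q b (insert b t)
  rw [divDiff, divDiff, divDiff, Finset.sum_insert h1, Finset.sum_insert hb,
    Finset.sum_insert ha, Finset.sum_insert hb, p1, p2]
  have hsum : (∑ i ∈ t, algebraMap R K (N i) / ∏ j ∈ (insert a (insert b t)).erase i,
        (algebraMap R K (x i) - algebraMap R K (x j))) *
        (algebraMap R K (x a) - algebraMap R K (x b)) =
      (∑ i ∈ t, algebraMap R K (N i) / ∏ j ∈ (insert a t).erase i,
        (algebraMap R K (x i) - algebraMap R K (x j))) -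
      ∑ i ∈ t, algebraMap R K (N i) / ∏ j ∈ (insert b t).erase i,
        (algebraMap R K (x i) - algebraMap R K (x j)) := by
    rw [Finset.sum_mul, ← Finset.sum_sub_distrib]
    refine Finset.sum_congr rfl fun i hi => ?_
    rw [p3 i hi, p4 a ha i hi, p4 b hb i hi]
    have n3 := hne (i := i) (j := a) fun e => ha (e ▸ hi)
    have n4 := hne (i := i) (j := b) fun e => hb (e ▸ hi)
    have n5 := q i t
    field_simp
    ring
  rw [add_mul, add_mul, hsum]
  field_simp
  ring

theorem map_divDiff (θ : R ≃+* R) (π : Equiv.Perm ι) {x N : ι → R}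
    (hx : ∀ i, θ (x i) = x (π i)) (hN : ∀ i, θ (N i) = N (π i)) (s : Finset ι) :
    IsFractionRing.ringEquivOfRingEquiv (K := K) (L := K) θ (divDiff K x N s) =
      divDiff K x N (s.map π.toEmbedding) := by
  rw [divDiff, divDiff, map_sum, Finset.sum_map]
  refine Finset.sum_congr rfl fun i _ => ?_
  rw [map_div₀, map_prod, IsFractionRing.ringEquivOfRingEquiv_algebraMap, hN]
  congr 1
  have : (s.map π.toEmbedding).erase (π.toEmbedding i) = (s.erase i).map π.toEmbedding := by
    rw [Finset.map_erase]
  rw [this, Finset.prod_map]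
  refine Finset.prod_congr rfl fun j _ => ?_
  rw [map_sub, IsFractionRing.ringEquivOfRingEquiv_algebraMap,
    IsFractionRing.ringEquivOfRingEquiv_algebraMap, hx, hx]
  rfl

/-- Divided differences of a symmetric family of ring elements stay in the ring. -/
theorem exists_algebraMap_eq_divDiff [IsDomain R] {x N : ι → R} (hinj : Function.Injective x)
    (hswap : ∀ a b, a ≠ b → ∃ θ : R ≃+* R, (∀ i, θ (x i) = x (Equiv.swap a b i)) ∧
      (∀ i, θ (N i) = N (Equiv.swap a b i)) ∧ ∀ r, x a - x b ∣ r - θ r) (s : Finset ι) :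
    ∃ P : R, algebraMap R K P = divDiff K x N s := by
  induction hk : s.card using Nat.strong_induction_on generalizing s with
  | _ k ih =>
    rcases s.eq_empty_or_nonempty with rfl | ⟨a, ha⟩
    · exact ⟨0, by simp [divDiff]⟩
    obtain ⟨s', ha', rfl⟩ : ∃ s', a ∉ s' ∧ insert a s' = s :=
      ⟨s.erase a, Finset.notMem_erase a s, Finset.insert_erase ha⟩
    rcases s'.eq_empty_or_nonempty with rfl | ⟨b, hb⟩
    · exact ⟨N a, by simp [divDiff]⟩
    obtain ⟨t, hb', rfl⟩ : ∃ t, b ∉ t ∧ insert b t = s' :=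
      ⟨s'.erase b, Finset.notMem_erase b s', Finset.insert_erase hb⟩
    obtain ⟨hab, hat⟩ : a ≠ b ∧ a ∉ t := by simpa using ha'
    have hc : k = t.card + 2 := by
      rw [← hk, Finset.card_insert_of_notMem ha', Finset.card_insert_of_notMem hb']
    obtain ⟨P1, h1⟩ := ih (t.card + 1) (by omega) (insert a t)
      (Finset.card_insert_of_notMem hat)
    obtain ⟨P2, h2⟩ := ih (t.card + 1) (by omega) (insert b t)
      (Finset.card_insert_of_notMem hb')
    obtain ⟨θ, hx, hN, hdvd⟩ := hswap a b hab
    -- The transposition exchanges the two smaller divided differences, so their difference is `P1 -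
    -- θ P1`, which `x_a - x_b` divides. With Newton's recursion this gives the quotient in the
    -- ring.
    have h3 := map_divDiff (K := K) θ (Equiv.swap a b) hx hN (insert a t)
    have e : (insert a t).map (Equiv.swap a b).toEmbedding = insert b t := by
      rw [Finset.map_insert]
      congr 1
      · simp
      · have : ∀ i ∈ t, Equiv.swap a b i = i := fun i hi =>
          Equiv.swap_apply_of_ne_of_ne (fun e => hat (e ▸ hi)) fun e => hb' (e ▸ hi)
        ext i
        simp only [Finset.mem_map, Equiv.coe_toEmbedding]
        constructor
        · rintro ⟨j, hj, rfl⟩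
          rwa [this j hj]
        · exact fun hi => ⟨i, hi, this i hi⟩
    rw [e, ← h1, ← h2, IsFractionRing.ringEquivOfRingEquiv_algebraMap] at h3
    obtain ⟨P, hP⟩ := hdvd P1
    refine ⟨P, ?_⟩
    have h4 := divDiff_insert_insert (K := K) hinj N hab hat hb'
    have hne : algebraMap R K (x a) - algebraMap R K (x b) ≠ 0 :=
      sub_ne_zero.2 fun e => hab (hinj (IsFractionRing.injective R K e))
    refine mul_right_cancel₀ hne ?_
    rw [h4, ← h1, ← h2, ← h3, ← map_sub, ← map_mul, ← map_sub, hP, mul_comm]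

/-- The sum of fractions may be evaluated term by term at a point where the nodes remain distinct up
to units: clear denominators in the ring, evaluate, and divide by a unit. -/
theorem map_eq_of_algebraMap_eq_divDiff [IsDomain R] {A : Type*} [CommRing A] {x N : ι → R}
    (hinj : Function.Injective x) (s : Finset ι) {P : R} (hP : algebraMap R K P = divDiff K x N s)
    (ev : R →+* A) (hev : ∀ i j, i ≠ j → IsUnit (ev (x i) - ev (x j))) :
    ev P = ∑ i ∈ s, ev (N i) * ∏ j ∈ s.erase i, Ring.inverse (ev (x i) - ev (x j)) := by
  set D : ι → R := fun i => ∏ j ∈ s.erase i, (x i - x j) with hD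
  have hD0 : ∀ i, algebraMap R K (D i) ≠ 0 := fun i => by
    rw [Ne, FaithfulSMul.algebraMap_eq_zero_iff, ← Ne]
    exact Finset.prod_ne_zero_iff.2 fun j hj =>
      sub_ne_zero.2 fun e => Finset.ne_of_mem_erase hj (hinj e).symm
  have hu : ∀ i, IsUnit (ev (D i)) := fun i => by
    rw [hD, map_prod]
    refine IsUnit.prod_iff.2 fun j hj => ?_
    rw [map_sub]
    exact hev i j (Finset.ne_of_mem_erase hj).symm
  have h1 : P * ∏ i ∈ s, D i = ∑ i ∈ s, N i * ∏ k ∈ s.erase i, D k := by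
    apply IsFractionRing.injective R K
    rw [map_mul, hP, divDiff, map_sum, Finset.sum_mul]
    refine Finset.sum_congr rfl fun i hi => ?_
    rw [map_mul, ← Finset.mul_prod_erase s D hi, map_mul, ← mul_assoc]
    congr 1
    have : ∏ j ∈ s.erase i, (algebraMap R K (x i) - algebraMap R K (x j)) =
        algebraMap R K (D i) := by
      rw [hD, map_prod]
      simp only [map_sub]
    rw [this, div_mul_cancel₀ _ (hD0 i)]
  have h2 := congrArg ev h1
  rw [map_mul, map_sum] at h2
  have hU : IsUnit (ev (∏ i ∈ s, D i)) := by
    rw [map_prod]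
    exact IsUnit.prod_iff.2 fun i _ => hu i
  refine hU.mul_right_cancel (h2.trans ?_)
  rw [Finset.sum_mul]
  refine Finset.sum_congr rfl fun i hi => ?_
  have : (∏ j ∈ s.erase i, Ring.inverse (ev (x i) - ev (x j))) * ev (D i) = 1 := by
    rw [hD, map_prod, ← Finset.prod_mul_distrib]
    refine Finset.prod_eq_one fun j hj => ?_
    rw [map_sub, Ring.inverse_mul_cancel _ (hev i j (Finset.ne_of_mem_erase hj).symm)]
  rw [← Finset.mul_prod_erase s D hi, map_mul, map_mul]
  linear_combination (-ev (N i) * ev (∏ k ∈ s.erase i, D k)) * this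

end DividedDifferences

section SwapDivides

variable {n : ℕ} {σ A : Type*} [CommRing A] [DecidableEq σ]

/-- Modulo `X_a - X_b` the two variables coincide and the transposition acts trivially. -/
theorem X_sub_X_dvd_sub_rename_swap (a b : σ) (r : MvPolynomial σ A) :
    (MvPolynomial.X a - MvPolynomial.X b : MvPolynomial σ A) ∣
      r - MvPolynomial.rename (Equiv.swap a b) r := by
  rw [← Ideal.mem_span_singleton, ← Ideal.Quotient.eq]
  set I : Ideal (MvPolynomial σ A) := Ideal.span {MvPolynomial.X a - MvPolynomial.X b}
  have hab : Ideal.Quotient.mk I (MvPolynomial.X a) = Ideal.Quotient.mk I (MvPolynomial.X b) :=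
    Ideal.Quotient.eq.2 (Ideal.mem_span_singleton_self _)
  have : Ideal.Quotient.mkₐ A I =
      (Ideal.Quotient.mkₐ A I).comp (MvPolynomial.rename (Equiv.swap a b)) := by
    refine MvPolynomial.algHom_ext fun i => ?_
    rw [AlgHom.comp_apply, MvPolynomial.rename_X]
    change Ideal.Quotient.mk I _ = Ideal.Quotient.mk I _
    by_cases hia : i = a
    · rw [hia, Equiv.swap_apply_left, hab]
    · by_cases hib : i = b
      · rw [hib, Equiv.swap_apply_right, hab]
      · rw [Equiv.swap_apply_of_ne_of_ne hia hib]
  exact DFunLike.congr_fun this r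

end SwapDivides

/-! ### Coefficients of the explicit formulas -/

section ExplicitFormulas

variable {n p q : ℕ}

/-- The coefficients of `e + c ∑_{s ≥ 1} x^{s-1} w^{-s}`. -/
def lineCoeff {R : Type*} [CommRing R] (e c x : R) : ℕ → R
  | 0 => e
  | s + 1 => c * x ^ s

theorem map_lineCoeff {R S : Type*} [CommRing R] [CommRing S] (f : R →+* S) (e c x : R) (s : ℕ) :
    f (lineCoeff e c x s) = lineCoeff (f e) (f c) (f x) s := by
  cases s <;> simp [lineCoeff]

theorem coeff_line {R : Type} [CommRing R] (e c x : R) (s : ℕ) :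
    PowerSeries.coeff s (PowerSeries.C e + PowerSeries.C c * PowerSeries.X * geomSeries x) =
      lineCoeff e c x s := by
  cases s with
  | zero => simp [lineCoeff]
  | succ s =>
    rw [mul_assoc, map_add, PowerSeries.coeff_C_mul, PowerSeries.coeff_succ_X_mul]
    simp [lineCoeff, geomSeries]

/-- Applied with e = 1 for F̃ and e = -1 for Ẽ: in both formulas the factor linear in w, divided by
w minus a root, is a constant plus a geometric series. -/
theorem div_wVar_sub {K : Type} [Field K] (e c x : K) :
    (HahnSeries.C e * (wVar K - HahnSeries.C x) + HahnSeries.C c) / (wVar K - HahnSeries.C x) =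
      HahnSeries.ofPowerSeries ℤ K
        (PowerSeries.C e + PowerSeries.C c * PowerSeries.X * geomSeries x) := by
  have h1 := eq_inv_of_mul_eq_one_right (wVar_sub_mul x)
  rw [map_add, mul_assoc, map_mul, map_mul, HahnSeries.ofPowerSeries_C, HahnSeries.ofPowerSeries_C,
    HahnSeries.ofPowerSeries_X, h1, add_div, mul_div_cancel_right₀ _ (wVar_sub_ne_zero x),
    div_eq_mul_inv]

theorem sum_mul_div_wVar_sub {K ι : Type} [Field K] [Fintype ι] (k x : ι → K) (e c : K) :
    ∑ i, HahnSeries.C (k i) *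
      ((HahnSeries.C e * (wVar K - HahnSeries.C (x i)) + HahnSeries.C c) /
        (wVar K - HahnSeries.C (x i))) =
      HahnSeries.ofPowerSeries ℤ K
        (PowerSeries.mk fun s => ∑ i, k i * lineCoeff e c (x i) s) := by
  have h : (PowerSeries.mk fun s => ∑ i, k i * lineCoeff e c (x i) s) =
      ∑ i, PowerSeries.C (k i) *
        (PowerSeries.C e + PowerSeries.C c * PowerSeries.X * geomSeries (x i)) := by
    ext s
    rw [PowerSeries.coeff_mk, map_sum]
    simp only [PowerSeries.coeff_C_mul, coeff_line]
  rw [h, map_sum]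
  refine Finset.sum_congr rfl fun i _ => ?_
  rw [div_wVar_sub, map_mul, HahnSeries.ofPowerSeries_C]

/-! #### The substitutions of Chern roots -/

theorem range_rootsF_inl (i : Fin (q + 1)) :
    Set.range (rootsF (p := p) i ∘ Sum.inl) = insert (Sum.inr i) (Set.range Sum.inl) := by
  ext x
  constructor
  · rintro ⟨j, rfl⟩
    induction j using Fin.lastCases with
    | last => left; simp [rootsF]
    | cast j => right; simp [rootsF]
  · rintro (rfl | ⟨j, rfl⟩)
    · exact ⟨Fin.last p, by simp [rootsF]⟩
    · exact ⟨j.castSucc, by simp [rootsF]⟩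

theorem range_rootsF_inr (i : Fin (q + 1)) :
    Set.range (rootsF (p := p) i ∘ Sum.inr) = Sum.inr '' {i}ᶜ := by
  rw [← Fin.range_succAbove i, ← Set.range_comp]
  rfl

theorem range_rootsE_inl (i : Fin (p + 1)) :
    Set.range (rootsE (q := q) i ∘ Sum.inl) = Sum.inl '' {i}ᶜ := by
  rw [← Fin.range_succAbove i, ← Set.range_comp]
  rfl

theorem range_rootsE_inr (i : Fin (p + 1)) :
    Set.range (rootsE (q := q) i ∘ Sum.inr) = insert (Sum.inl i) (Set.range Sum.inr) := by
  ext x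
  constructor
  · rintro ⟨j, rfl⟩
    induction j using Fin.cases with
    | zero => left; simp [rootsE]
    | succ j => right; simp [rootsE]
  · rintro (rfl | ⟨j, rfl⟩)
    · exact ⟨0, by simp [rootsE]⟩
    · exact ⟨j.succ, by simp [rootsE]⟩

theorem rootsF_injective (i : Fin (q + 1)) : Function.Injective (rootsF (p := p) i) := by
  refine ((Fintype.bijective_iff_surjective_and_card _).2 ⟨fun x => ?_, by simp; ring⟩).1
  have h : x ∈ Set.range (rootsF (p := p) i ∘ Sum.inl) ∪ Set.range (rootsF i ∘ Sum.inr) := by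
    rw [range_rootsF_inl, range_rootsF_inr]
    rcases x with x | x
    · simp
    · by_cases hx : x = i <;> simp [hx]
  rcases h with ⟨j, rfl⟩ | ⟨j, rfl⟩ <;> exact ⟨_, rfl⟩

theorem rootsE_injective (i : Fin (p + 1)) : Function.Injective (rootsE (q := q) i) := by
  refine ((Fintype.bijective_iff_surjective_and_card _).2 ⟨fun x => ?_, by simp; ring⟩).1
  have h : x ∈ Set.range (rootsE (q := q) i ∘ Sum.inl) ∪ Set.range (rootsE i ∘ Sum.inr) := by
    rw [range_rootsE_inl, range_rootsE_inr]
    rcases x with x | x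
    · by_cases hx : x = i <;> simp [hx]
    · simp
  rcases h with ⟨j, rfl⟩ | ⟨j, rfl⟩ <;> exact ⟨_, rfl⟩

/-- By symmetry of `F` only the two blocks of roots matter, not their order, so permuting the target
roots just moves the distinguished index `i`. -/
theorem rename_rename_rootsF {F : RootRingL n (p + 1) q} (hF : IsSymmetricIn F)
    (σ : Equiv.Perm (Fin p)) (τ : Equiv.Perm (Fin (q + 1))) (i : Fin (q + 1)) :
    MvPolynomial.rename (Equiv.sumCongr σ τ) (MvPolynomial.rename (rootsF i) F) =
      MvPolynomial.rename (rootsF (τ i)) F := by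
  rw [MvPolynomial.rename_rename]
  refine rename_eq_of_range_eq hF ((Equiv.injective _).comp (rootsF_injective i))
    (rootsF_injective _) ?_ ?_
  · rw [Function.comp_assoc, Set.range_comp, range_rootsF_inl, range_rootsF_inl, Set.image_insert_eq,
      ← Set.range_comp]
    have : (Equiv.sumCongr σ τ ∘ Sum.inl : Fin p → Fin p ⊕ Fin (q + 1)) = Sum.inl ∘ σ := rfl
    rw [this, σ.surjective.range_comp]
    rfl
  · rw [Function.comp_assoc, Set.range_comp, range_rootsF_inr, range_rootsF_inr, ← Set.image_comp]
    have : (Equiv.sumCongr σ τ ∘ Sum.inr : Fin (q + 1) → Fin p ⊕ Fin (q + 1)) = Sum.inr ∘ τ := rfl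
    rw [this, Set.image_comp, Set.image_compl_eq τ.bijective, Set.image_singleton]

theorem rename_rename_rootsE {F : RootRingL n p (q + 1)} (hF : IsSymmetricIn F)
    (σ : Equiv.Perm (Fin (p + 1))) (τ : Equiv.Perm (Fin q)) (i : Fin (p + 1)) :
    MvPolynomial.rename (Equiv.sumCongr σ τ) (MvPolynomial.rename (rootsE i) F) =
      MvPolynomial.rename (rootsE (σ i)) F := by
  rw [MvPolynomial.rename_rename]
  refine rename_eq_of_range_eq hF ((Equiv.injective _).comp (rootsE_injective i))
    (rootsE_injective _) ?_ ?_
  · rw [Function.comp_assoc, Set.range_comp, range_rootsE_inl, range_rootsE_inl, ← Set.image_comp]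
    have : (Equiv.sumCongr σ τ ∘ Sum.inl : Fin (p + 1) → Fin (p + 1) ⊕ Fin q) = Sum.inl ∘ σ := rfl
    rw [this, Set.image_comp, Set.image_compl_eq σ.bijective, Set.image_singleton]
  · rw [Function.comp_assoc, Set.range_comp, range_rootsE_inr, range_rootsE_inr, Set.image_insert_eq,
      ← Set.range_comp]
    have : (Equiv.sumCongr σ τ ∘ Sum.inr : Fin q → Fin (p + 1) ⊕ Fin q) = Sum.inr ∘ τ := rfl
    rw [this, τ.surjective.range_comp]
    rfl

/-- Moving the root of a site b ∉ J from the second block to the first turns evaluation at `x_J`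
into evaluation at `x_{J ∪ b}`. -/
theorem valueAt_rename_rootsF {F : RootRingL n (p + 1) q} (hF : IsSymmetricIn F)
    (J : Finset (Fin n)) (h1 : J.card = p) (h2 : Jᶜ.card = q + 1) (i : Fin (q + 1))
    (h3 : (insert (Jᶜ.orderEmbOfFin h2 i) J).card = p + 1)
    (h4 : (insert (Jᶜ.orderEmbOfFin h2 i) J)ᶜ.card = q) :
    valueAt J h1 h2 (MvPolynomial.rename (rootsF i) F) = valueAt _ h3 h4 F := by
  rw [valueAt, MvPolynomial.aeval_rename]
  have hinj := siteAt_injective J h1 h2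
  refine aeval_eq_valueAt hF _ h3 h4 (hinj.comp (rootsF_injective i)) ?_ ?_
  · change Set.range (siteAt J h1 h2 ∘ rootsF i ∘ Sum.inl) = _
    rw [Set.range_comp, range_rootsF_inl, Set.image_insert_eq,
      ← Set.range_comp, range_siteAt_inl, Finset.coe_insert]
    rfl
  · change Set.range (siteAt J h1 h2 ∘ rootsF i ∘ Sum.inr) = _
    rw [Set.range_comp, range_rootsF_inr, ← Set.image_comp,
      Set.compl_eq_univ_sdiff, Set.image_sdiff (hinj.comp Sum.inr_injective), Set.image_univ,
      range_siteAt_inr, Set.image_singleton, Finset.coe_insert, Set.insert_eq, Set.compl_union,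
      Set.inter_comm]
    rfl

theorem valueAt_rename_rootsE {F : RootRingL n p (q + 1)} (hF : IsSymmetricIn F)
    (J : Finset (Fin n)) (h1 : J.card = p + 1) (h2 : Jᶜ.card = q) (i : Fin (p + 1))
    (h3 : (J.erase (J.orderEmbOfFin h1 i)).card = p)
    (h4 : (J.erase (J.orderEmbOfFin h1 i))ᶜ.card = q + 1) :
    valueAt J h1 h2 (MvPolynomial.rename (rootsE i) F) = valueAt _ h3 h4 F := by
  rw [valueAt, MvPolynomial.aeval_rename]
  have hinj := siteAt_injective J h1 h2
  refine aeval_eq_valueAt hF _ h3 h4 (hinj.comp (rootsE_injective i)) ?_ ?_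
  · change Set.range (siteAt J h1 h2 ∘ rootsE i ∘ Sum.inl) = _
    rw [Set.range_comp, range_rootsE_inl, ← Set.image_comp,
      Set.compl_eq_univ_sdiff, Set.image_sdiff (hinj.comp Sum.inl_injective), Set.image_univ,
      range_siteAt_inl, Set.image_singleton, Finset.coe_erase]
    rfl
  · change Set.range (siteAt J h1 h2 ∘ rootsE i ∘ Sum.inr) = _
    rw [Set.range_comp, range_rootsE_inr, Set.image_insert_eq,
      ← Set.range_comp, range_siteAt_inr, Finset.coe_erase, Set.compl_sdiff]
    rfl

theorem prod_erase_orderEmbOfFin {M : Type*} [CommMonoid M] {k : ℕ} {J : Finset (Fin n)}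
    (h : J.card = k) (i : Fin k) (f : Fin n → M) :
    ∏ r ∈ Finset.univ.erase i, f (J.orderEmbOfFin h r) =
      ∏ j ∈ J.erase (J.orderEmbOfFin h i), f j := by
  have : J.erase (J.orderEmbOfFin h i) =
      (Finset.univ.erase i).map (J.orderEmbOfFin h).toEmbedding := by
    rw [Finset.map_erase, Finset.map_orderEmbOfFin_univ]
    rfl
  rw [this, Finset.prod_map]
  rfl

theorem sum_orderEmbOfFin {M : Type*} [AddCommMonoid M] {k : ℕ} {J : Finset (Fin n)}
    (h : J.card = k) (f : Fin n → M) : ∑ r, f (J.orderEmbOfFin h r) = ∑ j ∈ J, f j := by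
  conv_rhs => rw [← Finset.map_orderEmbOfFin_univ J h, Finset.sum_map]
  rfl

theorem valueAt_shiftInv (m : ℤ) (f : InvL n p q) (J : Finset (Fin n)) (h1 : J.card = p)
    (h2 : Jᶜ.card = q) : valueAt J h1 h2 (toPoly n p q (shiftInv n p q m f)) =
      shift n m (valueAt J h1 h2 (toPoly n p q f)) := by
  induction f using TensorProduct.induction_on with
  | zero => simp
  | add x y hx hy => simp only [map_add, hx, hy]
  | tmul a x =>
    have h : ∀ g : RootRing n p q, valueAt J h1 h2
        (MvPolynomial.map (algebraMap (BaseRing n) (CoeffRing n)) g) =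
        algebraMap (BaseRing n) (CoeffRing n)
          (MvPolynomial.aeval (fun s => zBase (siteAt J h1 h2 s)) g) := by
      intro g
      induction g using MvPolynomial.induction_on with
      | C a => rw [MvPolynomial.map_C, valueAt, MvPolynomial.aeval_C, MvPolynomial.aeval_C]; rfl
      | add f g hf hg => rw [map_add, map_add, map_add, map_add, hf, hg]
      | mul_X f i hf =>
        rw [map_mul, map_mul, map_mul, map_mul, hf, MvPolynomial.map_X, MvPolynomial.aeval_X,
          valueAt, MvPolynomial.aeval_X]
        rfl
    rw [shiftInv, LinearMap.rTensor_tmul, toPoly_tmul, toPoly_tmul, map_smul, map_smul, h,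
      smul_eq_mul, smul_eq_mul, map_mul, AlgHom.commutes]
    rfl

end ExplicitFormulas

/-! ### Polynomiality of the coefficients and their values at the fixed points -/

section PolynomialFormulas

variable {n p q : ℕ}

/-- Transpositions make the divided difference a polynomial, and the full group makes it symmetric
because it permutes the summands; `symmetrize` then lifts it to the invariants over 𝓛. -/
theorem exists_toPoly_eq_divDiff {ι : Type*} [Fintype ι] [DecidableEq ι]
    {x N : ι → RootRingL n p q} (hinj : Function.Injective x)
    (π : Equiv.Perm (Fin p) → Equiv.Perm (Fin q) → Equiv.Perm ι)
    (hx : ∀ σ τ i, MvPolynomial.rename (Equiv.sumCongr σ τ) (x i) = x (π σ τ i))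
    (hN : ∀ σ τ i, MvPolynomial.rename (Equiv.sumCongr σ τ) (N i) = N (π σ τ i))
    (hswap : ∀ a b, a ≠ b → ∃ σ τ, π σ τ = Equiv.swap a b ∧
      ∀ r, x a - x b ∣ r - MvPolynomial.rename (Equiv.sumCongr σ τ) r) :
    ∃ g : InvL n p q, algebraMap (RootRingL n p q) (RootField n p q) (toPoly n p q g) =
      divDiff (RootField n p q) x N Finset.univ := by
  obtain ⟨P, hP⟩ := exists_algebraMap_eq_divDiff (K := RootField n p q) hinj (fun a b hab => by
    obtain ⟨σ, τ, e, hd⟩ := hswap a b hab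
    refine ⟨(MvPolynomial.renameEquiv (CoeffRing n) (Equiv.sumCongr σ τ)).toRingEquiv, ?_, ?_, hd⟩
    · exact fun i => (hx σ τ i).trans (by rw [e])
    · exact fun i => (hN σ τ i).trans (by rw [e])) Finset.univ
  refine ⟨symmetrize n p q P, ?_⟩
  rw [toPoly_symmetrize, hP]
  intro σ τ
  apply IsFractionRing.injective (RootRingL n p q) (RootField n p q)
  have h := map_divDiff (K := RootField n p q)
    (MvPolynomial.renameEquiv (CoeffRing n) (Equiv.sumCongr σ τ)).toRingEquiv (π σ τ)
    (hx σ τ) (hN σ τ) Finset.univ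
  rw [Finset.map_univ_equiv, ← hP, IsFractionRing.ringEquivOfRingEquiv_algebraMap] at h
  exact h

/-- The numerators of the coefficient of `w^{-s}` in `formulaF`. -/
noncomputable def numF (f : InvL n (p + 1) q) (s : ℕ) (i : Fin (q + 1)) : RootRingL n p (q + 1) :=
  MvPolynomial.C ((-1) ^ p * -(yy n)) * MvPolynomial.rename (rootsF i) (toPoly n (p + 1) q f) *
    (∏ j : Fin p, (MvPolynomial.X (Sum.inr i) - MvPolynomial.X (Sum.inl j) -
      MvPolynomial.C (yy n))) *
    lineCoeff 1 (MvPolynomial.C (lam n +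
      yy n * (((n : ℤ) - 2 * ((p : ℤ) + 1) + 1 : ℤ) : CoeffRing n)))
      (MvPolynomial.X (Sum.inr i)) s

/-- The numerators of the coefficient of `w^{-s}` in `formulaE`. -/
noncomputable def numE (f : InvL n p (q + 1)) (s : ℕ) (i : Fin (p + 1)) : RootRingL n (p + 1) q :=
  MvPolynomial.C ((-1) ^ q *
      (-(yy n) * Ring.inverse ((lam n - yy n) * (lam n - 2 * yy n)))) *
    MvPolynomial.rename (rootsE i) (toPoly n p (q + 1) (shiftInv n p (q + 1) (-2) f)) *
    (∏ j : Fin q, (MvPolynomial.X (Sum.inr j) - MvPolynomial.X (Sum.inl i) -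
      MvPolynomial.C (yy n))) *
    lineCoeff (-1) (MvPolynomial.C (lam n - yy n)) (MvPolynomial.X (Sum.inl i)) s

theorem isUnit_cE (n : ℕ) : IsUnit ((lam n - yy n) * (lam n - 2 * yy n)) := by
  have h1 := isUnit_lam_sub (n := n) 1
  have h2 := isUnit_lam_sub (n := n) 2
  push_cast at h1 h2
  rw [one_mul] at h1
  exact h1.mul h2

theorem formulaF_eq (f : InvL n (p + 1) q) : formulaF n p q f =
    HahnSeries.ofPowerSeries ℤ (RootField n p (q + 1)) (PowerSeries.mk fun s =>
      divDiff (RootField n p (q + 1)) (fun i => MvPolynomial.X (Sum.inr i)) (numF f s)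
        Finset.univ) := by
  have h := sum_mul_div_wVar_sub (K := RootField n p (q + 1))
    (fun i : Fin (q + 1) => algebraMap (RootRingL n p (q + 1)) (RootField n p (q + 1))
      (MvPolynomial.C ((-1) ^ p * -(yy n)) * MvPolynomial.rename (rootsF i) (toPoly n (p + 1) q f) *
      (∏ j : Fin p, (MvPolynomial.X (Sum.inr i) - MvPolynomial.X (Sum.inl j) -
        MvPolynomial.C (yy n)))) / ∏ j ∈ Finset.univ.erase i,
        (algebraMap (RootRingL n p (q + 1)) (RootField n p (q + 1)) (MvPolynomial.X (Sum.inr i)) -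
        algebraMap (RootRingL n p (q + 1)) (RootField n p (q + 1)) (MvPolynomial.X (Sum.inr j))))
    (fun i => algebraMap (RootRingL n p (q + 1)) (RootField n p (q + 1))
      (MvPolynomial.X (Sum.inr i))) 1
    (algebraMap (RootRingL n p (q + 1)) (RootField n p (q + 1)) (MvPolynomial.C (lam n +
      yy n * (((n : ℤ) - 2 * ((p : ℤ) + 1) + 1 : ℤ) : CoeffRing n))))
  have e : ∀ s, divDiff (RootField n p (q + 1)) (fun i => MvPolynomial.X (Sum.inr i)) (numF f s)
      Finset.univ = _ := fun s => Finset.sum_congr rfl fun i _ => by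
    rw [numF, map_mul, map_lineCoeff, map_one, mul_div_right_comm]
  simp only [e]
  rw [← h, formulaF, Finset.mul_sum]
  refine Finset.sum_congr rfl fun i _ => ?_
  simp only [ofPoly, constL, root1, root2, map_mul, map_add, map_sub, map_neg, map_pow, map_prod,
    map_div₀, map_one, map_intCast]
  generalize (((n : ℤ) - 2 * ((p : ℤ) + 1) + 1 : ℤ) : LaurentSeries (RootField n p (q + 1))) = c
  simp only [div_eq_mul_inv]
  ring

/-- The denominators are γ_{1,j} - γ_{1,i}, opposite to the convention of `divDiff`, so the nodes
are taken to be -γ_{1,i}. -/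
theorem formulaE_eq (f : InvL n p (q + 1)) : formulaE n p q f =
    HahnSeries.ofPowerSeries ℤ (RootField n (p + 1) q) (PowerSeries.mk fun s =>
      divDiff (RootField n (p + 1) q) (fun i => -MvPolynomial.X (Sum.inl i)) (numE f s)
        Finset.univ) := by
  have hc : ∀ u : CoeffRing n, IsUnit u →
      algebraMap (RootRingL n (p + 1) q) (RootField n (p + 1) q)
        (MvPolynomial.C (Ring.inverse u)) =
      (algebraMap (RootRingL n (p + 1) q) (RootField n (p + 1) q) (MvPolynomial.C u))⁻¹ :=
    fun u hu => map_inverse_of_isUnit ((algebraMap (RootRingL n (p + 1) q)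
      (RootField n (p + 1) q)).comp MvPolynomial.C) hu
  have h := sum_mul_div_wVar_sub (K := RootField n (p + 1) q)
    (fun i : Fin (p + 1) => algebraMap (RootRingL n (p + 1) q) (RootField n (p + 1) q)
      (MvPolynomial.C ((-1) ^ q *
        (-(yy n) * Ring.inverse ((lam n - yy n) * (lam n - 2 * yy n)))) *
      MvPolynomial.rename (rootsE i) (toPoly n p (q + 1) (shiftInv n p (q + 1) (-2) f)) *
      (∏ j : Fin q, (MvPolynomial.X (Sum.inr j) - MvPolynomial.X (Sum.inl i) -
        MvPolynomial.C (yy n)))) / ∏ j ∈ Finset.univ.erase i,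
        (algebraMap (RootRingL n (p + 1) q) (RootField n (p + 1) q) (-MvPolynomial.X (Sum.inl i)) -
        algebraMap (RootRingL n (p + 1) q) (RootField n (p + 1) q) (-MvPolynomial.X (Sum.inl j))))
    (fun i => algebraMap (RootRingL n (p + 1) q) (RootField n (p + 1) q)
      (MvPolynomial.X (Sum.inl i))) (-1)
    (algebraMap (RootRingL n (p + 1) q) (RootField n (p + 1) q) (MvPolynomial.C (lam n - yy n)))
  have e : ∀ s, divDiff (RootField n (p + 1) q) (fun i => -MvPolynomial.X (Sum.inl i)) (numE f s)
      Finset.univ = _ := fun s => Finset.sum_congr rfl fun i _ => by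
    rw [numE, map_mul, map_lineCoeff, map_neg, map_one, mul_div_right_comm]
  simp only [e]
  rw [← h, formulaE, Finset.mul_sum]
  refine Finset.sum_congr rfl fun i _ => ?_
  simp only [ofPoly, constL, root1, root2, map_mul, hc _ (isUnit_cE n), map_sub, map_neg,
    map_pow, map_prod, map_div₀, map_one, map_inv₀, map_ofNat, neg_sub_neg]
  simp only [div_eq_mul_inv]
  ring

theorem exists_formulaF_eq_seriesOf (hs : (p + 1) + q = n) (f : InvL n (p + 1) q) :
    ∃ g : ℕ → InvL n p (q + 1), formulaF n p q f = seriesOf g ∧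
      ∀ (s : ℕ) (J : Finset (Fin n)) (h1 : J.card = p) (h2 : Jᶜ.card = q + 1),
        valueAt J h1 h2 (toPoly n p (q + 1) (g s)) =
          ∑ i ∈ Jᶜ, PowerSeries.coeff s (fSeries J i) *
            Loc n (inclCoh n (p + 1) q hs (cohClass n (p + 1) q f)) (insert i J) := by
  have hinj : Function.Injective
      fun i : Fin (q + 1) => (MvPolynomial.X (Sum.inr i) : RootRingL n p (q + 1)) :=
    (MvPolynomial.X_injective).comp Sum.inr_injective
  have h : ∀ s, ∃ g : InvL n p (q + 1), _ := fun s => exists_toPoly_eq_divDiff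
    (N := numF f s) hinj (fun _ τ => τ) (fun σ τ i => by
      rw [MvPolynomial.rename_X]
      rfl) (fun σ τ i => by
      rw [numF, numF, map_mul, map_mul, map_mul, MvPolynomial.rename_C,
        rename_rename_rootsF (isSymmetricIn_toPoly f), map_prod]
      congr 1
      · congr 1
        simp only [map_sub, MvPolynomial.rename_X, MvPolynomial.rename_C, Equiv.sumCongr_apply,
          Sum.map_inl, Sum.map_inr]
        exact Equiv.prod_comp σ fun j => (MvPolynomial.X (Sum.inr (τ i)) -
          MvPolynomial.X (Sum.inl j) - MvPolynomial.C (yy n) : RootRingL n p (q + 1))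
      · have := map_lineCoeff (MvPolynomial.rename (R := CoeffRing n)
          (Equiv.sumCongr σ τ)).toRingHom
        refine (this _ _ _ _).trans ?_
        simp) fun a b _ => ⟨1, Equiv.swap a b, rfl, fun r => by
      have := X_sub_X_dvd_sub_rename_swap (Sum.inr a) (Sum.inr b) r
      rwa [← Equiv.Perm.sumCongr_one_swap] at this⟩
  choose g hg using h
  refine ⟨g, ?_, fun s J h1 h2 => ?_⟩
  · rw [formulaF_eq, seriesOf]
    refine congrArg _ (PowerSeries.ext fun s => ?_)
    rw [PowerSeries.coeff_mk, PowerSeries.coeff_mk, ← hg s]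
  · have hev := map_eq_of_algebraMap_eq_divDiff hinj Finset.univ (hg s)
      (valueAt J h1 h2 : RootRingL n p (q + 1) →+* CoeffRing n) (fun i j hij => by
        simp only [RingHom.coe_coe, valueAt, MvPolynomial.aeval_X]
        exact isUnit_zz_sub fun e => hij (Sum.inr_injective (siteAt_injective J h1 h2 e)))
    refine hev.trans ?_
    rw [← sum_orderEmbOfFin h2]
    refine Finset.sum_congr rfl fun i _ => ?_
    set b := Jᶜ.orderEmbOfFin h2 i with hb
    have hbJ : b ∉ J := Finset.mem_compl.1 (Finset.orderEmbOfFin_mem Jᶜ h2 i)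
    have h3 : (insert b J).card = p + 1 := by rw [Finset.card_insert_of_notMem hbJ, h1]
    have h4 := card_compl_eq hs h3
    have hx : ∀ j, valueAt J h1 h2 (MvPolynomial.X (Sum.inr j)) =
        zz (Jᶜ.orderEmbOfFin h2 j) := fun j => by
      rw [valueAt, MvPolynomial.aeval_X]
      rfl
    have hx' : ∀ j, valueAt J h1 h2 (MvPolynomial.X (Sum.inl j)) =
        zz (J.orderEmbOfFin h1 j) := fun j => by
      rw [valueAt, MvPolynomial.aeval_X]
      rfl
    have hC : ∀ a, valueAt J h1 h2 (MvPolynomial.C a : RootRingL n p (q + 1)) = a := fun a =>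
      (valueAt J h1 h2).commutes a
    have hl := map_lineCoeff (valueAt J h1 h2 : RootRingL n p (q + 1) →+* CoeffRing n)
    simp only [RingHom.coe_coe] at hl ⊢
    have hR : valueAt J h1 h2 (MvPolynomial.rename (rootsF i) (toPoly n (p + 1) q f)) =
        valueAt (insert b J) h3 h4 (toPoly n (p + 1) q f) :=
      valueAt_rename_rootsF (isSymmetricIn_toPoly f) J h1 h2 i h3 h4
    rw [numF, map_mul, map_mul, map_mul, hC, hR, map_prod, hl, map_one, hC,
      Loc_inclCoh_of_card hs f _ h3 h4]
    simp only [map_sub, hx, hx', hC, ← hb]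
    rw [prod_orderEmbOfFin h1 fun j => zz b - zz j - yy n,
      prod_erase_orderEmbOfFin h2 i fun j => Ring.inverse (zz b - zz j), ← hb, fSeries,
      PowerSeries.coeff_C_mul, ← map_one PowerSeries.C, coeff_line, Finset.compl_insert]
    -- The sign (-1)^{k-1} of the formula, with k - 1 = p, is absorbed by reversing each of the `p`
    -- factors.
    have hsign : ∏ j ∈ J, (zz j - zz b + yy n) =
        (-1) ^ p * ∏ j ∈ J, (zz b - zz j - yy n) := by
      rw [← h1, ← Finset.prod_const, ← Finset.prod_mul_distrib]
      exact Finset.prod_congr rfl fun j _ => by ring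
    have hc : lam n + ((n : CoeffRing n) - 2 * J.card - 1) * yy n = lam n +
        yy n * (((n : ℤ) - 2 * ((p : ℤ) + 1) + 1 : ℤ) : CoeffRing n) := by
      rw [h1]
      push_cast
      ring
    rw [hsign, hc]
    ring

theorem exists_formulaE_eq_seriesOf (hs : p + (q + 1) = n) (f : InvL n p (q + 1)) :
    ∃ g : ℕ → InvL n (p + 1) q, formulaE n p q f = seriesOf g ∧
      ∀ (s : ℕ) (J : Finset (Fin n)) (h1 : J.card = p + 1) (h2 : Jᶜ.card = q),
        valueAt J h1 h2 (toPoly n (p + 1) q (g s)) =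
          ∑ m ∈ J, PowerSeries.coeff s (eSeries J m) *
            shift n (-2) (Loc n (inclCoh n p (q + 1) hs (cohClass n p (q + 1) f)) (J.erase m)) := by
  have hinj : Function.Injective
      fun i : Fin (p + 1) => (-MvPolynomial.X (Sum.inl i) : RootRingL n (p + 1) q) :=
    neg_injective.comp ((MvPolynomial.X_injective).comp Sum.inl_injective)
  have h : ∀ s, ∃ g : InvL n (p + 1) q, _ := fun s => exists_toPoly_eq_divDiff
    (N := numE f s) hinj (fun σ _ => σ) (fun σ τ i => by
      rw [map_neg, MvPolynomial.rename_X]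
      rfl) (fun σ τ i => by
      rw [numE, numE, map_mul, map_mul, map_mul, MvPolynomial.rename_C,
        rename_rename_rootsE (isSymmetricIn_toPoly _), map_prod]
      congr 1
      · congr 1
        simp only [map_sub, MvPolynomial.rename_X, MvPolynomial.rename_C, Equiv.sumCongr_apply,
          Sum.map_inl, Sum.map_inr]
        exact Equiv.prod_comp τ fun j => (MvPolynomial.X (Sum.inr j) -
          MvPolynomial.X (Sum.inl (σ i)) - MvPolynomial.C (yy n) : RootRingL n (p + 1) q)
      · have := map_lineCoeff (MvPolynomial.rename (R := CoeffRing n)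
          (Equiv.sumCongr σ τ)).toRingHom
        refine (this _ _ _ _).trans ?_
        simp) fun a b _ => ⟨Equiv.swap a b, 1, rfl, fun r => by
      have := X_sub_X_dvd_sub_rename_swap (Sum.inl a) (Sum.inl b) r
      rw [← Equiv.Perm.sumCongr_swap_one, ← neg_dvd] at this
      rwa [neg_sub_neg, ← neg_sub]⟩
  choose g hg using h
  refine ⟨g, ?_, fun s J h1 h2 => ?_⟩
  · rw [formulaE_eq, seriesOf]
    refine congrArg _ (PowerSeries.ext fun s => ?_)
    rw [PowerSeries.coeff_mk, PowerSeries.coeff_mk, ← hg s]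
  · have hev := map_eq_of_algebraMap_eq_divDiff hinj Finset.univ (hg s)
      (valueAt J h1 h2 : RootRingL n (p + 1) q →+* CoeffRing n) (fun i j hij => by
        simp only [RingHom.coe_coe, map_neg, valueAt, MvPolynomial.aeval_X, neg_sub_neg]
        exact isUnit_zz_sub fun e =>
          hij.symm (Sum.inl_injective (siteAt_injective J h1 h2 e)))
    refine hev.trans ?_
    rw [← sum_orderEmbOfFin h1]
    refine Finset.sum_congr rfl fun i _ => ?_
    set b := J.orderEmbOfFin h1 i with hb
    have hbJ : b ∈ J := Finset.orderEmbOfFin_mem J h1 i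
    have h3 : (J.erase b).card = p := by rw [Finset.card_erase_of_mem hbJ, h1, Nat.add_sub_cancel]
    have h4 := card_compl_eq hs h3
    have hx : ∀ j, valueAt J h1 h2 (MvPolynomial.X (Sum.inr j)) =
        zz (Jᶜ.orderEmbOfFin h2 j) := fun j => by
      rw [valueAt, MvPolynomial.aeval_X]
      rfl
    have hx' : ∀ j, valueAt J h1 h2 (MvPolynomial.X (Sum.inl j)) =
        zz (J.orderEmbOfFin h1 j) := fun j => by
      rw [valueAt, MvPolynomial.aeval_X]
      rfl
    have hC : ∀ a, valueAt J h1 h2 (MvPolynomial.C a : RootRingL n (p + 1) q) = a := fun a =>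
      (valueAt J h1 h2).commutes a
    have hl := map_lineCoeff (valueAt J h1 h2 : RootRingL n (p + 1) q →+* CoeffRing n)
    simp only [RingHom.coe_coe] at hl ⊢
    have hR : valueAt J h1 h2 (MvPolynomial.rename (rootsE i)
          (toPoly n p (q + 1) (shiftInv n p (q + 1) (-2) f))) =
        valueAt (J.erase b) h3 h4 (toPoly n p (q + 1) (shiftInv n p (q + 1) (-2) f)) :=
      valueAt_rename_rootsE (isSymmetricIn_toPoly _) J h1 h2 i h3 h4
    rw [numE, map_mul, map_mul, map_mul, hC, hR, valueAt_shiftInv, map_prod, hl, map_neg, map_one,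
      hC, Loc_inclCoh_of_card hs f _ h3 h4]
    simp only [map_sub, map_neg, hx, hx', hC, ← hb, neg_sub_neg]
    rw [prod_orderEmbOfFin h2 fun j => zz j - zz b - yy n,
      prod_erase_orderEmbOfFin h1 i fun j => Ring.inverse (zz j - zz b), ← hb, eSeries,
      PowerSeries.coeff_C_mul, ← map_one PowerSeries.C, ← map_neg, coeff_line]
    -- Likewise (-1)^{n-k-1}, with n - k - 1 = q, reverses the factors over the complement of `J`.
    have hsign : ∏ j ∈ Jᶜ, (zz b - zz j + yy n) =
        (-1) ^ q * ∏ j ∈ Jᶜ, (zz j - zz b - yy n) := by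
      rw [← h2, ← Finset.prod_const, ← Finset.prod_mul_distrib]
      exact Finset.prod_congr rfl fun j _ => by ring
    rw [hsign]
    ring

end PolynomialFormulas

/-! ### Difference operators with power series coefficients -/

section DifferenceOperators

variable {n : ℕ}

theorem shift_comp (m k : ℤ) :
    (shift n m : CoeffRing n →+* CoeffRing n).comp (shift n k : CoeffRing n →+* CoeffRing n) =
      (shift n (m + k) : CoeffRing n →+* CoeffRing n) := by
  refine IsLocalization.ringHom_ext (denominators n) (Polynomial.ringHom_ext (fun r => ?_) ?_)
  · have h : ∀ j : ℤ, shift n j (algebraMap (Polynomial (BaseRing n)) (CoeffRing n)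
        (Polynomial.C r)) = algebraMap (BaseRing n) (CoeffRing n) r := fun j => (shift n j).commutes r
    have h' : ∀ j : ℤ, shift n j (algebraMap (BaseRing n) (CoeffRing n) r) =
        algebraMap (BaseRing n) (CoeffRing n) r := fun j => (shift n j).commutes r
    simp only [RingHom.comp_apply, RingHom.coe_coe, h, h']
  · change shift n m (shift n k (lam n)) = shift n (m + k) (lam n)
    rw [shift_lam, map_add, map_mul, map_intCast, shift_lam, shift_lam, shift_yy]
    push_cast
    ring

theorem shift_zero : (shift n 0 : CoeffRing n →+* CoeffRing n) = RingHom.id _ := by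
  refine IsLocalization.ringHom_ext (denominators n) (Polynomial.ringHom_ext (fun r => ?_) ?_)
  · exact (shift n 0).commutes r
  · change shift n 0 (lam n) = lam n
    rw [shift_lam]
    simp

theorem shift_shift (m k : ℤ) (a : CoeffRing n) : shift n m (shift n k a) = shift n (m + k) a :=
  RingHom.congr_fun (shift_comp m k) a

theorem shift_zero_apply (a : CoeffRing n) : shift n 0 a = a := RingHom.congr_fun shift_zero a

/-- Matrices of power series in `w⁻¹` with coefficients in `𝓛_{λ,(z,y)}`. -/
abbrev SeriesMatrix (n : ℕ) : Type :=
  Matrix (Finset (Fin n)) (Finset (Fin n)) (PowerSeries (CoeffRing n))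

/-- The substitution `λ ↦ λ + m y` in a matrix of power series. -/
noncomputable def shiftMatrix (m : ℤ) (P : SeriesMatrix n) : SeriesMatrix n :=
  P.map (PowerSeries.map (shift n m : CoeffRing n →+* CoeffRing n))

/-- The series of difference operators `P(λ,w) δ^m`. -/
noncomputable def diffOp (m : ℤ) (P : SeriesMatrix n) :
    PowerSeries (Module.End (BaseRing n) (TensorSpace n)) :=
  PowerSeries.mk fun s =>
    (Matrix.toLin' (P.map (PowerSeries.coeff s))).restrictScalars (BaseRing n) * shiftTensor n m

theorem coeff_diffOp_apply (m : ℤ) (P : SeriesMatrix n) (s : ℕ) (ζ : TensorSpace n)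
    (I : Finset (Fin n)) : PowerSeries.coeff s (diffOp m P) ζ I =
      ∑ J, PowerSeries.coeff s (P I J) * shift n m (ζ J) := by
  rw [diffOp, PowerSeries.coeff_mk, Module.End.mul_apply, LinearMap.restrictScalars_apply,
    Matrix.toLin'_apply, Matrix.mulVec, dotProduct]
  rfl

/-- Commuting δ^m past the coefficients of `Q` substitutes λ + m y in them. -/
theorem diffOp_mul (m k : ℤ) (P Q : SeriesMatrix n) :
    diffOp m P * diffOp k Q = diffOp (m + k) (P * shiftMatrix m Q) := by
  refine PowerSeries.ext fun s => LinearMap.ext fun ζ => funext fun I => ?_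
  rw [PowerSeries.coeff_mul, LinearMap.sum_apply, Finset.sum_apply, coeff_diffOp_apply]
  simp only [Module.End.mul_apply, coeff_diffOp_apply, Matrix.mul_apply, map_sum,
    PowerSeries.coeff_mul, shiftMatrix, Matrix.map_apply, PowerSeries.coeff_map, Finset.sum_mul,
    Finset.mul_sum, map_mul, shift_shift, RingHom.coe_coe]
  conv_rhs => rw [Finset.sum_comm]
  rw [Finset.sum_comm]
  refine Finset.sum_congr rfl fun J _ => ?_
  rw [Finset.sum_comm]
  exact Finset.sum_congr rfl fun K _ => Finset.sum_congr rfl fun x _ => (mul_assoc _ _ _).symm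

theorem diffOp_zero_one : diffOp (n := n) 0 1 = 1 := by
  refine PowerSeries.ext fun s => LinearMap.ext fun ζ => funext fun I => ?_
  rw [coeff_diffOp_apply, Finset.sum_eq_single I, Matrix.one_apply_eq, shift_zero_apply,
    PowerSeries.coeff_one, PowerSeries.coeff_one]
  · split_ifs <;> simp
  · intro J _ hJ
    rw [Matrix.one_apply_ne hJ.symm, map_zero, zero_mul]
  · simp

variable (n) in
/-- The matrix of fixed-point restrictions of the stable envelope. -/
noncomputable def kappaSeries : SeriesMatrix n := (kappaMatrix n).map PowerSeries.C

/-- The matrix of the block `(i,j)` of the L-operator. -/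
noncomputable def lMatrix (i j : Fin 2) : SeriesMatrix n :=
  Matrix.of fun I J => PowerSeries.mk fun s => (lOperator n (i, I) (j, J)).coeff (s : ℤ)

variable (n) in
/-- The eigenvalues of `L_{22}` at the fixed points. -/
noncomputable def dMatrix : SeriesMatrix n := Matrix.diagonal dSeries

variable (n) in
/-- `F̃(w)` in the basis of fixed points. -/
noncomputable def fMatrix : SeriesMatrix n :=
  Matrix.of fun J K => ∑ i ∈ Jᶜ, if K = insert i J then fSeries J i else 0

variable (n) in
/-- `Ẽ(w)` in the basis of fixed points. -/
noncomputable def eMatrix : SeriesMatrix n :=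
  Matrix.of fun J K => ∑ m ∈ J, if K = J.erase m then eSeries J m else 0

theorem lTilde_eq_diffOp (i j : Fin 2) :
    lTilde n i j = diffOp (if j = 0 then -1 else 1) (lMatrix i j) := by
  refine PowerSeries.ext fun s => ?_
  rw [lTilde, diffOp, PowerSeries.coeff_mk, PowerSeries.coeff_mk, lCoeff]
  congr 3
  ext I J
  simp [lMatrix]

theorem kappaSeries_mul_lMatrix_diag :
    kappaSeries n * lMatrix 1 1 = dMatrix n * shiftMatrix 1 (kappaSeries n) := by
  ext J I s
  rw [dMatrix, Matrix.diagonal_mul, Matrix.mul_apply, map_sum]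
  simp only [kappaSeries, kappaMatrix, lMatrix, shiftMatrix, Matrix.map_apply, Matrix.of_apply,
    PowerSeries.map_C, PowerSeries.coeff_C_mul, PowerSeries.coeff_mul_C, PowerSeries.coeff_mk]
  exact kappa_lOperator_diag I J s

theorem kappaSeries_mul_lMatrix_up : kappaSeries n * lMatrix 0 1 =
    fMatrix n * dMatrix n * shiftMatrix 1 (kappaSeries n) := by
  ext J I s
  rw [Matrix.mul_apply, Matrix.mul_apply, map_sum, map_sum]
  simp only [kappaSeries, kappaMatrix, lMatrix, shiftMatrix, Matrix.map_apply, Matrix.of_apply,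
    PowerSeries.map_C, PowerSeries.coeff_C_mul, PowerSeries.coeff_mul_C, PowerSeries.coeff_mk,
    dMatrix, fMatrix, Matrix.mul_diagonal]
  rw [kappa_lOperator_up I J s]
  simp only [Finset.sum_mul, map_sum, ite_mul, zero_mul]
  rw [Finset.sum_comm]
  refine Finset.sum_congr rfl fun i _ => ?_
  rw [Finset.sum_eq_single (insert i J)]
  · simp
  · intro K _ hK
    simp [hK]
  · simp

theorem kappaSeries_mul_lMatrix_down : kappaSeries n * lMatrix 1 0 =
    dMatrix n * shiftMatrix 1 (eMatrix n) * shiftMatrix (-1) (kappaSeries n) := by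
  ext J I s
  rw [Matrix.mul_apply, Matrix.mul_apply, map_sum, map_sum]
  simp only [kappaSeries, kappaMatrix, lMatrix, shiftMatrix, Matrix.map_apply, Matrix.of_apply,
    PowerSeries.map_C, PowerSeries.coeff_C_mul, PowerSeries.coeff_mul_C, PowerSeries.coeff_mk,
    dMatrix, eMatrix, Matrix.diagonal_mul]
  rw [kappa_lOperator_down I J s]
  simp only [Finset.mul_sum, map_sum, Finset.sum_mul]
  rw [Finset.sum_comm]
  refine Finset.sum_congr rfl fun m _ => ?_
  rw [Finset.sum_eq_single (J.erase m)]
  · simp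
  · intro K _ hK
    simp [hK]
  · simp

theorem isUnit_dSeries (J : Finset (Fin n)) : IsUnit (dSeries J) := by
  rw [PowerSeries.isUnit_iff_constantCoeff, dSeries, map_prod]
  refine IsUnit.prod_iff.2 fun j _ => ?_
  have h : PowerSeries.constantCoeff (geomSeries (zz j + yy n)) = 1 := by
    rw [← PowerSeries.coeff_zero_eq_constantCoeff_apply, geomSeries, PowerSeries.coeff_mk, pow_zero]
  rw [map_mul, h]
  simp

/-- The inverse of D δ is D^{-1}(λ - y) δ^{-1}, and `D` is invertible because its diagonal series
have constant term one. Both products are checked, since operators do not commute. -/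
theorem isUnit_diffOp_dMatrix : IsUnit (diffOp 1 (dMatrix n)) := by
  choose D hD using fun J : Finset (Fin n) => isUnit_dSeries J
  have hs : ∀ (m k : ℤ) (p : PowerSeries (CoeffRing n)),
      PowerSeries.map (shift n m : CoeffRing n →+* CoeffRing n)
        (PowerSeries.map (shift n k : CoeffRing n →+* CoeffRing n) p) =
      PowerSeries.map (shift n (m + k) : CoeffRing n →+* CoeffRing n) p := fun m k p => by
    ext s
    simp [shift_shift]
  have h0 : ∀ p : PowerSeries (CoeffRing n),
      PowerSeries.map (shift n 0 : CoeffRing n →+* CoeffRing n) p = p := fun p => by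
    ext s
    simp [shift_zero_apply]
  set D' : SeriesMatrix n := Matrix.diagonal fun J => ((D J)⁻¹ : (PowerSeries (CoeffRing n))ˣ)
  have e : diffOp 1 (dMatrix n) * diffOp (-1) (shiftMatrix (-1) D') = 1 := by
    rw [diffOp_mul, ← diffOp_zero_one]
    congr 1
    rw [dMatrix, shiftMatrix, shiftMatrix, Matrix.diagonal_map (map_zero _),
      Matrix.diagonal_map (map_zero _), Matrix.diagonal_mul_diagonal, ← Matrix.diagonal_one]
    congr 1
    funext J
    rw [hs, add_neg_cancel, h0, ← hD, Units.mul_inv]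
  have e' : diffOp (-1) (shiftMatrix (-1) D') * diffOp 1 (dMatrix n) = 1 := by
    rw [diffOp_mul, ← diffOp_zero_one]
    congr 1
    rw [dMatrix, shiftMatrix, shiftMatrix, Matrix.diagonal_map (map_zero _),
      Matrix.diagonal_map (map_zero _), Matrix.diagonal_mul_diagonal, ← Matrix.diagonal_one]
    congr 1
    funext J
    rw [← map_mul, ← hD, Units.inv_mul, map_one]
  exact ⟨⟨_, _, e, e'⟩, rfl⟩

variable (n) in
/-- The operator of restriction of stable envelopes to the fixed points. -/
noncomputable def kappaOp : PowerSeries (Module.End (BaseRing n) (TensorSpace n)) :=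
  diffOp 0 (kappaSeries n)

theorem shiftMatrix_zero (P : SeriesMatrix n) : shiftMatrix 0 P = P := by
  ext I J s
  simp [shiftMatrix, shift_zero_apply]

theorem isUnit_kappaOp : IsUnit (kappaOp n) := by
  have h := isUnit_det_kappaMatrix (n := n)
  have key : ∀ M N : Matrix (Finset (Fin n)) (Finset (Fin n)) (CoeffRing n), M * N = 1 →
      diffOp 0 (M.map PowerSeries.C) * diffOp 0 (N.map PowerSeries.C) = 1 := fun M N hMN => by
    rw [diffOp_mul, shiftMatrix_zero, ← diffOp_zero_one, ← Matrix.map_mul, hMN,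
      Matrix.map_one _ (map_zero _) (map_one _), add_zero]
  exact ⟨⟨_, _, key _ _ (Matrix.mul_nonsing_inv _ h), key _ _ (Matrix.nonsing_inv_mul _ h)⟩, rfl⟩

theorem kappaOp_mul_lTilde_diag :
    kappaOp n * lTilde n 1 1 = diffOp 1 (dMatrix n) * kappaOp n := by
  rw [lTilde_eq_diffOp, kappaOp, diffOp_mul, diffOp_mul, shiftMatrix_zero,
    kappaSeries_mul_lMatrix_diag]
  rfl

theorem kappaOp_mul_lTilde_up :
    kappaOp n * lTilde n 0 1 = diffOp 0 (fMatrix n) * diffOp 1 (dMatrix n) * kappaOp n := by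
  rw [lTilde_eq_diffOp, kappaOp, diffOp_mul, diffOp_mul, diffOp_mul, shiftMatrix_zero,
    shiftMatrix_zero, kappaSeries_mul_lMatrix_up]
  rfl

theorem kappaOp_mul_lTilde_down :
    kappaOp n * lTilde n 1 0 = diffOp 1 (dMatrix n) * diffOp (-2) (eMatrix n) * kappaOp n := by
  rw [lTilde_eq_diffOp, kappaOp, diffOp_mul, diffOp_mul, diffOp_mul, shiftMatrix_zero,
    kappaSeries_mul_lMatrix_down]
  rfl

theorem isUnit_lTilde (n : ℕ) : IsUnit (lTilde n 1 1) := by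
  obtain ⟨u, hu⟩ := isUnit_kappaOp (n := n)
  have h : lTilde n 1 1 = ↑u⁻¹ * (diffOp 1 (dMatrix n) * ↑u) := by
    rw [hu, ← kappaOp_mul_lTilde_diag, ← hu, Units.inv_mul_cancel_left]
  rw [h]
  exact u⁻¹.isUnit.mul (isUnit_diffOp_dMatrix.mul u.isUnit)

/-- From K L̃_12 = F Dδ K = F K L̃_22, multiply by the inverse of L̃_22 on the right; the shifts
cancel. -/
theorem kappaOp_mul_fTilde : kappaOp n * fTilde n = diffOp 0 (fMatrix n) * kappaOp n := by
  rw [fTilde, ← mul_assoc, kappaOp_mul_lTilde_up, mul_assoc (diffOp 0 _),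
    ← kappaOp_mul_lTilde_diag, mul_assoc, mul_assoc, Ring.mul_inverse_cancel _ (isUnit_lTilde n),
    mul_one]

/-- Multiplying by Dδ on the left turns both sides into K L̃_21. The δ^{-1} from L̃_22^{-1} and the
δ^{-1} in L̃_21 add up to δ^{-2}, the source of f(λ - 2y) in the formula. -/
theorem kappaOp_mul_eTilde : kappaOp n * eTilde n = diffOp (-2) (eMatrix n) * kappaOp n := by
  refine isUnit_diffOp_dMatrix.mul_left_cancel ?_
  rw [← mul_assoc, ← kappaOp_mul_lTilde_diag, eTilde, mul_assoc,
    Ring.mul_inverse_cancel_left _ _ (isUnit_lTilde n), kappaOp_mul_lTilde_down, mul_assoc]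

theorem coeff_diffOp_mul_kappaOp (m : ℤ) (P : SeriesMatrix n) (s : ℕ) (ζ : TensorSpace n)
    (J : Finset (Fin n)) : PowerSeries.coeff s (diffOp m P * kappaOp n) ζ J =
      ∑ K, PowerSeries.coeff s (P J K) * shift n m (Loc n (stab n ζ) K) := by
  rw [kappaOp, diffOp_mul, coeff_diffOp_apply]
  simp only [Matrix.mul_apply, shiftMatrix, kappaSeries, Matrix.map_apply, PowerSeries.map_C,
    map_sum, PowerSeries.coeff_mul_C, Loc_stab, Matrix.mulVec, dotProduct, map_mul, Finset.sum_mul,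
    Finset.mul_sum, add_zero, RingHom.coe_coe]
  rw [Finset.sum_comm]
  exact Finset.sum_congr rfl fun K _ => Finset.sum_congr rfl fun I _ => mul_assoc _ _ _

theorem coeff_kappaOp_mul (T : PowerSeries (Module.End (BaseRing n) (TensorSpace n))) (s : ℕ)
    (ζ : TensorSpace n) : PowerSeries.coeff s (kappaOp n * T) ζ =
      Loc n (stab n (PowerSeries.coeff s T ζ)) := by
  have h : kappaOp n =
      PowerSeries.C (((kappaMatrix n).toLin').restrictScalars (BaseRing n)) := by
    refine PowerSeries.ext fun s => LinearMap.ext fun ζ => funext fun I => ?_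
    rw [kappaOp, coeff_diffOp_apply, PowerSeries.coeff_C]
    simp only [kappaSeries, Matrix.map_apply, PowerSeries.coeff_C, shift_zero_apply]
    split_ifs
    · rfl
    · simp
  rw [h, PowerSeries.coeff_C_mul, Module.End.mul_apply, LinearMap.restrictScalars_apply,
    Matrix.toLin'_apply, Loc_stab]

theorem Loc_stab_fTilde (s : ℕ) (ζ : TensorSpace n) (J : Finset (Fin n)) :
    Loc n (stab n (PowerSeries.coeff s (fTilde n) ζ)) J =
      ∑ i ∈ Jᶜ, PowerSeries.coeff s (fSeries J i) * Loc n (stab n ζ) (insert i J) := by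
  rw [← coeff_kappaOp_mul, kappaOp_mul_fTilde, coeff_diffOp_mul_kappaOp]
  simp only [fMatrix, Matrix.of_apply, map_sum, Finset.sum_mul, shift_zero_apply]
  rw [Finset.sum_comm]
  refine Finset.sum_congr rfl fun i _ => ?_
  rw [Finset.sum_eq_single (insert i J)]
  · simp
  · intro K _ hK
    simp [hK]
  · simp

theorem Loc_stab_eTilde (s : ℕ) (ζ : TensorSpace n) (J : Finset (Fin n)) :
    Loc n (stab n (PowerSeries.coeff s (eTilde n) ζ)) J =
      ∑ m ∈ J, PowerSeries.coeff s (eSeries J m) * shift n (-2) (Loc n (stab n ζ) (J.erase m)) := by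
  rw [← coeff_kappaOp_mul, kappaOp_mul_eTilde, coeff_diffOp_mul_kappaOp]
  simp only [eMatrix, Matrix.of_apply, map_sum, Finset.sum_mul]
  rw [Finset.sum_comm]
  refine Finset.sum_congr rfl fun i _ => ?_
  rw [Finset.sum_eq_single (J.erase i)]
  · simp
  · intro K _ hK
    simp [hK]
  · simp

end DifferenceOperators

theorem mainTheorem10 (n : ℕ) :
    Function.Bijective (stab n) ∧
    IsUnit (lTilde n 1 1) ∧
    (∀ (p q : ℕ) (hs : (p + 1) + q = n) (ht : p + (q + 1) = n) (f : InvL n (p + 1) q),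
      ∃ g : ℕ → InvL n p (q + 1), formulaF n p q f = seriesOf g ∧
        ∀ (s : ℕ) (ζ : TensorSpace n),
          stab n ζ = inclCoh n (p + 1) q hs (cohClass n (p + 1) q f) →
          stab n (PowerSeries.coeff s (fTilde n) ζ) =
            inclCoh n p (q + 1) ht (cohClass n p (q + 1) (g s))) ∧
    (∀ (p q : ℕ) (hs : p + (q + 1) = n) (ht : (p + 1) + q = n) (f : InvL n p (q + 1)),
      ∃ g : ℕ → InvL n (p + 1) q, formulaE n p q f = seriesOf g ∧
        ∀ (s : ℕ) (ζ : TensorSpace n),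
          stab n ζ = inclCoh n p (q + 1) hs (cohClass n p (q + 1) f) →
          stab n (PowerSeries.coeff s (eTilde n) ζ) =
            inclCoh n (p + 1) q ht (cohClass n (p + 1) q (g s))) ∧
    (∀ (x : CohL n 0 n) (s : ℕ) (ζ : TensorSpace n),
      stab n ζ = inclCoh n 0 n (Nat.zero_add n) x →
      PowerSeries.coeff s (fTilde n) ζ = 0) ∧
    (∀ (x : CohL n n 0) (s : ℕ) (ζ : TensorSpace n),
      stab n ζ = inclCoh n n 0 (Nat.add_zero n) x →
      PowerSeries.coeff s (eTilde n) ζ = 0) := by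
  refine ⟨stab_bijective n, isUnit_lTilde n, fun p q hs ht f => ?_, fun p q hs ht f => ?_,
    fun x s ζ hζ => ?_, fun x s ζ hζ => ?_⟩
  · obtain ⟨g, hg, hv⟩ := exists_formulaF_eq_seriesOf hs f
    -- Equality is tested at every fixed point. On the target component it is the evaluation of the
    -- formula; elsewhere both sides vanish, because `J ∪ i` misses the source component.
    refine ⟨g, hg, fun s ζ hζ => Loc_injective n (funext fun J => ?_)⟩
    rw [Loc_stab_fTilde, hζ]
    by_cases h1 : J.card = p
    · rw [Loc_inclCoh_of_card ht _ J h1 (card_compl_eq ht h1), hv]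
    · rw [Loc_inclCoh_of_card_ne ht _ J h1]
      refine Finset.sum_eq_zero fun i hi => ?_
      rw [Loc_inclCoh_of_card_ne, mul_zero]
      rw [Finset.card_insert_of_notMem (Finset.mem_compl.1 hi)]
      omega
  · obtain ⟨g, hg, hv⟩ := exists_formulaE_eq_seriesOf hs f
    refine ⟨g, hg, fun s ζ hζ => Loc_injective n (funext fun J => ?_)⟩
    rw [Loc_stab_eTilde, hζ]
    by_cases h1 : J.card = p + 1
    · rw [Loc_inclCoh_of_card ht _ J h1 (card_compl_eq ht h1), hv]
    · rw [Loc_inclCoh_of_card_ne ht _ J h1]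
      refine Finset.sum_eq_zero fun i hi => ?_
      rw [Loc_inclCoh_of_card_ne, map_zero, mul_zero]
      rw [Finset.card_erase_of_mem hi]
      have := Finset.card_pos.2 ⟨i, hi⟩
      omega
  · refine (stab_bijective n).1 (Loc_injective n (funext fun J => ?_))
    rw [Loc_stab_fTilde, hζ, map_zero, map_zero]
    -- The value at `x_J` uses only the nonempty sets `J ∪ i`, so the summand `k = 0` is
    -- annihilated.
    refine Finset.sum_eq_zero fun i hi => ?_
    rw [Loc_inclCoh_of_card_ne, mul_zero]
    exact Finset.card_ne_zero.2 ⟨i, Finset.mem_insert_self i J⟩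
  · refine (stab_bijective n).1 (Loc_injective n (funext fun J => ?_))
    rw [Loc_stab_eTilde, hζ, map_zero, map_zero]
    -- Here only the sets `J ∖ m`, of size less than `n`, occur.
    refine Finset.sum_eq_zero fun i hi => ?_
    rw [Loc_inclCoh_of_card_ne, map_zero, mul_zero]
    have h1 := Finset.card_erase_lt_of_mem hi
    have h2 := J.card_le_univ
    rw [Fintype.card_fin] at h2
    omega
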